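/- **Setting.** Let $\mathbb D$ be the open unit disk. Let $\{\alpha_{n,N}\}_{n,N\ge 0}\subset\mathbb D$. For each $N$, define monic polynomials by $\Phi_{0,N}=1$, $\Phi_{n+1,N}(z)=z\Phi_{n,N}(z)-\overline{\alpha_{n,N}}\,\Phi^*_{n,N}(z)$, where $\Phi_{n,N}^*(z)=z^n\overline{\Phi_{n,N}(1/\bar z)}$. For $|\beta|=1$ let $\Phi^{(\beta)}_{n+1,N}(z)=z\Phi_{n,N}(z)-\bar\beta\,\Phi^*_{n,N}(z)$, $n\ge 0$. For $t>0$, a limit as $n/N\to t$ means the limit along every pair of sequences $n_j,N_j\to\infty$ of positive integers with $n_j/N_j\to t$. A quotient converges uniformly on a compact set $K$ as $n/N\to t$ if, along every such pair of sequences, its denominator has no zero in $K$ for all large $j$ and the quotients converge uniformly on $K$. *Limiting zero sets.* $\Lambda_{\beta,t}$ is the set of all $\xi\in\partial\mathbb D$ for which there are $n_j,N_j\to\infty$ with $n_j/N_j\to t$ and $\liminf_{j\to\infty}\operatorname{dist}\bigl(\xi,\{z\in\partial\mathbb D:\Phi^{(\beta)}_{n_j,N_j}(z)=0\}\bigr)=0$;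 moreover $\Lambda_t=\bigcap_{|\beta|=1}\Lambda_{\beta,t}$. *Limit functions.* For $|\gamma|\le1$ put $\rho=\sqrt{1-|\gamma|^2}$ and let $\mathcal C(\gamma)$ be the CMV operator on $\ell^2(\mathbb N_0)$ all of whose Verblunsky coefficients equal $\gamma$, i.e. the operator with matrix $$\begin{pmatrix}\bar\gamma&\bar\gamma\rho&\rho^2&0&0&\cdots\\ \rho&-|\gamma|^2&-\rho\gamma&0&0&\cdots\\ 0&\bar\gamma\rho&-|\gamma|^2&\bar\gamma\rho&\rho^2&\cdots\\ 0&\rho^2&-\rho\gamma&-|\gamma|^2&-\rho\gamma&\cdots\\ 0&0&0&\bar\gamma\rho&-|\gamma|^2&\cdots\\ \vdots&\vdots&\vdots&\vdots&\vdots&\ddots\end{pmatrix}.$$ For $z$ outside its spectrum let $m_\gamma(z)=\langle e_0,(z-\mathcal C(\gamma))^{-1}e_0\rangle$, $F_\gamma(z)=\langle e_0,(\mathcal C(\gamma)+z)(\mathcal C(\gamma)-z)^{-1}e_0\rangle$, and let $f_\gamma(z)=\dfrac1z\,\dfrac{F_\gamma(z)-1}{F_\gamma(z)+1}$, where the values at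 $z=0$ and at isolated points of the spectrum are defined by taking limits. For $a\in[0,1]$ let $\theta_a=2\arcsin a$, $\Gamma_a=\{e^{i\theta}:\theta_a\le\theta\le 2\pi-\theta_a\}$, and $$G_a(z)=\tfrac12\Bigl(z+1+\sqrt{(z-1)^2+4a^2z}\Bigr),\qquad z\in\mathbb C\setminus\Gamma_a,$$ where the square root is analytic on $\mathbb C\setminus\Gamma_a$ and equals $1$ at $z=0$; for $a=0$ it is $1-z$ if $|z|<1$ and $z-1$ if $|z|>1$. **Theorem.** Let $|\beta|=1$, $t>0$, $|\alpha|\le 1$, $a=|\alpha|$, and suppose that $\lim_{n/N\to t}\alpha_{n,N}=\alpha$. Then, as $n/N\to t$: 1. $\dfrac{\Phi_{n,N}}{\Phi^{(\beta)}_{n+1,N}}\to m_{-\bar\alpha\beta}$ uniformly on compact subsets of $\mathbb C\setminus\Lambda_{\beta,t}$. 2. $\dfrac{\Phi_{n,N}}{\Phi^*_{n,N}}\to f_{-\bar\alpha}$ uniformly on compact subsets of $\mathbb C\setminus\Lambda_t$ if $\alpha\ne0$, and of $\mathbb D$ if $\alpha=0$. 3. $\dfrac{\Phi^*_{n+1,N}}{\Phi^*_{n,N}}\to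 G_a$ uniformly on compact subsets of $\mathbb C\setminus\Lambda_t$ if $\alpha\neq0$, and uniformly on $\overline{\mathbb D}$ if $\alpha=0$, where $G_0$ is extended to $\partial\mathbb D$ by its limits from inside $\mathbb D$. 4. $\dfrac{\Phi_{n+1,N}}{\Phi_{n,N}}\to G_a$ uniformly on compact subsets of $\mathbb C\setminus\Lambda_t$ if $\alpha\ne0$, and of $\mathbb C\setminus\mathbb D$ if $\alpha=0$, where $G_0$ is extended to $\partial\mathbb D$ by its limits from outside $\overline{\mathbb D}$. 5. $\dfrac{\Phi^{(\beta)}_{n+1,N}}{\Phi^{(\beta)}_{n,N}}\to G_a$ uniformly on compact subsets of $\mathbb C\setminus\Lambda_{\beta,t}$. -/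

import Mathlib

open Filter Topology Polynomial
open scoped ComplexConjugate

noncomputable section

namespace VaryingOPUC

/-! ### Orthogonal and paraorthogonal polynomials on the unit circle -/

/-- The reversed polynomial `z ^ n * conj (p (1 / conj z))` of a polynomial `p` of degree at most
`n`: the coefficients are conjugated and listed in the opposite order. -/
def revPoly (n : ℕ) (p : ℂ[X]) : ℂ[X] := reflect n (p.map (starRingEnd ℂ))

/-- The monic orthogonal polynomials `Φ_n` with Verblunsky coefficients `a`, generated by the
Szegő recurrence. -/
def opuc (a : ℕ → ℂ) : ℕ → ℂ[X]
  | 0 => 1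
  | n + 1 => X * opuc a n - C (conj (a n)) * revPoly n (opuc a n)

/-- The reversed orthogonal polynomials `Φ_n^*`. -/
def opucStar (a : ℕ → ℂ) (n : ℕ) : ℂ[X] := revPoly n (opuc a n)

/-- The paraorthogonal polynomials `Φ_n^{(β)}` (the value `1` at `n = 0` is a convention). -/
def popuc (a : ℕ → ℂ) (β : ℂ) : ℕ → ℂ[X]
  | 0 => 1
  | n + 1 => X * opuc a n - C (conj β) * opucStar a n

/-! ### The CMV operator on `ℓ²(ℕ₀)` -/

/-- `ρ(α) = √(1 - |α|²)`. -/
def rho (α : ℂ) : ℂ := (Real.sqrt (1 - ‖α‖ ^ 2) : ℝ)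

/-- `prev a j = α_{j-1}`, with the usual convention `α_{-1} = -1` (so that `ρ_{-1} = 0`). -/
def prev (a : ℕ → ℂ) : ℕ → ℂ
  | 0 => -1
  | j + 1 => a j

/-- The entries of the pentadiagonal CMV matrix
```
  conj α₀   conj α₁ ρ₀     ρ₁ ρ₀         0             0        ...
  ρ₀       -conj α₁ α₀    -ρ₁ α₀         0             0        ...
  0         conj α₂ ρ₁    -conj α₂ α₁    conj α₃ ρ₂    ρ₃ ρ₂    ...
  0         ρ₂ ρ₁         -ρ₂ α₁        -conj α₃ α₂   -ρ₃ α₂    ...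
  0         0              0             conj α₄ ρ₃   -conj α₄ α₃ ...
```
with Verblunsky coefficients `a`. -/
def cmvEntry (a : ℕ → ℂ) (j k : ℕ) : ℂ :=
  if Even j then
    if k + 1 = j then conj (a j) * rho (prev a j)
    else if k = j then -(conj (a j) * prev a j)
    else if k = j + 1 then conj (a (j + 1)) * rho (a j)
    else if k = j + 2 then rho (a (j + 1)) * rho (a j)
    else 0
  else
    if k + 2 = j then rho (prev a j) * rho (prev a (j - 1))
    else if k + 1 = j then -(rho (prev a j) * prev a (j - 1))
    else if k = j then -(conj (a j) * prev a j)
    else if k = j + 1 then -(rho (a j) * prev a j)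
    else 0

/-- The Hilbert space `ℓ²(ℕ₀)`. -/
abbrev Ell2 : Type := lp (fun _ : ℕ => ℂ) 2

lemma norm_rho_le (α : ℂ) : ‖rho α‖ ≤ 1 := by
  rw [rho, Complex.norm_real, Real.norm_of_nonneg (Real.sqrt_nonneg _)]
  exact Real.sqrt_le_one.mpr (by nlinarith [sq_nonneg ‖α‖])

lemma norm_cmvEntry_le {a : ℕ → ℂ} {M : ℝ} (hM : 1 ≤ M) (ha : ∀ n, ‖a n‖ ≤ M) (j k : ℕ) :
    ‖cmvEntry a j k‖ ≤ M * M := by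
  have hr : ∀ α, ‖rho α‖ ≤ M := fun α => (norm_rho_le α).trans hM
  have hp : ∀ n, ‖prev a n‖ ≤ M := by
    intro n
    cases n with
    | zero => simpa [prev] using hM
    | succ n => exact ha n
  have h0 : (0 : ℝ) ≤ M := by linarith
  have hmul : ∀ x y : ℂ, ‖x‖ ≤ M → ‖y‖ ≤ M → ‖x * y‖ ≤ M * M := fun x y hx hy => by
    rw [norm_mul]; exact mul_le_mul hx hy (norm_nonneg _) h0
  have hc : ∀ n, ‖conj (a n)‖ ≤ M := fun n => by simpa using ha n
  unfold cmvEntry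
  split_ifs <;> first
    | exact hmul _ _ (hc _) (hr _)
    | exact hmul _ _ (hr _) (hr _)
    | (rw [norm_neg]; exact hmul _ _ (hc _) (hp _))
    | (rw [norm_neg]; exact hmul _ _ (hr _) (hp _))
    | (rw [norm_zero]; positivity)

lemma cmvEntry_eq_zero {a : ℕ → ℂ} {j k : ℕ} (h : k + 2 < j ∨ j + 2 < k) :
    cmvEntry a j k = 0 := by
  unfold cmvEntry
  split_ifs <;> first | rfl | omega

lemma memℓp_cmv {a : ℕ → ℂ} (ha : ∃ M, ∀ n, ‖a n‖ ≤ M) (x : Ell2) :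
    Memℓp (fun j : ℕ => ∑ k ∈ Finset.range (j + 3), cmvEntry a j k * x k) 2 := by
  obtain ⟨M₀, hM₀⟩ := ha
  set M := max M₀ 1
  have hM : ∀ n, ‖a n‖ ≤ M := fun n => (hM₀ n).trans (le_max_left _ _)
  have hE := norm_cmvEntry_le (le_max_right M₀ 1) hM
  have hsum : Summable fun n : ℕ => ‖x n‖ ^ 2 := by
    have := (lp.memℓp x).summable (by norm_num)
    simpa using this
  -- the first two coordinates are split off, so that the indices can be shifted
  have key : Summable fun i : ℕ =>
      ‖∑ k ∈ Finset.range (i + 2 + 3), cmvEntry a (i + 2) k * x k‖ ^ 2 := by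
    have hb : Summable fun i : ℕ => (M * M) ^ 2 * (5 * (‖x i‖ ^ 2 + ‖x (i + 1)‖ ^ 2
        + ‖x (i + 2)‖ ^ 2 + ‖x (i + 3)‖ ^ 2 + ‖x (i + 4)‖ ^ 2)) := by
      have hs : ∀ d, Summable fun i : ℕ => ‖x (i + d)‖ ^ 2 := fun d =>
        (summable_nat_add_iff (f := fun n : ℕ => ‖x n‖ ^ 2) d).mpr hsum
      exact (((((hs 0).add (hs 1)).add (hs 2)).add (hs 3)).add (hs 4)).mul_left 5 |>.mul_left _
    refine Summable.of_nonneg_of_le (fun i => by positivity) (fun i => ?_) hb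
    have h1 : ∑ k ∈ Finset.range (i + 2 + 3), cmvEntry a (i + 2) k * x k
        = ∑ d ∈ Finset.range 5, cmvEntry a (i + 2) (i + d) * x (i + d) := by
      rw [show i + 2 + 3 = i + 5 by ring, Finset.sum_range_add, Finset.sum_eq_zero, zero_add]
      intro k hk
      rw [cmvEntry_eq_zero (Or.inl (by have := Finset.mem_range.mp hk; omega)), zero_mul]
    have h2 : ‖∑ k ∈ Finset.range (i + 2 + 3), cmvEntry a (i + 2) k * x k‖
        ≤ M * M * (‖x i‖ + ‖x (i + 1)‖ + ‖x (i + 2)‖ + ‖x (i + 3)‖ + ‖x (i + 4)‖) := by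
      rw [h1]
      refine (norm_sum_le _ _).trans ?_
      have : ∀ d ∈ Finset.range 5, ‖cmvEntry a (i + 2) (i + d) * x (i + d)‖
          ≤ M * M * ‖x (i + d)‖ := fun d _ => by
        rw [norm_mul]; exact mul_le_mul_of_nonneg_right (hE _ _) (norm_nonneg _)
      refine (Finset.sum_le_sum this).trans (le_of_eq ?_)
      simp [Finset.sum_range_succ]; ring
    calc _ ≤ (M * M * (‖x i‖ + ‖x (i + 1)‖ + ‖x (i + 2)‖ + ‖x (i + 3)‖ + ‖x (i + 4)‖)) ^ 2 :=
          pow_le_pow_left₀ (norm_nonneg _) h2 2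
      _ ≤ _ := by
          rw [mul_pow]
          refine mul_le_mul_of_nonneg_left ?_ (by positivity)
          generalize ‖x i‖ = p
          generalize ‖x (i + 1)‖ = q
          generalize ‖x (i + 2)‖ = r
          generalize ‖x (i + 3)‖ = s
          generalize ‖x (i + 4)‖ = u
          nlinarith [sq_nonneg (p - q), sq_nonneg (p - r), sq_nonneg (p - s), sq_nonneg (p - u),
            sq_nonneg (q - r), sq_nonneg (q - s), sq_nonneg (q - u), sq_nonneg (r - s),
            sq_nonneg (r - u), sq_nonneg (s - u)]
  refine memℓp_gen ?_
  have := (summable_nat_add_iff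
    (f := fun j : ℕ => ‖∑ k ∈ Finset.range (j + 3), cmvEntry a j k * x k‖ ^ 2) 2).mp key
  simpa using this

/-- The linear map of the CMV matrix on `ℓ²(ℕ₀)`. Row `j` of the matrix vanishes beyond
column `j + 2`, so the sum is the full matrix-vector product. -/
def cmvLin (a : ℕ → ℂ) (ha : ∃ M, ∀ n, ‖a n‖ ≤ M) : Ell2 →ₗ[ℂ] Ell2 where
  toFun x := ⟨fun j => ∑ k ∈ Finset.range (j + 3), cmvEntry a j k * x k, memℓp_cmv ha x⟩
  map_add' x y := by
    ext j
    change ∑ k ∈ Finset.range (j + 3), cmvEntry a j k * (x k + y k) = _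
    simp only [mul_add, Finset.sum_add_distrib]
    rfl
  map_smul' c x := by
    ext j
    simp [Finset.mul_sum, mul_left_comm]

/-- The CMV operator `𝒞` on `ℓ²(ℕ₀)` with Verblunsky coefficients `a`. -/
def cmv (a : ℕ → ℂ) (ha : ∃ M, ∀ n, ‖a n‖ ≤ M) : Ell2 →L[ℂ] Ell2 :=
  ContinuousLinearMap.ofSeqClosedGraph (g := cmvLin a ha) <| by
    intro u x y hu hy
    ext j
    have h1 : Tendsto (fun i => (cmvLin a ha (u i)) j) atTop (𝓝 (y j)) :=
      ((lp.evalCLM ℂ (fun _ : ℕ => ℂ) 2 j).continuous.tendsto y).comp hy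
    have h2 : Tendsto (fun i => (cmvLin a ha (u i)) j) atTop (𝓝 ((cmvLin a ha x) j)) := by
      change Tendsto (fun i => ∑ k ∈ Finset.range (j + 3), cmvEntry a j k * u i k) atTop
        (𝓝 (∑ k ∈ Finset.range (j + 3), cmvEntry a j k * x k))
      refine tendsto_finsetSum _ fun k _ => Tendsto.const_mul _ ?_
      exact ((lp.evalCLM ℂ (fun _ : ℕ => ℂ) 2 k).continuous.tendsto x).comp hu
    exact tendsto_nhds_unique h1 h2

/-- The CMV operator `𝒞(γ)` with constant Verblunsky coefficients `γ`. -/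
def constCMV (γ : ℂ) : Ell2 →L[ℂ] Ell2 := cmv (fun _ => γ) ⟨‖γ‖, fun _ => le_rfl⟩

/-- The vector `e₀ ∈ ℓ²(ℕ₀)`. -/
def e0 : Ell2 := lp.single 2 0 1

/-! ### The `m`-function, Carathéodory function and Schur function of `𝒞(γ)` -/

/-- `m_γ(z) = ⟨e₀, (z - 𝒞(γ))⁻¹ e₀⟩` for `z` outside the spectrum of `𝒞(γ)`. -/
def mFun (γ z : ℂ) : ℂ := inner ℂ e0 (resolvent (constCMV γ) z e0)

/-- `F_γ(z) = ⟨e₀, (𝒞(γ) + z) (𝒞(γ) - z)⁻¹ e₀⟩` for `z` outside the spectrum of `𝒞(γ)`. -/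
def caraFun (γ z : ℂ) : ℂ :=
  inner ℂ e0 ((constCMV γ + algebraMap ℂ (Ell2 →L[ℂ] Ell2) z)
    (Ring.inverse (constCMV γ - algebraMap ℂ (Ell2 →L[ℂ] Ell2) z) e0))

/-- The Schur function `f_γ(z) = (1 / z) (F_γ(z) - 1) / (F_γ(z) + 1)`. The values at `z = 0` and
at isolated points of the spectrum (where `F_γ` has a pole or `e₀` does not see the spectrum) are
obtained by taking limits; at all other points outside the spectrum this is the quotient itself,
whenever it is finite. -/
def schurFun (γ z : ℂ) : ℂ :=
  limUnder (𝓝[≠] z) fun w => 1 / w * ((caraFun γ w - 1) / (caraFun γ w + 1))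

/-! ### The function `G_a` -/

/-- The arc `Γ_a = {e^{iθ} | θ_a ≤ θ ≤ 2π - θ_a}`, where `θ_a = 2 arcsin a`. -/
def arc (a : ℝ) : Set ℂ :=
  {z | ∃ θ : ℝ, 2 * Real.arcsin a ≤ θ ∧ θ ≤ 2 * Real.pi - 2 * Real.arcsin a ∧
    z = Complex.exp (θ * Complex.I)}

/-- The square root of `(z - 1)² + 4 a² z` that is analytic off `Γ_a` and equals `1` at `0`,
written through the principal square root. For `a = 0` it is `1 - z` for `|z| < 1` and `z - 1`
for `|z| > 1`. These properties are proved below. -/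
def arcRoot (a : ℝ) (z : ℂ) : ℂ :=
  (z + 1) * Complex.sqrt (((z - 1) ^ 2 + 4 * z * (a : ℂ) ^ 2) / (z + 1) ^ 2)

lemma arcRoot_zero (a : ℝ) : arcRoot a 0 = 1 := by
  simp [arcRoot, Complex.sqrt]

lemma arcRoot_zero_of_norm_lt {z : ℂ} (hz : ‖z‖ < 1) : arcRoot 0 z = 1 - z := by
  have h1 : z + 1 ≠ 0 := fun h => by simp [eq_neg_of_add_eq_zero_left h] at hz
  have hn : z.re * z.re + z.im * z.im < 1 := by
    rw [← Complex.normSq_apply, Complex.normSq_eq_norm_sq]; nlinarith [norm_nonneg z]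
  have hre : 0 < ((1 - z) / (z + 1)).re := by
    rw [Complex.div_re, ← add_div]
    refine div_pos ?_ (Complex.normSq_pos.mpr h1)
    simp; nlinarith
  have : ((z - 1) ^ 2 + 4 * z * ((0 : ℝ) : ℂ) ^ 2) / (z + 1) ^ 2 = ((1 - z) / (z + 1)) ^ 2 := by
    rw [div_pow]; simp; ring
  rw [arcRoot, this, Complex.sqrt, Complex.sq_cpow_two_inv hre]
  field_simp

lemma arcRoot_zero_of_one_lt_norm {z : ℂ} (hz : 1 < ‖z‖) : arcRoot 0 z = z - 1 := by
  have h1 : z + 1 ≠ 0 := fun h => by simp [eq_neg_of_add_eq_zero_left h] at hz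
  have hn : 1 < z.re * z.re + z.im * z.im := by
    rw [← Complex.normSq_apply, Complex.normSq_eq_norm_sq]; nlinarith [norm_nonneg z]
  have hre : 0 < ((z - 1) / (z + 1)).re := by
    rw [Complex.div_re, ← add_div]
    refine div_pos ?_ (Complex.normSq_pos.mpr h1)
    simp; nlinarith
  have : ((z - 1) ^ 2 + 4 * z * ((0 : ℝ) : ℂ) ^ 2) / (z + 1) ^ 2 = ((z - 1) / (z + 1)) ^ 2 := by
    rw [div_pow]; simp
  rw [arcRoot, this, Complex.sqrt, Complex.sq_cpow_two_inv hre]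
  field_simp

lemma neg_one_mem_arc {a : ℝ} : (-1 : ℂ) ∈ arc a := by
  refine ⟨Real.pi, ?_, ?_, by rw [Complex.exp_pi_mul_I]⟩ <;>
    linarith [Real.arcsin_le_pi_div_two a]

lemma arcRoot_sq {a : ℝ} {z : ℂ} (hz : z ∉ arc a) :
    arcRoot a z ^ 2 = (z - 1) ^ 2 + 4 * z * (a : ℂ) ^ 2 := by
  have h1 : z + 1 ≠ 0 := fun h => hz (by rw [eq_neg_of_add_eq_zero_left h]; exact neg_one_mem_arc)
  rw [arcRoot, mul_pow, Complex.sqrt, ← Complex.cpow_nat_mul]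
  simp only [Nat.cast_ofNat, ne_eq, OfNat.ofNat_ne_zero, not_false_eq_true, mul_inv_cancel₀,
    Complex.cpow_one]
  field_simp

/-- Off `Γ_a` the argument of the principal square root avoids `(-∞, 0]`. -/
lemma arcRoot_arg_mem_slitPlane {a : ℝ} (ha0 : 0 ≤ a) (ha1 : a ≤ 1) {z : ℂ} (hz : z ∉ arc a) :
    ((z - 1) ^ 2 + 4 * z * (a : ℂ) ^ 2) / (z + 1) ^ 2 ∈ Complex.slitPlane := by
  by_contra hw
  have h1 : z + 1 ≠ 0 := fun h => hz (by rw [eq_neg_of_add_eq_zero_left h]; exact neg_one_mem_arc)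
  set w := ((z - 1) ^ 2 + 4 * z * (a : ℂ) ^ 2) / (z + 1) ^ 2 with hwdef
  rw [Complex.mem_slitPlane_iff, not_or, not_lt, not_not] at hw
  obtain ⟨hre, him⟩ := hw
  set r : ℝ := -w.re with hr
  have hr0 : 0 ≤ r := by linarith
  have hwr : w = ((-r : ℝ) : ℂ) := Complex.ext (by simp [hr]) (by simpa using him)
  have hq : (z - 1) ^ 2 + 4 * z * (a : ℂ) ^ 2 = ((-r : ℝ) : ℂ) * (z + 1) ^ 2 := by
    rw [← hwr, hwdef]; field_simp
  have hasq : a ^ 2 ≤ 1 := by nlinarith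
  -- real and imaginary parts of `(1 + r) (z + 1)² = 4 (1 - a²) z`
  have hR := congrArg Complex.re hq
  have hI := congrArg Complex.im hq
  simp [pow_two] at hR hI
  obtain ⟨x, y⟩ := z
  simp only at hR hI
  have hnorm : x ^ 2 + y ^ 2 = 1 := by
    by_cases hy : y = 0
    · subst hy
      exfalso
      have h1' : x + 1 ≠ 0 := fun h => h1 (Complex.ext (by simpa using h) (by simp))
      have h2 : 0 < (x + 1) ^ 2 := by positivity
      have h3 : (x - 1) ^ 2 + 4 * x * a ^ 2 = -r * (x + 1) ^ 2 := by nlinarith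
      by_cases hx : 0 ≤ x
      · have h4 : x = 1 ∧ a = 0 := by
          have e1 : 0 ≤ 4 * x * a ^ 2 := by positivity
          have e2 : 0 ≤ r * (x + 1) ^ 2 := by positivity
          have e3 : (x - 1) ^ 2 = 0 := by nlinarith [sq_nonneg (x - 1)]
          have e4 : x = 1 := by nlinarith [pow_eq_zero_iff (two_ne_zero) |>.mp e3]
          refine ⟨e4, ?_⟩
          subst e4
          have : a ^ 2 = 0 := by nlinarith [sq_nonneg a]
          exact pow_eq_zero_iff two_ne_zero |>.mp this
        refine hz ⟨0, by simp [h4.2], by simp [h4.2, Real.pi_pos.le], ?_⟩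
        simp only [Complex.ofReal_zero, zero_mul, Complex.exp_zero]
        exact Complex.ext (by simpa using h4.1) (by simp)
      · nlinarith [mul_nonneg hr0 h2.le, mul_nonneg (by linarith : 0 ≤ -x) (sub_nonneg.mpr hasq)]
    · -- divide the imaginary part by `y`
      have hI' : (1 + r) * (x + 1) = 2 * (1 - a ^ 2) := by
        have : y * ((1 + r) * (x + 1) - 2 * (1 - a ^ 2)) = 0 := by nlinarith
        rcases mul_eq_zero.mp this with h | h
        · exact absurd h hy
        · linarith
      have : (1 + r) * (x ^ 2 + y ^ 2 - 1) = 0 := by nlinarith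
      rcases mul_eq_zero.mp this with h | h <;> linarith
  have hx : x ≤ 1 - 2 * a ^ 2 := by
    have e1 : (1 + r) * (x ^ 2 + 2 * x + 1 - y ^ 2) = 4 * (1 - a ^ 2) * x := by nlinarith
    have e2 : (1 + r) * (2 * (x + 1) * y) = 4 * (1 - a ^ 2) * y := by nlinarith
    have e3 : (1 + r) * (x + 1) = 2 * (1 - a ^ 2) := by
      have f1 : x * ((1 + r) * (x + 1) - 2 * (1 - a ^ 2)) = 0 := by
        have : y ^ 2 = 1 - x ^ 2 := by linarith
        rw [this] at e1
        nlinarith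
      have f2 : y * ((1 + r) * (x + 1) - 2 * (1 - a ^ 2)) = 0 := by nlinarith
      have f3 : (x ^ 2 + y ^ 2) * ((1 + r) * (x + 1) - 2 * (1 - a ^ 2)) = 0 := by
        linear_combination x * f1 + y * f2
      rw [hnorm] at f3
      linarith
    have e4 : 0 ≤ x + 1 := by nlinarith
    nlinarith
  -- a point of the unit circle with real part at most `cos θ_a` is on the arc
  have hs0 : 0 ≤ Real.arcsin a := Real.arcsin_nonneg.mpr ha0
  have hcos : Real.cos (2 * Real.arcsin a) = 1 - 2 * a ^ 2 := by
    rw [Real.cos_two_mul, Real.cos_sq', Real.sin_arcsin (by linarith) ha1]; ring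
  have hx1 : -1 ≤ x := by nlinarith
  have hle : 2 * Real.arcsin a ≤ Real.arccos x := by
    rw [← Real.arccos_cos (x := 2 * Real.arcsin a) (by linarith)
      (by linarith [Real.arcsin_le_pi_div_two a]), hcos]
    exact Real.arccos_le_arccos hx
  have hcx : Real.cos (Real.arccos x) = x := Real.cos_arccos hx1 (by nlinarith)
  have hsx : Real.sin (Real.arccos x) = |y| := by
    rw [Real.sin_arccos, show 1 - x ^ 2 = y ^ 2 by linarith, Real.sqrt_sq_eq_abs]
  have hpi := Real.arccos_le_pi x
  rcases abs_cases y with ⟨h, -⟩ | ⟨h, -⟩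
  · refine hz ⟨Real.arccos x, hle, by linarith [Real.arcsin_le_pi_div_two a], ?_⟩
    rw [Complex.exp_mul_I, ← Complex.ofReal_cos, ← Complex.ofReal_sin, hcx, hsx, h]
    exact Complex.ext (by simp) (by simp)
  · refine hz ⟨2 * Real.pi - Real.arccos x, by linarith [Real.arcsin_le_pi_div_two a],
      by linarith, ?_⟩
    rw [Complex.exp_mul_I, ← Complex.ofReal_cos, ← Complex.ofReal_sin,
      Real.cos_two_pi_sub, Real.sin_two_pi_sub, hcx, hsx, h]
    exact Complex.ext (by simp) (by simp)

lemma differentiableOn_arcRoot {a : ℝ} (ha0 : 0 ≤ a) (ha1 : a ≤ 1) :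
    DifferentiableOn ℂ (arcRoot a) (arc a)ᶜ := by
  intro z hz
  have h1 : z + 1 ≠ 0 := fun h => hz (by rw [eq_neg_of_add_eq_zero_left h]; exact neg_one_mem_arc)
  have hs := arcRoot_arg_mem_slitPlane ha0 ha1 hz
  have h2 : (z + 1) ^ 2 ≠ 0 := pow_ne_zero 2 h1
  refine DifferentiableAt.differentiableWithinAt ?_
  unfold arcRoot Complex.sqrt
  refine DifferentiableAt.mul (by fun_prop) (DifferentiableAt.cpow ?_ (by fun_prop) hs)
  exact DifferentiableAt.div (by fun_prop) (by fun_prop) h2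

/-- `G_a(z) = (z + 1 + √((z - 1)² + 4 a² z)) / 2`, for `z` outside `Γ_a`. -/
def G (a : ℝ) (z : ℂ) : ℂ := 1 / 2 * (z + 1 + arcRoot a z)

/-! ### Limits along `n / N → t` and the limiting zero sets -/

/-- The index sequences over which a limit `n / N → t` is taken: `n_j, N_j → ∞` and
`n_j / N_j → t`. -/
def RatioSeq (t : ℝ) (n N : ℕ → ℕ) : Prop :=
  Tendsto n atTop atTop ∧ Tendsto N atTop atTop ∧
    Tendsto (fun j => (n j : ℝ) / (N j : ℝ)) atTop (𝓝 t)

/-- `lim_{n/N → t} x_{n,N} = l`. -/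
def RatioTendsto (t : ℝ) (x : ℕ → ℕ → ℂ) (l : ℂ) : Prop :=
  ∀ n N : ℕ → ℕ, RatioSeq t n N → Tendsto (fun j => x (n j) (N j)) atTop (𝓝 l)

/-- `lim_{n/N → t} P_{n,N}(z) / Q_{n,N}(z) = g(z)` uniformly on compact subsets of `S`. On each
compact set the denominators are eventually free of zeros, so that the quotients make sense. -/
def RatioTendstoOnCompacts (t : ℝ) (P Q : ℕ → ℕ → ℂ[X]) (g : ℂ → ℂ) (S : Set ℂ) : Prop :=
  ∀ n N : ℕ → ℕ, RatioSeq t n N → ∀ K : Set ℂ, K ⊆ S → IsCompact K →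
    (∀ᶠ j in atTop, ∀ z ∈ K, (Q (n j) (N j)).eval z ≠ 0) ∧
    TendstoUniformlyOn (fun j z => (P (n j) (N j)).eval z / (Q (n j) (N j)).eval z) g atTop K

/-- For a doubly indexed family `α_{n,N}` (written `α n N`), the coefficients `n ↦ α_{n,N}`. -/
def coeffs (α : ℕ → ℕ → ℂ) (N : ℕ) : ℕ → ℂ := fun n => α n N

/-- The zero set of `Φ_{n,N}^{(β)}` on the unit circle. -/
def popucZeros (α : ℕ → ℕ → ℂ) (β : ℂ) (n N : ℕ) : Set ℂ :=
  {z | ‖z‖ = 1 ∧ (popuc (coeffs α N) β n).eval z = 0}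

/-- The set `Λ_{β,t}` of limit points of zeros of `Φ_{n,N}^{(β)}` as `n / N → t`. -/
def limitZeros (α : ℕ → ℕ → ℂ) (t : ℝ) (β : ℂ) : Set ℂ :=
  {ξ | ‖ξ‖ = 1 ∧ ∃ n N : ℕ → ℕ, RatioSeq t n N ∧
    liminf (fun j => Metric.infEDist ξ (popucZeros α β (n j) (N j))) atTop = 0}

/-- The set `Λ_t`, the intersection of all `Λ_{β,t}` with `|β| = 1`. -/
def limitZerosInter (α : ℕ → ℕ → ℂ) (t : ℝ) : Set ℂ :=
  {ξ | ∀ β : ℂ, ‖β‖ = 1 → ξ ∈ limitZeros α t β}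

end VaryingOPUC

end

open VaryingOPUC

namespace VaryingOPUC

/-! ### Orthogonal polynomials: recurrences and reflection -/

/-! Two families carry the proof: the Schur iterates f_n = Φ_n / Φ_n^* and the quotients m_n = Φ_n /
Φ_{n+1}^{(β)}. The other quotients are rational expressions in these, in z and in the current
Verblunsky coefficient.

In the disc, f_{n+1} comes from z f_n by a Möbius step with parameter -conj α_n. The step does not
increase pseudohyperbolic distance, and multiplication by z with |z| ≤ r contracts it by the factor
2r / (1 + r²) (`pseudoDist_schurStep_le`). The condition n/N → t survives shifts of n, so for each
fixed k the last k parameters all tend to the same limit. Hence f_n forgets its past and approaches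
the fixed point c / (G_a - z), c = -conj α, of the limiting step (`eventually_pseudoDist_le`,
`schur_fixed_point`). The reflection z ↦ 1 / conj z gives the exterior.

On the circle, m_n is the Cauchy transform of a probability measure on the zeros of Φ_{n+1}^{(β)}
(`exists_partial_fractions`). Where the zeros keep a distance δ, the m_n are bounded by 1/δ and
Lipschitz with constant 1/δ², so limits found in the disc extend to the circle
(`HasGap.tendsto_of_norm_eq_one`). The limit function must be continuous there, so Γ_a has to
consist of limits of zeros (`arc_subset_limitZeros`). For a < 1: at a point ξ of the circle free of
zeros, Re(ξ m_n) = 1/2, which forces |f| → 1 at ξ, while the fixed point equation gives |1 - w|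
|f(w)| ≤ 2a; thus |1 - ξ| ≤ 2a. Such ξ form an open subset of the circle, which therefore misses
Γ_a. For a = 1, Γ_a = {-1}, and a gap at -1 would make zero-free quotients converge to z + 1,
against the maximum principle.

The limits are identified with functions of 𝒞(γ) by factoring it into two block diagonal unitaries.
The resolvent equation becomes tridiagonal and has a geometric solution of ratio (z + 1 - G_a) /
G_a, of modulus less than 1 off Γ_a (`mFun_eq_of_geometric`). Invertibility off the circle is
unitarity; on the circle it follows from a numerical range estimate (`re_inner_constCMV_le`). -/

lemma opuc_succ (a : ℕ → ℂ) (n : ℕ) :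
    opuc a (n + 1) = X * opuc a n - C (conj (a n)) * opucStar a n := rfl

lemma opucStar_zero (a : ℕ → ℂ) : opucStar a 0 = 1 := by
  simp [opucStar, revPoly, opuc]

lemma natDegree_revPoly_le (n : ℕ) {p : ℂ[X]} (hp : p.natDegree ≤ n) :
    (revPoly n p).natDegree ≤ n := by
  rw [natDegree_le_iff_coeff_eq_zero]
  intro k hk
  rw [revPoly, coeff_reflect, revAt_eq_self_of_lt hk, coeff_map,
    coeff_eq_zero_of_natDegree_lt (hp.trans_lt hk), map_zero]

lemma natDegree_opuc_le (a : ℕ → ℂ) (n : ℕ) : (opuc a n).natDegree ≤ n := by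
  induction n with
  | zero => simp [opuc]
  | succ n ih =>
    rw [opuc_succ]
    refine (natDegree_sub_le _ _).trans (max_le ?_ ?_)
    · exact natDegree_mul_le.trans (by rw [natDegree_X]; omega)
    · exact (natDegree_C_mul_le _ _).trans ((natDegree_revPoly_le n ih).trans (by omega))

lemma natDegree_opucStar_le (a : ℕ → ℂ) (n : ℕ) : (opucStar a n).natDegree ≤ n :=
  natDegree_revPoly_le n (natDegree_opuc_le a n)

lemma coeff_X_mul_sub (a : ℕ → ℂ) (c : ℂ) (n : ℕ) :
    (X * opuc a n - C c * opucStar a n).coeff (n + 1) = (opuc a n).coeff n := by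
  rw [coeff_sub, coeff_X_mul, coeff_C_mul,
    coeff_eq_zero_of_natDegree_lt (Nat.lt_succ_of_le (natDegree_opucStar_le a n))]
  simp

lemma coeff_opuc_self (a : ℕ → ℂ) (n : ℕ) : (opuc a n).coeff n = 1 := by
  induction n with
  | zero => simp [opuc]
  | succ n ih => rw [opuc_succ, coeff_X_mul_sub, ih]

lemma natDegree_opuc (a : ℕ → ℂ) (n : ℕ) : (opuc a n).natDegree = n :=
  le_antisymm (natDegree_opuc_le a n)
    (le_natDegree_of_ne_zero (by rw [coeff_opuc_self]; exact one_ne_zero))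

lemma opuc_monic (a : ℕ → ℂ) (n : ℕ) : (opuc a n).Monic := by
  rw [Monic, leadingCoeff, natDegree_opuc, coeff_opuc_self]

lemma natDegree_popuc_succ (a : ℕ → ℂ) (β : ℂ) (n : ℕ) :
    (popuc a β (n + 1)).natDegree = n + 1 := by
  refine le_antisymm ?_ (le_natDegree_of_ne_zero ?_)
  · refine (natDegree_sub_le _ _).trans (max_le ?_ ?_)
    · exact natDegree_mul_le.trans (by rw [natDegree_X, natDegree_opuc]; omega)
    · exact (natDegree_C_mul_le _ _).trans ((natDegree_opucStar_le a n).trans (by omega))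
  · rw [popuc, coeff_X_mul_sub, coeff_opuc_self]; exact one_ne_zero

lemma popuc_succ_monic (a : ℕ → ℂ) (β : ℂ) (n : ℕ) : (popuc a β (n + 1)).Monic := by
  rw [Monic, leadingCoeff, natDegree_popuc_succ, popuc, coeff_X_mul_sub, coeff_opuc_self]

lemma opucStar_succ (a : ℕ → ℂ) (n : ℕ) :
    opucStar a (n + 1) = opucStar a n - C (a n) * (X * opuc a n) := by
  have h1 : reflect (n + 1) (X * (opuc a n).map (starRingEnd ℂ)) = opucStar a n := by
    rw [add_comm, reflect_mul _ _ (natDegree_X_le) (natDegree_map_le.trans (natDegree_opuc_le a n)),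
      reflect_one_X, one_mul]
    rfl
  have h3 : (opucStar a n).map (starRingEnd ℂ) = reflect n (opuc a n) := by
    ext k
    simp [opucStar, revPoly, coeff_reflect]
  -- Reflecting a polynomial of degree at most n in degree n + 1 instead of n costs a factor X,
  -- which is the reflection of 1 in degree 1.
  have h2 : reflect (n + 1) ((opucStar a n).map (starRingEnd ℂ)) = X * opuc a n := by
    have h4 : reflect 1 (1 : ℂ[X]) = X := by
      simp
    have h5 : reflect n (reflect n (opuc a n)) = opuc a n := by
      ext k
      simp
    rw [h3]
    have := reflect_mul (1 : ℂ[X]) (reflect n (opuc a n)) (F := 1) (G := n) (by simp) (by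
      rw [← h3]; exact natDegree_map_le.trans (natDegree_opucStar_le a n))
    rw [h4, h5, one_mul, add_comm] at this
    exact this
  rw [opucStar, revPoly, opuc_succ, Polynomial.map_sub, Polynomial.map_mul, Polynomial.map_mul,
    map_X, map_C, reflect_sub, reflect_C_mul, h1, h2]
  simp

section Eval
variable (a : ℕ → ℂ) (β : ℂ) (n : ℕ) (z : ℂ)

lemma eval_opuc_succ : (opuc a (n + 1)).eval z
    = z * (opuc a n).eval z - conj (a n) * (opucStar a n).eval z := by
  simp [opuc_succ]

lemma eval_opucStar_succ : (opucStar a (n + 1)).eval z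
    = (opucStar a n).eval z - a n * (z * (opuc a n).eval z) := by
  simp [opucStar_succ]

lemma eval_popuc_succ : (popuc a β (n + 1)).eval z
    = z * (opuc a n).eval z - conj β * (opucStar a n).eval z := by
  simp [popuc]

end Eval

/-- The reflection `z ↦ 1 / conj z` exchanges `Φ_n` and `Φ_n^*`. -/
lemma eval_reflection (a : ℕ → ℂ) (n : ℕ) {z : ℂ} (hz : z ≠ 0) :
    (opucStar a n).eval z = z ^ n * conj ((opuc a n).eval (1 / conj z)) ∧
    (opuc a n).eval z = z ^ n * conj ((opucStar a n).eval (1 / conj z)) := by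
  induction n with
  | zero => simp [opuc, opucStar_zero]
  | succ n ih =>
    obtain ⟨h1, h2⟩ := ih
    constructor
    · rw [eval_opucStar_succ, eval_opuc_succ, h1]
      rw [h2]
      simp only [map_sub, map_mul, map_div₀, map_one, Complex.conj_conj]
      field_simp
      ring
    · rw [eval_opucStar_succ, eval_opuc_succ, h1, h2]
      simp only [map_sub, map_mul, map_div₀, map_one, Complex.conj_conj]
      field_simp
      ring

/-! ### Location of the zeros. -/

lemma one_div_conj_of_norm_eq_one {z : ℂ} (hz : ‖z‖ = 1) : 1 / conj z = z := by
  have : z * conj z = 1 := by rw [Complex.mul_conj']; simp [hz]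
  have h0 : conj z ≠ 0 := right_ne_zero_of_mul_eq_one this
  rw [div_eq_iff h0, this]

lemma eval_opucStar_circle (a : ℕ → ℂ) (n : ℕ) {z : ℂ} (hz : ‖z‖ = 1) :
    (opucStar a n).eval z = z ^ n * conj ((opuc a n).eval z) := by
  have := (eval_reflection a n (z := z) (by rintro rfl; simp at hz)).1
  rwa [one_div_conj_of_norm_eq_one hz] at this

/-- With u = zΦ_n and v = Φ_n^* this is how the Szegő recurrence acts on |Φ^*|² - |Φ|². It also
shows that Schur steps map the disc into itself. -/
lemma normSq_mobius (γ u v : ℂ) :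
    ‖v - γ * u‖ ^ 2 - ‖u - conj γ * v‖ ^ 2 = (1 - ‖γ‖ ^ 2) * (‖v‖ ^ 2 - ‖u‖ ^ 2) := by
  simp only [← Complex.normSq_eq_norm_sq, Complex.normSq_apply]
  simp
  ring

/-- In the closed unit disc `Φ_n^*` has no zeros and dominates `Φ_n`. -/
lemma opucStar_dominates {a : ℕ → ℂ} (ha : ∀ n, ‖a n‖ < 1) (n : ℕ) {z : ℂ} (hz : ‖z‖ ≤ 1) :
    (opucStar a n).eval z ≠ 0 ∧ ‖(opuc a n).eval z‖ ≤ ‖(opucStar a n).eval z‖ := by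
  induction n with
  | zero => simp [opuc, opucStar_zero]
  | succ n ih =>
    obtain ⟨h0, h1⟩ := ih
    have hu : ‖z * (opuc a n).eval z‖ ≤ ‖(opucStar a n).eval z‖ := by
      rw [norm_mul]
      exact (mul_le_of_le_one_left (norm_nonneg _) hz).trans h1
    have hpos : 0 < ‖(opucStar a n).eval z‖ := norm_pos_iff.mpr h0
    constructor
    · rw [eval_opucStar_succ, sub_ne_zero]
      intro h
      have := congrArg norm h
      rw [norm_mul] at this
      nlinarith [ha n, norm_nonneg (a n), norm_nonneg (z * (opuc a n).eval z)]
    · have key := normSq_mobius (a n) (z * (opuc a n).eval z) ((opucStar a n).eval z)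
      rw [← eval_opucStar_succ, ← eval_opuc_succ] at key
      have h2 : 0 ≤ (1 - ‖a n‖ ^ 2) *
          (‖(opucStar a n).eval z‖ ^ 2 - ‖z * (opuc a n).eval z‖ ^ 2) := by
        have := ha n
        refine mul_nonneg (by nlinarith [norm_nonneg (a n)]) (by
          nlinarith [norm_nonneg (z * (opuc a n).eval z)])
      exact (sq_le_sq₀ (norm_nonneg _) (norm_nonneg _)).mp (by linarith)

lemma opuc_dominates {a : ℕ → ℂ} (ha : ∀ n, ‖a n‖ < 1) (n : ℕ) {z : ℂ} (hz : 1 ≤ ‖z‖) :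
    (opuc a n).eval z ≠ 0 ∧ ‖(opucStar a n).eval z‖ ≤ ‖(opuc a n).eval z‖ := by
  have hz0 : z ≠ 0 := by rintro rfl; simp at hz; linarith
  obtain ⟨h1, h2⟩ := eval_reflection a n hz0
  have hy : ‖1 / conj z‖ ≤ 1 := by
    rw [norm_div, norm_one, RCLike.norm_conj]
    exact (div_le_one (by linarith)).mpr hz
  obtain ⟨h3, h4⟩ := opucStar_dominates ha n hy
  rw [h1, h2]
  refine ⟨mul_ne_zero (pow_ne_zero _ hz0) (by simpa using h3), ?_⟩
  rw [norm_mul, norm_mul, RCLike.norm_conj, RCLike.norm_conj]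
  gcongr

/-- The zeros of `Φ_{n+1}^{(β)}` lie on the unit circle. -/
lemma norm_eq_one_of_popuc_eq_zero {a : ℕ → ℂ} (ha : ∀ n, ‖a n‖ < 1) {β : ℂ} (hβ : ‖β‖ = 1)
    (n : ℕ) {z : ℂ} (h : (popuc a β n).eval z = 0) : ‖z‖ = 1 := by
  cases n with
  | zero => simp [popuc] at h
  | succ n =>
    -- A zero gives |z| |Φ_n| = |Φ_n^*|, which the domination inequalities exclude off the circle.
    rw [eval_popuc_succ, sub_eq_zero] at h
    have h' := congrArg norm h
    rw [norm_mul, norm_mul, RCLike.norm_conj, hβ, one_mul] at h'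
    rcases lt_trichotomy ‖z‖ 1 with hz | hz | hz
    · obtain ⟨h0, h1⟩ := opucStar_dominates ha n hz.le
      have := norm_pos_iff.mpr h0
      nlinarith [norm_nonneg z]
    · exact hz
    · obtain ⟨h0, h1⟩ := opuc_dominates ha n hz.le
      have := norm_pos_iff.mpr h0
      nlinarith [norm_nonneg z]

/-! ### Partial fractions of `Φ_n / Φ_{n+1}^{(β)}` -/

/-- On the circle Φ_n Φ_n^* = z^n |Φ_n|², so c / |Φ_n|² is the angular derivative of the argument of
Φ_n / Φ_n^*. One recurrence step replaces c by (1 - |α_n|²)(|Φ_n|² + c), which keeps it nonnegative.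
-/
lemma exists_wronskian {a : ℕ → ℂ} (ha : ∀ n, ‖a n‖ < 1) (n : ℕ) {z : ℂ} (hz : ‖z‖ = 1) :
    ∃ c : ℝ, 0 ≤ c ∧ z * ((derivative (opuc a n)).eval z * (opucStar a n).eval z
      - (opuc a n).eval z * (derivative (opucStar a n)).eval z) = z ^ n * c := by
  induction n with
  | zero => exact ⟨0, le_rfl, by simp [opuc, opucStar_zero]⟩
  | succ n ih =>
    obtain ⟨c, hc, h⟩ := ih
    refine ⟨(1 - ‖a n‖ ^ 2) * (‖(opuc a n).eval z‖ ^ 2 + c), ?_, ?_⟩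
    · have := ha n
      exact mul_nonneg (by nlinarith [norm_nonneg (a n)]) (by positivity)
    · have hs : (opuc a n).eval z * (opucStar a n).eval z
          = z ^ n * (‖(opuc a n).eval z‖ ^ 2 : ℝ) := by
        rw [eval_opucStar_circle a n hz]
        have := Complex.mul_conj' ((opuc a n).eval z)
        push_cast
        rw [← this]; ring
      have ha2 := Complex.mul_conj' (a n)
      rw [opuc_succ, opucStar_succ]
      simp only [derivative_sub, derivative_mul, derivative_X, derivative_C, eval_sub, eval_mul,
        eval_add, eval_X, eval_C, eval_one, eval_zero]
      push_cast at hs ⊢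
      rw [← ha2]
      linear_combination (1 - a n * conj (a n)) * z * (hs + h)

/-- At a zero, zΦ_n = conj β Φ_n^*, so the derivative times Φ_n^* becomes z^n (|Φ_n|² + c) with the
Wronskian constant c ≥ 0. Hence the zero is simple, and the residue of Φ_n / Φ_{n+1}^{(β)} is |Φ_n|²
/ (|Φ_n|² + c). -/
lemma exists_popuc_residue {a : ℕ → ℂ} (ha : ∀ n, ‖a n‖ < 1) {β : ℂ} (hβ : ‖β‖ = 1) (n : ℕ)
    {z : ℂ} (h : (popuc a β (n + 1)).eval z = 0) :
    (derivative (popuc a β (n + 1))).eval z ≠ 0 ∧ ∃ r : ℝ, 0 ≤ r ∧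
      (opuc a n).eval z = r * (derivative (popuc a β (n + 1))).eval z := by
  have hz := norm_eq_one_of_popuc_eq_zero ha hβ (n + 1) h
  have hz0 : z ≠ 0 := by rintro rfl; simp at hz
  obtain ⟨c, hc, hw⟩ := exists_wronskian ha n hz
  obtain ⟨h0, -⟩ := opucStar_dominates ha n hz.le
  obtain ⟨h0', -⟩ := opuc_dominates ha n hz.ge
  set S : ℝ := ‖(opuc a n).eval z‖ ^ 2 with hS
  have hSpos : 0 < S := by have := norm_pos_iff.mpr h0'; positivity
  have hs : (opuc a n).eval z * (opucStar a n).eval z = z ^ n * (S : ℝ) := by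
    rw [eval_opucStar_circle a n hz, hS]
    have := Complex.mul_conj' ((opuc a n).eval z)
    push_cast
    rw [← this]; ring
  rw [eval_popuc_succ] at h
  have key : (derivative (popuc a β (n + 1))).eval z * (opucStar a n).eval z
      = z ^ n * ((S + c : ℝ) : ℂ) := by
    rw [popuc]
    simp only [derivative_sub, derivative_mul, derivative_X, derivative_C, eval_sub, eval_mul,
      eval_add, eval_X, eval_C, eval_one, eval_zero]
    push_cast at hs hw ⊢
    linear_combination hs + hw + (derivative (opucStar a n)).eval z * h
  have hSc : ((S + c : ℝ) : ℂ) ≠ 0 := by exact_mod_cast (by positivity : S + c ≠ 0)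
  have hne : z ^ n * ((S + c : ℝ) : ℂ) ≠ 0 := mul_ne_zero (pow_ne_zero _ hz0) hSc
  refine ⟨left_ne_zero_of_mul (key ▸ hne), S / (S + c), by positivity, ?_⟩
  apply mul_right_cancel₀ h0
  rw [hs, mul_assoc, key]
  push_cast at hSc ⊢
  field_simp

/-- `Φ_n / Φ_{n+1}^{(β)}` is the Cauchy transform of a probability measure supported by the zeros
of `Φ_{n+1}^{(β)}`. -/
lemma exists_partial_fractions {a : ℕ → ℂ} (ha : ∀ n, ‖a n‖ < 1) {β : ℂ} (hβ : ‖β‖ = 1) (n : ℕ) :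
    ∃ (s : Finset ℂ) (r : ℂ → ℝ), (∀ x ∈ s, ‖x‖ = 1 ∧ (popuc a β (n + 1)).eval x = 0) ∧
      (∀ x ∈ s, 0 ≤ r x) ∧ ∑ x ∈ s, r x = 1 ∧
      ∀ z, (popuc a β (n + 1)).eval z ≠ 0 →
        (opuc a n).eval z / (popuc a β (n + 1)).eval z = ∑ x ∈ s, r x / (z - x) := by
  classical
  set P := popuc a β (n + 1) with hP
  have hP0 : P ≠ 0 := (popuc_succ_monic a β n).ne_zero
  have hres := fun z (h : P.eval z = 0) => exists_popuc_residue ha hβ n h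
  set s := P.roots.toFinset with hs
  have hmem : ∀ x ∈ s, P.eval x = 0 := by
    intro x hx
    rw [hs, Multiset.mem_toFinset, mem_roots hP0] at hx
    exact hx
  have hnodup : P.roots.Nodup := by
    rw [Multiset.nodup_iff_count_le_one]
    intro x
    rw [count_roots]
    by_contra hlt
    push Not at hlt
    have hroot := (one_lt_rootMultiplicity_iff_isRoot hP0).mp hlt
    exact (hres x hroot.1).1 hroot.2
  have hcard : s.card = n + 1 := by
    rw [hs, Multiset.toFinset_card_of_nodup hnodup,
      ← (IsAlgClosed.splits P).natDegree_eq_card_roots, natDegree_popuc_succ]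
  have hnodal : Lagrange.nodal s id = P := by
    have := (IsAlgClosed.splits P).eq_prod_roots_of_monic (popuc_succ_monic a β n)
    rw [this, Lagrange.nodal_eq, Finset.prod, hs, Multiset.toFinset_val, hnodup.dedup]
    rfl
  have hinj : Set.InjOn (id : ℂ → ℂ) (s : Set ℂ) := Set.injOn_id _
  choose! r hr0 hr using fun x (hx : x ∈ s) => (hres x (hmem x hx)).2
  -- The nodal polynomial of the zeros is Φ_{n+1}^{(β)} itself, so the terms of Lagrange
  -- interpolation of Φ_n carry exactly the residues.
  have hw : ∀ x ∈ s, Lagrange.nodalWeight s id x * (opuc a n).eval x = r x := by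
    intro x hx
    rw [Lagrange.nodalWeight_eq_eval_derivative_nodal hx, hnodal, id, hr x hx]
    have := (hres x (hmem x hx)).1
    rw [hP]
    field_simp
  have hdeg : (opuc a n).degree < s.card := by
    rw [hcard, degree_eq_natDegree (opuc_monic a n).ne_zero, natDegree_opuc]
    exact_mod_cast Nat.lt_succ_self n
  refine ⟨s, r, fun x hx => ⟨norm_eq_one_of_popuc_eq_zero ha hβ _ (hmem x hx), hmem x hx⟩, hr0,
    ?_, ?_⟩
  -- Φ_n is monic of degree one less than the number of nodes; its leading coefficient is the sum of
  -- the residues.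
  · have h1 := Lagrange.leadingCoeff_eq_sum (P := opuc a n) hinj (by
      rw [hcard, degree_eq_natDegree (opuc_monic a n).ne_zero, natDegree_opuc]; rfl)
    rw [(opuc_monic a n).leadingCoeff] at h1
    have h2 : ((∑ x ∈ s, r x : ℝ) : ℂ) = 1 := by
      rw [h1, Complex.ofReal_sum]
      refine Finset.sum_congr rfl fun x hx => ?_
      rw [← hw x hx, Lagrange.nodalWeight, Finset.prod_inv_distrib, div_eq_mul_inv, mul_comm]
      rfl
    exact_mod_cast h2
  · intro z hz
    have hne : ∀ x ∈ s, z ≠ id x := by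
      rintro x hx rfl
      exact hz (hmem _ hx)
    have h1 : opuc a n = Lagrange.interpolate s id fun x => (opuc a n).eval x :=
      Lagrange.eq_interpolate hinj hdeg
    have h2 := Lagrange.eval_interpolate_not_at_node (fun x => (opuc a n).eval x) hne
    rw [← h1, hnodal] at h2
    rw [h2, mul_div_cancel_left₀ _ hz]
    refine Finset.sum_congr rfl fun x hx => ?_
    rw [← hw x hx, id]
    ring

lemma popuc_eval_ne_zero_of_gap {a : ℕ → ℂ} (ha : ∀ n, ‖a n‖ < 1) {β : ℂ} (hβ : ‖β‖ = 1) {n : ℕ}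
    {δ : ℝ} (hδ : 0 < δ) {z : ℂ}
    (hz : ∀ x, ‖x‖ = 1 → (popuc a β n).eval x = 0 → δ ≤ ‖z - x‖) :
    (popuc a β n).eval z ≠ 0 := by
  intro h
  have := hz z (norm_eq_one_of_popuc_eq_zero ha hβ n h) h
  simp at this
  linarith

lemma norm_opuc_div_popuc_le {a : ℕ → ℂ} (ha : ∀ n, ‖a n‖ < 1) {β : ℂ} (hβ : ‖β‖ = 1) {n : ℕ}
    {δ : ℝ} (hδ : 0 < δ) {z : ℂ}
    (hz : ∀ x, ‖x‖ = 1 → (popuc a β (n + 1)).eval x = 0 → δ ≤ ‖z - x‖) :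
    ‖(opuc a n).eval z / (popuc a β (n + 1)).eval z‖ ≤ 1 / δ := by
  obtain ⟨s, r, hs, hr, hsum, hm⟩ := exists_partial_fractions ha hβ n
  rw [hm z (popuc_eval_ne_zero_of_gap ha hβ hδ hz)]
  calc _ ≤ ∑ x ∈ s, r x * (1 / δ) := by
        refine (norm_sum_le _ _).trans (Finset.sum_le_sum fun x hx => ?_)
        rw [norm_div, Complex.norm_real, Real.norm_of_nonneg (hr x hx), div_eq_mul_one_div]
        have := hz x (hs x hx).1 (hs x hx).2
        have h0 := hr x hx
        gcongr
    _ = 1 / δ := by rw [← Finset.sum_mul, hsum, one_mul]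

/-- The Lipschitz constant depends on the gap only, not on n or on the coefficients. This
equicontinuity carries limits from the disc to the circle. -/
lemma norm_opuc_div_popuc_sub_le {a : ℕ → ℂ} (ha : ∀ n, ‖a n‖ < 1) {β : ℂ} (hβ : ‖β‖ = 1) {n : ℕ}
    {δ : ℝ} (hδ : 0 < δ) {z w : ℂ}
    (hz : ∀ x, ‖x‖ = 1 → (popuc a β (n + 1)).eval x = 0 → δ ≤ ‖z - x‖)
    (hw : ∀ x, ‖x‖ = 1 → (popuc a β (n + 1)).eval x = 0 → δ ≤ ‖w - x‖) :
    ‖(opuc a n).eval z / (popuc a β (n + 1)).eval z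
      - (opuc a n).eval w / (popuc a β (n + 1)).eval w‖ ≤ ‖z - w‖ / δ ^ 2 := by
  obtain ⟨s, r, hs, hr, hsum, hm⟩ := exists_partial_fractions ha hβ n
  rw [hm z (popuc_eval_ne_zero_of_gap ha hβ hδ hz), hm w (popuc_eval_ne_zero_of_gap ha hβ hδ hw),
    ← Finset.sum_sub_distrib]
  calc _ ≤ ∑ x ∈ s, r x * (‖z - w‖ / δ ^ 2) := by
        refine (norm_sum_le _ _).trans (Finset.sum_le_sum fun x hx => ?_)
        have h1 := hz x (hs x hx).1 (hs x hx).2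
        have h2 := hw x (hs x hx).1 (hs x hx).2
        have h0 := hr x hx
        have hz0 : z - x ≠ 0 := norm_pos_iff.mp (by linarith)
        have hw0 : w - x ≠ 0 := norm_pos_iff.mp (by linarith)
        have : (r x : ℂ) / (z - x) - r x / (w - x) = r x * ((w - z) / ((z - x) * (w - x))) := by
          field_simp
          ring
        rw [this, norm_mul, Complex.norm_real, Real.norm_of_nonneg h0, norm_div, norm_mul,
          norm_sub_rev w z, pow_two]
        gcongr
    _ = _ := by rw [← Finset.sum_mul, hsum, one_mul]

/-- For distinct unimodular z and x one has Re(z / (z - x)) = 1/2; the quotient is a convex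
combination of such terms. -/
lemma re_mul_opuc_div_popuc {a : ℕ → ℂ} (ha : ∀ n, ‖a n‖ < 1) {β : ℂ} (hβ : ‖β‖ = 1) {n : ℕ}
    {z : ℂ} (hz : ‖z‖ = 1) (h : (popuc a β (n + 1)).eval z ≠ 0) :
    (z * ((opuc a n).eval z / (popuc a β (n + 1)).eval z)).re = 1 / 2 := by
  obtain ⟨s, r, hs, hr, hsum, hm⟩ := exists_partial_fractions ha hβ n
  rw [hm z h, Finset.mul_sum, Complex.re_sum]
  have key : ∀ x ∈ s, (z * (r x / (z - x))).re = r x * (1 / 2) := by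
    intro x hx
    have hne : z - x ≠ 0 := by
      intro h0
      rw [sub_eq_zero] at h0
      exact h (h0 ▸ (hs x hx).2)
    have e : z * (r x / (z - x)) = (r x : ℝ) * (z / (z - x)) := by ring
    rw [e, Complex.re_ofReal_mul]
    congr 1
    have hx1 : x.re * x.re + x.im * x.im = 1 := by
      rw [← Complex.normSq_apply, Complex.normSq_eq_norm_sq, (hs x hx).1, one_pow]
    have hz1 : z.re * z.re + z.im * z.im = 1 := by
      rw [← Complex.normSq_apply, Complex.normSq_eq_norm_sq, hz, one_pow]
    have hN := (Complex.normSq_pos.mpr hne).ne'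
    rw [Complex.div_re, ← add_div, div_eq_iff hN, Complex.normSq_apply]
    simp only [Complex.sub_re, Complex.sub_im]
    linear_combination (1 / 2) * hz1 - (1 / 2) * hx1
  rw [Finset.sum_congr rfl key, ← Finset.sum_mul, hsum, one_mul]

/-- Eliminating Φ_n^* through conj β Φ_n^* = zΦ_n - Φ_{n+1}^{(β)} leaves only m_n and the
coefficient of index n. Convergence of m_n thus yields that of successive paraorthogonal quotients.
-/
lemma popuc_div_popuc {a : ℕ → ℂ} {β : ℂ} (hβ : ‖β‖ = 1) (n : ℕ) {z : ℂ}
    (h : (popuc a β (n + 1)).eval z ≠ 0) :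
    (popuc a β (n + 2)).eval z / (popuc a β (n + 1)).eval z
      = 1 + z * (conj (a n) * β) + z * ((opuc a n).eval z / (popuc a β (n + 1)).eval z)
        * (z * (1 - conj (a n) * β) - (1 - a n * conj β)) := by
  have hb : β * conj β = 1 := by rw [Complex.mul_conj']; simp [hβ]
  field_simp
  rw [eval_popuc_succ, eval_popuc_succ, eval_opuc_succ, eval_opucStar_succ]
  linear_combination (opucStar a n).eval z * z * conj (a n) * hb

/-! ### The constant CMV operator as a product of block diagonal unitaries -/

lemma rho_conj (c : ℂ) : rho (conj c) = rho c := by simp [rho]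

lemma conj_rho (c : ℂ) : conj (rho c) = rho c := by simp [rho]

lemma rho_sq {c : ℂ} (hc : ‖c‖ ≤ 1) : rho c ^ 2 = 1 - c * conj c := by
  have : 0 ≤ 1 - ‖c‖ ^ 2 := by nlinarith [norm_nonneg c]
  rw [rho, ← Complex.ofReal_pow, Real.sq_sqrt this, Complex.mul_conj']
  push_cast; ring

/-- The direct sum of the blocks `(conj c, ρ; ρ, -c)`, acting on sequences. -/
noncomputable def blockSeq (c : ℂ) (y : ℕ → ℂ) (j : ℕ) : ℂ :=
  if Even j then conj c * y j + rho c * y (j + 1) else rho c * y (j - 1) - c * y j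

/-- The direct sum of `1` and the blocks `(conj c, ρ; ρ, -c)`, acting on sequences. -/
noncomputable def shiftedBlockSeq (c : ℂ) (y : ℕ → ℂ) : ℕ → ℂ
  | 0 => y 0
  | j + 1 => blockSeq c (fun n => y (n + 1)) j

lemma blockSeq_even (c : ℂ) (y : ℕ → ℂ) (k : ℕ) :
    blockSeq c y (2 * k) = conj c * y (2 * k) + rho c * y (2 * k + 1) := by
  simp [blockSeq]

lemma blockSeq_odd (c : ℂ) (y : ℕ → ℂ) (k : ℕ) :
    blockSeq c y (2 * k + 1) = rho c * y (2 * k) - c * y (2 * k + 1) := by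
  simp [blockSeq]

lemma shiftedBlockSeq_zero (c : ℂ) (y : ℕ → ℂ) : shiftedBlockSeq c y 0 = y 0 := rfl

lemma shiftedBlockSeq_odd (c : ℂ) (y : ℕ → ℂ) (k : ℕ) :
    shiftedBlockSeq c y (2 * k + 1) = conj c * y (2 * k + 1) + rho c * y (2 * k + 2) :=
  blockSeq_even c (fun n => y (n + 1)) k

lemma shiftedBlockSeq_even (c : ℂ) (y : ℕ → ℂ) (k : ℕ) :
    shiftedBlockSeq c y (2 * k + 2) = rho c * y (2 * k + 1) - c * y (2 * k + 2) :=
  blockSeq_odd c (fun n => y (n + 1)) k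

lemma eq_of_even_odd {f g : ℕ → ℂ} (he : ∀ k, f (2 * k) = g (2 * k))
    (ho : ∀ k, f (2 * k + 1) = g (2 * k + 1)) : f = g := by
  ext j
  rcases Nat.even_or_odd' j with ⟨k, rfl | rfl⟩
  exacts [he k, ho k]

/-- Each 2 × 2 block is unitary, and its adjoint is the block with parameter conj c. -/
lemma blockSeq_conj_blockSeq {c : ℂ} (hc : ‖c‖ ≤ 1) (y : ℕ → ℂ) :
    blockSeq (conj c) (blockSeq c y) = y := by
  have h := rho_sq hc
  refine eq_of_even_odd (fun k => ?_) fun k => ?_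
  · rw [blockSeq_even, blockSeq_even, blockSeq_odd, rho_conj, Complex.conj_conj]
    linear_combination y (2 * k) * h
  · rw [blockSeq_odd, blockSeq_even, blockSeq_odd, rho_conj]
    linear_combination y (2 * k + 1) * h

lemma shiftedBlockSeq_conj {c : ℂ} (hc : ‖c‖ ≤ 1) (y : ℕ → ℂ) :
    shiftedBlockSeq (conj c) (shiftedBlockSeq c y) = y := by
  ext j
  cases j with
  | zero => rfl
  | succ j => exact congrFun (blockSeq_conj_blockSeq hc fun n => y (n + 1)) j

lemma normSq_block {c : ℂ} (hc : ‖c‖ ≤ 1) (u v : ℂ) :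
    ‖conj c * u + rho c * v‖ ^ 2 + ‖rho c * u - c * v‖ ^ 2 = ‖u‖ ^ 2 + ‖v‖ ^ 2 := by
  have h := rho_sq hc
  have hr := conj_rho c
  have : ((‖conj c * u + rho c * v‖ ^ 2 + ‖rho c * u - c * v‖ ^ 2 : ℝ) : ℂ)
      = ((‖u‖ ^ 2 + ‖v‖ ^ 2 : ℝ) : ℂ) := by
    push_cast
    simp only [← Complex.mul_conj', map_add, map_sub, map_mul, Complex.conj_conj, hr]
    linear_combination (u * conj u + v * conj v) * h
  exact_mod_cast this

lemma hasSum_even_odd {f : ℕ → ℝ} {S : ℝ} (h : HasSum f S) :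
    HasSum (fun k => f (2 * k) + f (2 * k + 1)) S := by
  have he : Summable fun k => f (2 * k) :=
    h.summable.comp_injective (mul_right_injective₀ two_ne_zero)
  have ho : Summable fun k => f (2 * k + 1) :=
    h.summable.comp_injective fun a b hab => by simpa using hab
  rw [h.unique (he.hasSum.even_add_odd ho.hasSum)]
  exact he.hasSum.add ho.hasSum

lemma hasSum_of_even_odd {f : ℕ → ℝ} (hf : ∀ n, 0 ≤ f n) {S : ℝ}
    (h : HasSum (fun k => f (2 * k) + f (2 * k + 1)) S) : HasSum f S := by
  have he : Summable fun k => f (2 * k) :=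
    h.summable.of_nonneg_of_le (fun k => hf _) fun k => by linarith [hf (2 * k + 1)]
  have ho : Summable fun k => f (2 * k + 1) :=
    h.summable.of_nonneg_of_le (fun k => hf _) fun k => by linarith [hf (2 * k)]
  rw [h.unique (he.hasSum.add ho.hasSum)]
  exact he.hasSum.even_add_odd ho.hasSum

lemma hasSum_blockSeq {c : ℂ} (hc : ‖c‖ ≤ 1) {y : ℕ → ℂ} {S : ℝ}
    (h : HasSum (fun n => ‖y n‖ ^ 2) S) : HasSum (fun n => ‖blockSeq c y n‖ ^ 2) S := by
  refine hasSum_of_even_odd (fun n => by positivity) ?_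
  simp only [blockSeq_even, blockSeq_odd, normSq_block hc]
  exact hasSum_even_odd (f := fun n => ‖y n‖ ^ 2) h

lemma hasSum_shiftedBlockSeq {c : ℂ} (hc : ‖c‖ ≤ 1) {y : ℕ → ℂ} {S : ℝ}
    (h : HasSum (fun n => ‖y n‖ ^ 2) S) : HasSum (fun n => ‖shiftedBlockSeq c y n‖ ^ 2) S := by
  rw [← hasSum_nat_add_iff' 1] at h ⊢
  have := hasSum_blockSeq hc h
  simpa [shiftedBlockSeq] using this

lemma hasSum_norm_sq (x : Ell2) : HasSum (fun n => ‖x n‖ ^ 2) (‖x‖ ^ 2) := by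
  have := lp.hasSum_norm (p := 2) (by norm_num) x
  simpa using this

lemma memℓp_of_hasSum {y : ℕ → ℂ} {S : ℝ} (h : HasSum (fun n => ‖y n‖ ^ 2) S) :
    Memℓp y 2 :=
  memℓp_gen (by simpa using h.summable)

lemma norm_sq_eq_of_hasSum {x : Ell2} {S : ℝ} (h : HasSum (fun n => ‖x n‖ ^ 2) S) :
    ‖x‖ ^ 2 = S :=
  (hasSum_norm_sq x).unique h

/-- The factorization of the CMV matrix into two block diagonal unitaries L and M, the blocks of M
being shifted by one place. It replaces the pentadiagonal matrix in all that follows. -/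
lemma constCMV_apply (c : ℂ) (x : Ell2) :
    (constCMV c x : ℕ → ℂ) = blockSeq c (shiftedBlockSeq c x) := by
  have h0 : rho (-1) = 0 := by simp [rho]
  have hdef : ∀ j, constCMV c x j = ∑ k ∈ Finset.range (j + 3), cmvEntry (fun _ => c) j k * x k :=
    fun j => by rw [constCMV, cmv, ContinuousLinearMap.coeFn_ofSeqClosedGraph]; rfl
  -- From row 2 on, only a window of five columns matters. Rows 0 and 1 are computed separately,
  -- since there the convention α_{-1} = -1 enters.
  have hlow : ∀ j, constCMV c x (j + 2)
      = ∑ d ∈ Finset.range 5, cmvEntry (fun _ => c) (j + 2) (j + d) * x (j + d) := by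
    intro j
    rw [hdef, show j + 2 + 3 = j + 5 by ring, Finset.sum_range_add, Finset.sum_eq_zero, zero_add]
    intro k hk
    rw [cmvEntry_eq_zero (Or.inl (by have := Finset.mem_range.mp hk; omega)), zero_mul]
  refine eq_of_even_odd (fun k => ?_) fun k => ?_
  · rw [blockSeq_even]
    cases k with
    | zero =>
      rw [mul_zero, shiftedBlockSeq_zero, show 0 + 1 = 2 * 0 + 1 by rfl, shiftedBlockSeq_odd, hdef]
      simp [Finset.sum_range_succ, cmvEntry, prev]
      ring
    | succ k =>
      have he : Even (2 * k + 2) := ⟨k + 1, by ring⟩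
      rw [show 2 * (k + 1) = 2 * k + 2 by ring, shiftedBlockSeq_even,
        show 2 * k + 2 + 1 = 2 * (k + 1) + 1 by ring, shiftedBlockSeq_odd, hlow]
      have h1 : 2 * k ≠ 2 * k + 2 + 1 := by omega
      have h2 : 2 * k ≠ 2 * k + 2 + 2 := by omega
      simp [Finset.sum_range_succ, cmvEntry, prev, he, mul_add, h1, h2]
      ring_nf
  · rw [blockSeq_odd]
    cases k with
    | zero =>
      rw [mul_zero, shiftedBlockSeq_zero, show 0 + 1 = 2 * 0 + 1 by rfl, shiftedBlockSeq_odd, hdef]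
      simp [Finset.sum_range_succ, cmvEntry, prev]
      ring
    | succ k =>
      have ho : ¬ Even (2 * k + 1 + 2) := by simp [parity_simps]
      rw [show 2 * (k + 1) = 2 * k + 2 by ring, shiftedBlockSeq_even,
        show 2 * k + 2 + 1 = 2 * (k + 1) + 1 by ring, shiftedBlockSeq_odd,
        show 2 * (k + 1) + 1 = 2 * k + 1 + 2 by ring, hlow]
      simp [Finset.sum_range_succ, cmvEntry, prev, ho, mul_add]
      ring_nf

/-- The constant CMV operator is unitary. -/
noncomputable def cmvIsometry {c : ℂ} (hc : ‖c‖ ≤ 1) : Ell2 ≃ₗᵢ[ℂ] Ell2 :=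
  LinearIsometryEquiv.ofSurjective
    { toLinearMap := (constCMV c : Ell2 →ₗ[ℂ] Ell2)
      norm_map' := fun x => by
        have h : HasSum (fun n => ‖constCMV c x n‖ ^ 2) (‖x‖ ^ 2) := by
          rw [constCMV_apply]
          exact hasSum_blockSeq hc (hasSum_shiftedBlockSeq hc (hasSum_norm_sq x))
        exact (sq_eq_sq₀ (norm_nonneg _) (norm_nonneg _)).mp (norm_sq_eq_of_hasSum h) }
    (by
      intro y
      have hc' : ‖conj c‖ ≤ 1 := by simpa using hc
      have h := hasSum_shiftedBlockSeq hc' (hasSum_blockSeq hc' (hasSum_norm_sq y))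
      refine ⟨⟨_, memℓp_of_hasSum h⟩, ?_⟩
      apply lp.ext
      change (constCMV c _ : ℕ → ℂ) = _
      rw [constCMV_apply]
      have h1 := shiftedBlockSeq_conj hc' (blockSeq (conj c) y)
      have h2 := blockSeq_conj_blockSeq hc' y
      rw [Complex.conj_conj] at h1 h2
      change blockSeq c (shiftedBlockSeq c (shiftedBlockSeq (conj c) (blockSeq (conj c) y))) = y
      rw [h1, h2])

lemma constCMV_mem_unitary {c : ℂ} (hc : ‖c‖ ≤ 1) :
    constCMV c ∈ unitary (Ell2 →L[ℂ] Ell2) := by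
  have : constCMV c = (Unitary.linearIsometryEquiv.symm (cmvIsometry hc) :
      unitary (Ell2 →L[ℂ] Ell2)) := by
    rw [Unitary.coe_symm_linearIsometryEquiv_apply]
    rfl
  rw [this]
  exact SetLike.coe_mem _

lemma norm_constCMV_apply {c : ℂ} (hc : ‖c‖ ≤ 1) (x : Ell2) : ‖constCMV c x‖ = ‖x‖ :=
  (cmvIsometry hc).norm_map x

lemma isUnit_sub_constCMV_of_norm_ne_one {c : ℂ} (hc : ‖c‖ ≤ 1) {z : ℂ} (hz : ‖z‖ ≠ 1) :
    IsUnit (algebraMap ℂ (Ell2 →L[ℂ] Ell2) z - constCMV c) := by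
  by_contra h
  have := spectrum.subset_circle_of_unitary (𝕜 := ℂ) (constCMV_mem_unitary hc)
    (show z ∈ spectrum ℂ (constCMV c) from h)
  exact hz (by simpa using this)

/-! ### The spectrum of the constant CMV operator off the arc -/

/-- The two sides differ by ρ²(|r - p|² + |q - s|²). For p, q, r, s four consecutive entries of a
sequence, the cross terms on the left telescope along the sequence. -/
lemma normSq_block_sub (c p q r s : ℂ) :
    4 * ‖c‖ ^ 2 * (‖q‖ ^ 2 + ‖r‖ ^ 2) + 4 * ((rho c * c * conj r * s).re
      - (rho c * c * conj p * q).re)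
    ≤ ‖(c * q + rho c * r) - (rho c * p - c * q)‖ ^ 2
      + ‖(rho c * q - conj c * r) - (conj c * r + rho c * s)‖ ^ 2 := by
  obtain ⟨t, ht⟩ : ∃ t : ℝ, rho c = t := ⟨_, rfl⟩
  rw [ht]
  simp only [← Complex.normSq_eq_norm_sq, Complex.normSq_apply]
  simp
  nlinarith [sq_nonneg (t * (r.re - p.re)), sq_nonneg (t * (r.im - p.im)),
    sq_nonneg (t * (q.re - s.re)), sq_nonneg (t * (q.im - s.im))]

/-- With 𝒞 = LM, ‖x - 𝒞x‖ = ‖L^*x - Mx‖, a sum of local terms bounded below by `normSq_block_sub`.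
The telescoping term starts at 0 because x 0 = 0 and tends to 0 at infinity, so ‖x - 𝒞x‖² ≥
4|c|²‖x‖². Expanding this square gives the claim. Off the zeroth coordinate, the numerical range
thus lies to the left of Γ_a's endpoints. -/
lemma re_inner_constCMV_le {c : ℂ} (hc : ‖c‖ ≤ 1) {x : Ell2} (hx : x 0 = 0) :
    (inner ℂ x (constCMV c x)).re ≤ (1 - 2 * ‖c‖ ^ 2) * ‖x‖ ^ 2 := by
  have hc' : ‖conj c‖ ≤ 1 := by simpa using hc
  have hS := hasSum_norm_sq x
  have hD : HasSum (fun n => ‖(blockSeq (conj c) x - shiftedBlockSeq c x) n‖ ^ 2)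
      (‖x - constCMV c x‖ ^ 2) := by
    have h1 := hasSum_blockSeq hc' (hasSum_norm_sq (x - constCMV c x))
    convert h1 using 3 with n
    have h2 := congrFun (blockSeq_conj_blockSeq hc (shiftedBlockSeq c x)) n
    rw [← constCMV_apply] at h2
    rw [Pi.sub_apply, ← h2]
    congr 1
    change _ = blockSeq (conj c) (fun n => x n - constCMV c x n) n
    unfold blockSeq
    split_ifs <;> ring
  have key : 4 * ‖c‖ ^ 2 * ‖x‖ ^ 2 ≤ ‖x - constCMV c x‖ ^ 2 := by
    have hS2 := (hasSum_even_odd (f := fun n => ‖x n‖ ^ 2) hS).tendsto_sum_nat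
    have hD2 := (hasSum_even_odd hD).tendsto_sum_nat
    -- At k = 0 the truncated index 2k - 1 is 0, which is harmless since x 0 = 0.
    set T : ℕ → ℝ := fun k => (rho c * c * conj (x (2 * k - 1)) * x (2 * k)).re with hT
    have hT0 : Tendsto T atTop (𝓝 0) := by
      have h0 : Tendsto (fun n => x n) atTop (𝓝 0) := by
        have := hS.summable.tendsto_atTop_zero
        rw [tendsto_zero_iff_norm_tendsto_zero]
        have h2 := this.sqrt
        simpa [Real.sqrt_sq] using h2
      have e1 : Tendsto (fun k : ℕ => 2 * k) atTop atTop :=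
        tendsto_atTop_mono (fun k => by change k ≤ 2 * k; omega) tendsto_id
      have e2 : Tendsto (fun k : ℕ => 2 * k - 1) atTop atTop :=
        tendsto_atTop_mono (fun k => by omega) (tendsto_sub_atTop_nat 1)
      have h3 := (Complex.continuous_conj.tendsto 0).comp (h0.comp e2)
      have h4 := ((h3.const_mul (rho c * c)).mul (h0.comp e1))
      have h5 := (Complex.continuous_re.tendsto _).comp h4
      simpa only [mul_zero, Complex.zero_re] using! h5
    have hle : ∀ K, 4 * ‖c‖ ^ 2 * ∑ k ∈ Finset.range K, (‖x (2 * k)‖ ^ 2 + ‖x (2 * k + 1)‖ ^ 2)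
        + 4 * T K ≤ ∑ k ∈ Finset.range K, (‖(blockSeq (conj c) x - shiftedBlockSeq c x) (2 * k)‖ ^ 2
          + ‖(blockSeq (conj c) x - shiftedBlockSeq c x) (2 * k + 1)‖ ^ 2) := by
      intro K
      induction K with
      | zero => simp [hT, hx]
      | succ K ih =>
        rw [Finset.sum_range_succ, Finset.sum_range_succ]
        suffices h : 4 * ‖c‖ ^ 2 * (‖x (2 * K)‖ ^ 2 + ‖x (2 * K + 1)‖ ^ 2) + 4 * (T (K + 1) - T K)
            ≤ ‖(blockSeq (conj c) x - shiftedBlockSeq c x) (2 * K)‖ ^ 2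
            + ‖(blockSeq (conj c) x - shiftedBlockSeq c x) (2 * K + 1)‖ ^ 2 by linarith
        rw [Pi.sub_apply, Pi.sub_apply, blockSeq_even, blockSeq_odd, shiftedBlockSeq_odd,
          rho_conj, Complex.conj_conj]
        cases K with
        | zero =>
          have := normSq_block_sub c 0 (x 0) (x 1) (x 2)
          rw [mul_zero, shiftedBlockSeq_zero]
          simpa [hT, hx] using! this
        | succ k =>
          rw [show shiftedBlockSeq c x (2 * (k + 1)) = _ from shiftedBlockSeq_even c x k]
          exact normSq_block_sub c (x (2 * k + 1)) (x (2 * (k + 1))) (x (2 * (k + 1) + 1))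
            (x (2 * (k + 1) + 2))
    have := le_of_tendsto_of_tendsto' ((hS2.const_mul (4 * ‖c‖ ^ 2)).add (hT0.const_mul 4)) hD2 hle
    linarith
  have h1 := norm_sub_sq (𝕜 := ℂ) x (constCMV c x)
  rw [norm_constCMV_apply hc] at h1
  simp only [RCLike.re_to_complex] at h1
  linarith

/-- Bounded below means injective with closed range; for a normal operator the orthogonal complement
of the range is the kernel, so the range is everything. -/
lemma isUnit_of_isStarNormal_of_bound {T : Ell2 →L[ℂ] Ell2} (hT : IsStarNormal T) {M : ℝ}
    (h : ∀ x, ‖x‖ ≤ M * ‖T x‖) : IsUnit T := by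
  have hM : ∀ x, ‖x‖ ≤ (M.toNNReal : ℝ) * ‖T x‖ := fun x =>
    (h x).trans (mul_le_mul_of_nonneg_right (Real.le_coe_toNNReal M) (norm_nonneg _))
  rw [ContinuousLinearMap.isUnit_iff_bijective,
    ContinuousLinearMap.bijective_iff_dense_range_and_antilipschitz]
  refine ⟨?_, _, T.antilipschitz_of_bound hM⟩
  rw [Submodule.topologicalClosure_eq_top_iff,
    ContinuousLinearMap.IsStarNormal.orthogonal_range hT, LinearMap.ker_eq_bot']
  intro x hx
  have := hM x
  rw [show T x = 0 from hx, norm_zero, mul_zero] at this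
  exact norm_le_zero_iff.mp this

lemma inner_e0 (x : Ell2) : inner ℂ e0 x = x 0 := by
  rw [e0, lp.inner_single_left]
  simp

lemma e0_apply (n : ℕ) : e0 n = if n = 0 then 1 else 0 := by
  rw [e0, lp.single_apply]
  split_ifs with h
  · subst h; rfl
  · exact Pi.single_eq_of_ne h 1

lemma norm_e0 : ‖e0‖ = 1 := by
  rw [e0, lp.norm_single (by norm_num)]
  simp

/-- If the resolvent equation has a solution with right-hand side `e₀`, then a point of the unit
circle off the arc is not in the spectrum. -/
lemma isUnit_sub_constCMV_of_lt_re {c : ℂ} (hc : ‖c‖ ≤ 1) {z : ℂ} (hre : 1 - 2 * ‖c‖ ^ 2 < z.re)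
    {v : Ell2} (hv : z • v - constCMV c v = e0) :
    IsUnit (algebraMap ℂ (Ell2 →L[ℂ] Ell2) z - constCMV c) := by
  set T := algebraMap ℂ (Ell2 →L[ℂ] Ell2) z - constCMV c with hTdef
  have hTx : ∀ x, T x = z • x - constCMV c x := fun x => by
    simp [hTdef, Algebra.algebraMap_eq_smul_one]
  have hT : IsStarNormal T := by
    obtain ⟨h1, h2⟩ := Unitary.mem_iff.mp (constCMV_mem_unitary hc)
    refine ⟨?_⟩
    rw [Commute, SemiconjBy, hTdef, star_sub, ← algebraMap_star_comm]
    simp only [sub_mul, mul_sub, h1, h2]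
    rw [Algebra.commutes (star z) (constCMV c), Algebra.commutes z (star (constCMV c)),
      Algebra.commutes (star z) (algebraMap ℂ (Ell2 →L[ℂ] Ell2) z)]
    abel
  have hadj := ContinuousLinearMap.isStarNormal_iff_norm_eq_adjoint.mp hT
  set δ := z.re - (1 - 2 * ‖c‖ ^ 2) with hδ
  have hδ0 : 0 < δ := by linarith
  refine isUnit_of_isStarNormal_of_bound hT (M := (1 + ‖v‖ * ‖T‖) / δ + ‖v‖) fun x => ?_
  -- x 0 = ⟨e₀, x⟩ = ⟨Tv, x⟩ = ⟨v, T^*x⟩, and ‖T^*x‖ = ‖Tx‖ by normality. The zeroth coordinate is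
  -- therefore controlled, and the numerical range bound handles the rest y of x.
  have h0 : ‖x 0‖ ≤ ‖T x‖ * ‖v‖ := by
    rw [← inner_e0, ← norm_inner_symm, ← hv, ← hTx, ← ContinuousLinearMap.adjoint_inner_left,
      hadj x]
    exact norm_inner_le_norm _ _
  set y := x - (x 0) • e0 with hy
  have hy0 : y 0 = 0 := by
    change x 0 - x 0 * e0 0 = 0
    simp [e0_apply]
  have h1 : δ * ‖y‖ ^ 2 ≤ (inner ℂ y (T y)).re := by
    have h2 := re_inner_constCMV_le hc hy0
    have h3 : inner ℂ y (z • y) = z * (‖y‖ ^ 2 : ℝ) := by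
      rw [inner_smul_right, inner_self_eq_norm_sq_to_K]
      simp
    rw [hTx, inner_sub_right, Complex.sub_re, h3, Complex.re_mul_ofReal]
    nlinarith
  have h4 : δ * ‖y‖ ≤ ‖T y‖ := by
    have h5 : (inner ℂ y (T y)).re ≤ ‖y‖ * ‖T y‖ :=
      (Complex.re_le_norm _).trans (norm_inner_le_norm _ _)
    rcases (norm_nonneg y).eq_or_lt with h6 | h6
    · rw [← h6, mul_zero]; exact norm_nonneg _
    · nlinarith
  have h7 : ‖T y‖ ≤ ‖T x‖ + ‖x 0‖ * ‖T‖ := by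
    rw [hy, map_sub, map_smul]
    refine (norm_sub_le _ _).trans ?_
    rw [norm_smul]
    have := T.le_opNorm e0
    rw [norm_e0, mul_one] at this
    gcongr
  have h8 : ‖x‖ ≤ ‖y‖ + ‖x 0‖ := by
    have : x = y + x 0 • e0 := by rw [hy]; abel
    calc ‖x‖ = ‖y + x 0 • e0‖ := by rw [← this]
      _ ≤ ‖y‖ + ‖x 0 • e0‖ := norm_add_le _ _
      _ = _ := by rw [norm_smul, norm_e0, mul_one]
  have h9 : ‖y‖ ≤ (‖T x‖ + ‖T x‖ * ‖v‖ * ‖T‖) / δ := by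
    rw [le_div_iff₀ hδ0]
    have : ‖x 0‖ * ‖T‖ ≤ ‖T x‖ * ‖v‖ * ‖T‖ := by gcongr
    linarith
  calc ‖x‖ ≤ (‖T x‖ + ‖T x‖ * ‖v‖ * ‖T‖) / δ + ‖T x‖ * ‖v‖ := by linarith
    _ = _ := by field_simp

lemma resolvent_constCMV_e0 {c z : ℂ} (h : IsUnit (algebraMap ℂ (Ell2 →L[ℂ] Ell2) z - constCMV c))
    {v : Ell2} (hv : z • v - constCMV c v = e0) : resolvent (constCMV c) z e0 = v := by
  have h1 := Ring.inverse_mul_cancel _ h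
  have h2 := congrArg (fun T : Ell2 →L[ℂ] Ell2 => T v) h1
  simpa [Algebra.algebraMap_eq_smul_one, hv, resolvent] using h2

lemma caraFun_eq {c z : ℂ} (h : IsUnit (algebraMap ℂ (Ell2 →L[ℂ] Ell2) z - constCMV c)) :
    caraFun c z = 1 - 2 * z * mFun c z := by
  set R := resolvent (constCMV c) z with hR
  have h1 : (algebraMap ℂ (Ell2 →L[ℂ] Ell2) z - constCMV c) * R = 1 := Ring.mul_inverse_cancel _ h
  have h2 : Ring.inverse (constCMV c - algebraMap ℂ (Ell2 →L[ℂ] Ell2) z) = -R := by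
    obtain ⟨u, hu⟩ := h
    rw [← neg_sub, hR, resolvent, ← hu, ← Units.val_neg, Ring.inverse_unit, Ring.inverse_unit,
      inv_neg, Units.val_neg]
  have h3 : (constCMV c + algebraMap ℂ (Ell2 →L[ℂ] Ell2) z) * (-R) = 1 - (2 * z) • R := by
    have : (constCMV c + algebraMap ℂ (Ell2 →L[ℂ] Ell2) z) * (-R)
        = (algebraMap ℂ (Ell2 →L[ℂ] Ell2) z - constCMV c) * R
          - (2 : ℂ) • ((algebraMap ℂ (Ell2 →L[ℂ] Ell2) z) * R) := by
      rw [two_smul]; noncomm_ring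
    rw [this, h1, Algebra.algebraMap_eq_smul_one, smul_mul_assoc, one_mul, smul_smul]
  have h4 := congrArg (fun T : Ell2 →L[ℂ] Ell2 => T e0) h3
  rw [caraFun, h2, mFun, ← hR]
  change inner ℂ e0 (((constCMV c + algebraMap ℂ (Ell2 →L[ℂ] Ell2) z) * (-R)) e0) = _
  rw [h3]
  simp only [sub_apply, one_apply_eq_self, smul_apply, inner_sub_right, inner_smul_right]
  rw [inner_self_eq_norm_sq_to_K, norm_e0]
  simp

/-- A geometric solution of the tridiagonal system equivalent to `(z - 𝒞(c)) v = e₀`. -/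
lemma exists_resolvent_vector {c : ℂ} (hc : ‖c‖ ≤ 1) {z A B l : ℂ} (hl : ‖l‖ < 1)
    (h0 : (z - conj c) * A - rho c * B = 1) (h1 : c * (1 + z) * B = rho c * (1 - z * l) * A)
    (h2 : rho c * (z - l) * B = conj c * (1 + z) * l * A) :
    ∃ v : Ell2, z • v - constCMV c v = e0 ∧ v 0 = A := by
  have hc' : ‖conj c‖ ≤ 1 := by simpa using hc
  -- The unknown is w = Mv, so that v = M^*w and the equation reads zM^*w - Lw = e₀. For this ansatz
  -- `h0` is row 0, `h1` the odd rows and `h2` the even rows from 2 on.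
  set w : ℕ → ℂ := fun n => if Even n then A * l ^ (n / 2) else B * l ^ (n / 2) with hw
  have we : ∀ k, w (2 * k) = A * l ^ k := fun k => by simp [hw]
  have wo : ∀ k, w (2 * k + 1) = B * l ^ k := fun k => by
    have : (2 * k + 1) / 2 = k := by omega
    simp [hw, this]
  have hl2 : ‖l‖ ^ 2 < 1 := by nlinarith [norm_nonneg l]
  have hsum : HasSum (fun n => ‖w n‖ ^ 2) ((‖A‖ ^ 2 + ‖B‖ ^ 2) * (1 - ‖l‖ ^ 2)⁻¹) := by
    refine hasSum_of_even_odd (fun n => by positivity) ?_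
    have := (hasSum_geometric_of_lt_one (by positivity) hl2).mul_left (‖A‖ ^ 2 + ‖B‖ ^ 2)
    have e : (fun k => ‖w (2 * k)‖ ^ 2 + ‖w (2 * k + 1)‖ ^ 2)
        = fun k => (‖A‖ ^ 2 + ‖B‖ ^ 2) * (‖l‖ ^ 2) ^ k := by
      ext k
      rw [we, wo, norm_mul, norm_mul, norm_pow]
      ring
    rw [e]
    exact this
  set v : Ell2 := ⟨_, memℓp_of_hasSum (hasSum_shiftedBlockSeq hc' hsum)⟩ with hv
  have hvw : (v : ℕ → ℂ) = shiftedBlockSeq (conj c) w := rfl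
  have hCv : (constCMV c v : ℕ → ℂ) = blockSeq c w := by
    have := shiftedBlockSeq_conj hc' w
    rw [Complex.conj_conj] at this
    rw [constCMV_apply, hvw, this]
  refine ⟨v, ?_, ?_⟩
  · apply lp.ext
    have hcoe : ((z • v - constCMV c v : Ell2) : ℕ → ℂ)
        = fun n => z * shiftedBlockSeq (conj c) w n - blockSeq c w n := by
      rw [← hvw, ← hCv]
      rfl
    rw [hcoe]
    refine eq_of_even_odd (fun k => ?_) fun k => ?_
    · simp only [blockSeq_even, e0_apply]
      cases k with
      | zero =>
        have e0' := we 0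
        have e1 := wo 0
        simp only [mul_zero, zero_add, pow_zero, mul_one] at e0' e1
        simp only [mul_zero, shiftedBlockSeq_zero, zero_add, e0', e1, if_true]
        linear_combination h0
      | succ k =>
        rw [show 2 * (k + 1) = 2 * k + 2 by ring, shiftedBlockSeq_even, rho_conj,
          show 2 * k + 2 + 1 = 2 * (k + 1) + 1 by ring, wo, wo,
          show 2 * k + 2 = 2 * (k + 1) by ring, we, if_neg (by omega)]
        linear_combination l ^ k * h2
    · simp only [blockSeq_odd, shiftedBlockSeq_odd, e0_apply, rho_conj, Complex.conj_conj]
      rw [show 2 * k + 2 = 2 * (k + 1) by ring, we, we, wo, if_neg (by omega)]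
      linear_combination l ^ k * h1
  · rw [hvw, shiftedBlockSeq_zero]
    simpa using we 0

/-- The resolvent set and the `m`-function of the constant CMV operator in terms of a geometric
solution of the resolvent equation. -/
lemma mFun_eq_of_geometric {c : ℂ} (hc : ‖c‖ ≤ 1) {z A B l : ℂ}
    (hz : ‖z‖ ≠ 1 ∨ 1 - 2 * ‖c‖ ^ 2 < z.re) (hl : ‖l‖ < 1)
    (h0 : (z - conj c) * A - rho c * B = 1) (h1 : c * (1 + z) * B = rho c * (1 - z * l) * A)
    (h2 : rho c * (z - l) * B = conj c * (1 + z) * l * A) :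
    IsUnit (algebraMap ℂ (Ell2 →L[ℂ] Ell2) z - constCMV c) ∧ mFun c z = A := by
  obtain ⟨v, hv, hv0⟩ := exists_resolvent_vector hc hl h0 h1 h2
  have hu : IsUnit (algebraMap ℂ (Ell2 →L[ℂ] Ell2) z - constCMV c) := by
    rcases hz with hz | hz
    · exact isUnit_sub_constCMV_of_norm_ne_one hc hz
    · exact isUnit_sub_constCMV_of_lt_re hc hz hv
  refine ⟨hu, ?_⟩
  rw [mFun, resolvent_constCMV_e0 hu hv, inner_e0, hv0]

/-! ### The function `G_a` -/

lemma mem_arc_iff {a : ℝ} (ha0 : 0 ≤ a) (ha1 : a ≤ 1) {z : ℂ} :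
    z ∈ arc a ↔ ‖z‖ = 1 ∧ z.re ≤ 1 - 2 * a ^ 2 := by
  have hs0 : 0 ≤ Real.arcsin a := Real.arcsin_nonneg.mpr ha0
  have hs1 := Real.arcsin_le_pi_div_two a
  have hcos : Real.cos (2 * Real.arcsin a) = 1 - 2 * a ^ 2 := by
    rw [Real.cos_two_mul, Real.cos_sq', Real.sin_arcsin (by linarith) ha1]; ring
  constructor
  · rintro ⟨θ, h1, h2, rfl⟩
    refine ⟨Complex.norm_exp_ofReal_mul_I θ, ?_⟩
    rw [Complex.exp_ofReal_mul_I_re, ← hcos]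
    rcases le_total θ Real.pi with h | h
    · exact Real.cos_le_cos_of_nonneg_of_le_pi (by linarith) h h1
    · rw [← Real.cos_two_pi_sub θ]
      exact Real.cos_le_cos_of_nonneg_of_le_pi (by linarith) (by linarith) (by linarith)
  · rintro ⟨hz, hx⟩
    have hn : z.re ^ 2 + z.im ^ 2 = 1 := by
      have := Complex.normSq_apply z
      rw [Complex.normSq_eq_norm_sq, hz] at this
      linarith
    have hx1 : -1 ≤ z.re := by nlinarith
    have hle : 2 * Real.arcsin a ≤ Real.arccos z.re := by
      rw [← Real.arccos_cos (x := 2 * Real.arcsin a) (by linarith) (by linarith), hcos]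
      exact Real.arccos_le_arccos hx
    have hcx : Real.cos (Real.arccos z.re) = z.re := Real.cos_arccos hx1 (by nlinarith)
    have hsx : Real.sin (Real.arccos z.re) = |z.im| := by
      rw [Real.sin_arccos, show 1 - z.re ^ 2 = z.im ^ 2 by linarith, Real.sqrt_sq_eq_abs]
    have hpi := Real.arccos_le_pi z.re
    rcases abs_cases z.im with ⟨h, -⟩ | ⟨h, -⟩
    · refine ⟨Real.arccos z.re, hle, by linarith, ?_⟩
      apply Complex.ext
      · rw [Complex.exp_ofReal_mul_I_re, hcx]
      · rw [Complex.exp_ofReal_mul_I_im, hsx, h]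
    · refine ⟨2 * Real.pi - Real.arccos z.re, by linarith, by linarith, ?_⟩
      apply Complex.ext
      · rw [Complex.exp_ofReal_mul_I_re, Real.cos_two_pi_sub, hcx]
      · rw [Complex.exp_ofReal_mul_I_im, Real.sin_two_pi_sub, hsx, h, neg_neg]

lemma isClosed_arc {a : ℝ} (ha0 : 0 ≤ a) (ha1 : a ≤ 1) : IsClosed (arc a) := by
  have : arc a = {z : ℂ | ‖z‖ = 1} ∩ {z : ℂ | z.re ≤ 1 - 2 * a ^ 2} :=
    Set.ext fun z => mem_arc_iff ha0 ha1
  rw [this]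
  exact (isClosed_eq continuous_norm continuous_const).inter
    (isClosed_le Complex.continuous_re continuous_const)

lemma notMem_arc_of_norm_ne_one {a : ℝ} (ha0 : 0 ≤ a) (ha1 : a ≤ 1) {z : ℂ} (hz : ‖z‖ ≠ 1) :
    z ∉ arc a := fun h => hz ((mem_arc_iff ha0 ha1).mp h).1

lemma norm_ne_one_or_lt_re {a : ℝ} (ha0 : 0 ≤ a) (ha1 : a ≤ 1) {z : ℂ} (hz : z ∉ arc a) :
    ‖z‖ ≠ 1 ∨ 1 - 2 * a ^ 2 < z.re := by
  rw [mem_arc_iff ha0 ha1, not_and, not_le] at hz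
  exact or_iff_not_imp_left.mpr fun h => hz (not_not.mp h)

lemma continuousAt_G {a : ℝ} (ha0 : 0 ≤ a) (ha1 : a ≤ 1) {z : ℂ} (hz : z ∉ arc a) :
    ContinuousAt (G a) z := by
  have h1 : ContinuousAt (arcRoot a) z :=
    ((differentiableOn_arcRoot ha0 ha1).continuousOn z hz).continuousAt
      ((isClosed_arc ha0 ha1).isOpen_compl.mem_nhds hz)
  unfold G
  fun_prop

lemma re_sqrt_pos {w : ℂ} (hw : w ∈ Complex.slitPlane) : 0 < (Complex.sqrt w).re := by
  have h0 := Complex.slitPlane_ne_zero hw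
  have h1 := Complex.mem_slitPlane_iff_arg.mp hw
  have h2 := (Complex.arg_le_pi w).lt_of_ne h1.1
  have h3 := Complex.neg_pi_lt_arg w
  rw [Complex.sqrt, Complex.cpow_def_of_ne_zero h0, Complex.exp_re]
  refine mul_pos (Real.exp_pos _) (Real.cos_pos_of_mem_Ioo ?_)
  have : (Complex.log w * 2⁻¹).im = Complex.arg w / 2 := by
    rw [show (2 : ℂ)⁻¹ = ((2⁻¹ : ℝ) : ℂ) by push_cast; rfl, Complex.im_mul_ofReal, Complex.log_im]
    ring
  rw [this]
  constructor <;> linarith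

/-- The two roots of the quadratic equation of G are (z + 1)(1 ± s)/2. A square root s with positive
real part makes G the root of strictly larger modulus. -/
lemma exists_G_eq {a : ℝ} (ha0 : 0 ≤ a) (ha1 : a ≤ 1) {z : ℂ} (hz : z ∉ arc a) :
    ∃ s : ℂ, 0 < s.re ∧ G a z = 1 / 2 * (z + 1) * (1 + s) :=
  ⟨_, re_sqrt_pos (arcRoot_arg_mem_slitPlane ha0 ha1 hz), by rw [G, arcRoot]; ring⟩

lemma add_one_ne_zero_of_notMem_arc {a : ℝ} {z : ℂ} (hz : z ∉ arc a) : z + 1 ≠ 0 :=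
  fun h => hz (by rw [eq_neg_of_add_eq_zero_left h]; exact neg_one_mem_arc)

lemma G_quadratic {a : ℝ} {z : ℂ} (hz : z ∉ arc a) :
    G a z ^ 2 - (z + 1) * G a z + z * (1 - (a : ℂ) ^ 2) = 0 := by
  have := arcRoot_sq hz
  rw [G]
  linear_combination 1 / 4 * this

lemma G_ne_zero {a : ℝ} (ha0 : 0 ≤ a) (ha1 : a ≤ 1) {z : ℂ} (hz : z ∉ arc a) : G a z ≠ 0 := by
  obtain ⟨s, hs, h⟩ := exists_G_eq ha0 ha1 hz
  rw [h]
  refine mul_ne_zero (mul_ne_zero (by norm_num) (add_one_ne_zero_of_notMem_arc hz)) fun h0 => ?_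
  have := congrArg Complex.re h0
  simp at this
  linarith

/-- Here z + 1 - G is the other root. The quotient is the decay rate of the solution of the
resolvent equation, so this inequality puts that solution in ℓ². -/
lemma norm_conjugate_root_div_G_lt {a : ℝ} (ha0 : 0 ≤ a) (ha1 : a ≤ 1) {z : ℂ} (hz : z ∉ arc a) :
    ‖(z + 1 - G a z) / G a z‖ < 1 := by
  have h0 := norm_pos_iff.mpr (G_ne_zero ha0 ha1 hz)
  rw [norm_div, div_lt_one h0]
  obtain ⟨s, hs, h⟩ := exists_G_eq ha0 ha1 hz
  have h1 : z + 1 - G a z = 1 / 2 * (z + 1) * (1 - s) := by rw [h]; ring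
  rw [h1, h, norm_mul, norm_mul (1 / 2 * (z + 1))]
  have h2 : 1 / 2 * (z + 1) ≠ 0 := mul_ne_zero (by norm_num) (add_one_ne_zero_of_notMem_arc hz)
  refine mul_lt_mul_of_pos_left ?_ (norm_pos_iff.mpr h2)
  rw [← sq_lt_sq₀ (norm_nonneg _) (norm_nonneg _), ← Complex.normSq_eq_norm_sq,
    ← Complex.normSq_eq_norm_sq, Complex.normSq_apply, Complex.normSq_apply]
  simp
  nlinarith

/-- The radicand in `arcRoot` is conjugated by z ↦ 1 / conj z, and the principal root commutes with
conjugation off the negative axis. This symmetry transports statements from the disc to the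
exterior. -/
lemma G_one_div_conj {a : ℝ} (ha0 : 0 ≤ a) (ha1 : a ≤ 1) {z : ℂ} (hz : z ∉ arc a) (hz0 : z ≠ 0) :
    conj (G a (1 / conj z)) = G a z / z := by
  have h1 := add_one_ne_zero_of_notMem_arc hz
  have h1' : conj z + 1 ≠ 0 := by
    intro h; apply h1
    have := congrArg conj h
    simpa using this
  have hz0' : conj z ≠ 0 := by simpa using hz0
  have hw := arcRoot_arg_mem_slitPlane ha0 ha1 hz
  set w := ((z - 1) ^ 2 + 4 * z * (a : ℂ) ^ 2) / (z + 1) ^ 2 with hwdef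
  have h2 : ((1 / conj z - 1) ^ 2 + 4 * (1 / conj z) * (a : ℂ) ^ 2) / (1 / conj z + 1) ^ 2
      = conj w := by
    have h3 : 1 / conj z + 1 ≠ 0 := by
      rw [div_add_one hz0']
      exact div_ne_zero (by rwa [add_comm]) hz0'
    rw [hwdef, map_div₀]
    simp only [map_add, map_pow, map_sub, map_mul, map_one, Complex.conj_ofReal]
    rw [div_eq_div_iff (pow_ne_zero 2 h3) (pow_ne_zero 2 h1')]
    have h4 : conj (4 : ℂ) = 4 := Complex.conj_ofNat 4
    rw [h4]
    field_simp
    ring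
  have h5 : conj (Complex.sqrt (conj w)) = Complex.sqrt w := by
    have := Complex.cpow_conj w 2⁻¹ (Complex.mem_slitPlane_iff_arg.mp hw).1
    have h6 : conj (2⁻¹ : ℂ) = 2⁻¹ := by rw [map_inv₀, Complex.conj_ofNat]
    rw [h6] at this
    rw [Complex.sqrt, Complex.sqrt, ← this]
  have h7 : arcRoot a z = (z + 1) * Complex.sqrt w := by rw [arcRoot, hwdef]
  rw [G, G, h7, arcRoot, h2]
  simp only [map_mul, map_add, map_div₀, map_one, Complex.conj_conj, h5]
  have h4 : conj (2 : ℂ) = 2 := Complex.conj_ofNat 2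
  rw [h4]
  clear_value w
  field_simp
  ring

lemma G_zero_of_norm_lt {z : ℂ} (hz : ‖z‖ < 1) : G 0 z = 1 := by
  rw [G, arcRoot_zero_of_norm_lt hz]; ring

lemma G_zero_of_one_lt_norm {z : ℂ} (hz : 1 < ‖z‖) : G 0 z = z := by
  rw [G, arcRoot_zero_of_one_lt_norm hz]; ring

lemma G_one (z : ℂ) : G 1 z = z + 1 := by
  rw [G, arcRoot]
  by_cases h : z + 1 = 0
  · simp [h]
  · have : ((z - 1) ^ 2 + 4 * z * ((1 : ℝ) : ℂ) ^ 2) / (z + 1) ^ 2 = 1 := by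
      rw [div_eq_one_iff_eq (pow_ne_zero 2 h)]; push_cast; ring
    rw [this, Complex.sqrt, Complex.one_cpow]
    ring

lemma G_at_zero (a : ℝ) : G a 0 = 1 := by
  rw [G, arcRoot_zero]; ring

lemma G_ne_self {a : ℝ} (ha0 : 0 ≤ a) (ha1 : a ≤ 1) {z : ℂ} (hz : z ∉ arc a)
    (h : a ≠ 0 ∨ ‖z‖ < 1) : G a z ≠ z := by
  intro hG
  have hq := G_quadratic hz
  rw [hG] at hq
  have h1 : z * (a : ℂ) ^ 2 = 0 := by linear_combination -hq
  rcases mul_eq_zero.mp h1 with h2 | h2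
  · rw [h2, G_at_zero] at hG
    exact one_ne_zero hG
  · have h3 : a = 0 := by simpa using h2
    subst h3
    rcases h with h | h
    · exact h rfl
    · rw [G_zero_of_norm_lt h] at hG
      rw [← hG] at h
      simp at h

/-- The bound `|f| ≤ 1` for the Schur function `f = a / (G_a - z)`. -/
lemma le_norm_G_sub {a : ℝ} (ha0 : 0 ≤ a) (ha1 : a ≤ 1) {z : ℂ} (hz : ‖z‖ < 1) :
    a ≤ ‖G a z - z‖ := by
  rcases ha0.eq_or_lt with rfl | hpos
  · exact norm_nonneg _
  rcases ha1.eq_or_lt with rfl | hlt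
  · rw [G_one]; simp
  have harc : ∀ w : ℂ, ‖w‖ < 1 → w ∉ arc a := fun w hw =>
    notMem_arc_of_norm_ne_one ha0 ha1 hw.ne
  by_contra! hcon
  -- along the segment from `0` to `z` the modulus would take the value `a`
  have hseg : ∀ t ∈ Set.Icc (0 : ℝ) 1, ‖(t : ℂ) * z‖ < 1 := by
    intro t ht
    rw [norm_mul, Complex.norm_real, Real.norm_of_nonneg ht.1]
    nlinarith [ht.1, ht.2, norm_nonneg z]
  have hcont : ContinuousOn (fun t : ℝ => ‖G a (t * z) - t * z‖) (Set.Icc 0 1) := by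
    intro t ht
    have h1 : ContinuousAt (fun t : ℝ => G a ((t : ℂ) * z)) t :=
      ContinuousAt.comp (g := G a) (f := fun t : ℝ => (t : ℂ) * z)
        (continuousAt_G ha0 ha1 (harc _ (hseg t ht))) (by fun_prop)
    exact ContinuousAt.continuousWithinAt (by fun_prop)
  have hmem : a ∈ Set.Icc ((fun t : ℝ => ‖G a (t * z) - t * z‖) 1)
      ((fun t : ℝ => ‖G a (t * z) - t * z‖) 0) := by
    simp only [Complex.ofReal_one, one_mul, Complex.ofReal_zero, zero_mul, G_at_zero, sub_zero,
      norm_one]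
    exact ⟨hcon.le, hlt.le⟩
  obtain ⟨t, ht, hta⟩ := intermediate_value_Icc' zero_le_one hcont hmem
  have hw := hseg t ht
  set w := (t : ℂ) * z with hwdef
  have hq := G_quadratic (harc w hw)
  have hD : ‖G a w - w‖ = a := hta
  set D := G a w - w with hDdef
  -- The quadratic equation in terms of D = G - w, factored below as D(D + w) = D + a²w. Taking
  -- moduli with |D| = a leaves a²(1 - a²)(1 - |w|²) = 0, impossible for 0 < a < 1 and |w| < 1.
  have h1 : D * D = D - w * D + (a : ℂ) ^ 2 * w := by
    rw [hDdef]; linear_combination hq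
  have h2 : D * (D + w) = D + (a : ℂ) ^ 2 * w := by linear_combination h1
  have h2' : ‖D‖ ^ 2 * (‖D + w‖ ^ 2) = ‖D + (a : ℂ) ^ 2 * w‖ ^ 2 := by
    rw [← mul_pow, ← norm_mul, h2]
  have h4 : ‖(a : ℂ)‖ = a := by rw [Complex.norm_real, Real.norm_of_nonneg ha0]
  have hD2 : D.re * D.re + D.im * D.im = a ^ 2 := by
    rw [← Complex.normSq_apply, Complex.normSq_eq_norm_sq, hD]
  have hw2 : w.re * w.re + w.im * w.im < 1 := by
    rw [← Complex.normSq_apply, Complex.normSq_eq_norm_sq]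
    nlinarith [norm_nonneg w]
  rw [hD] at h2'
  simp only [← Complex.normSq_eq_norm_sq, Complex.normSq_apply, Complex.add_re, Complex.add_im,
    ← Complex.ofReal_pow, Complex.re_ofReal_mul,
    Complex.im_ofReal_mul] at h2'
  have h6 : a ^ 2 * (1 - a ^ 2) * (1 - (w.re * w.re + w.im * w.im)) = 0 := by
    linear_combination (-1 : ℝ) * h2' - (1 - a ^ 2) * hD2
  have h7 : 0 < a ^ 2 * (1 - a ^ 2) * (1 - (w.re * w.re + w.im * w.im)) :=
    mul_pos (mul_pos (by positivity) (by nlinarith)) (by linarith)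
  linarith

/-! ### The resolvent functions of the constant CMV operator -/

lemma norm_sq_eq_mul_conj (c : ℂ) : ((‖c‖ : ℝ) : ℂ) ^ 2 = c * conj c := (Complex.mul_conj' c).symm

lemma mFun_eq {c : ℂ} (hc : ‖c‖ ≤ 1) {z : ℂ} (hz : z ∉ arc ‖c‖)
    (hD : z * (1 + c) - G ‖c‖ z ≠ 0) :
    IsUnit (algebraMap ℂ (Ell2 →L[ℂ] Ell2) z - constCMV c) ∧
      mFun c z = c / (z * (1 + c) - G ‖c‖ z) := by
  have hG := G_ne_zero (norm_nonneg c) hc hz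
  have hl := norm_conjugate_root_div_G_lt (norm_nonneg c) hc hz
  have hq := G_quadratic hz
  rw [norm_sq_eq_mul_conj] at hq
  have hr := rho_sq hc
  set g := G ‖c‖ z with hg
  refine mFun_eq_of_geometric hc (norm_ne_one_or_lt_re (norm_nonneg c) hc hz) hl
    -- The first equation determines ρB; the quadratic equation extracts a factor ρ² from it, so
    -- this form of B remains valid for |c| = 1.
    (B := rho c * (g - z) / (g * (z * (1 + c) - g))) ?_ ?_ ?_
  · field_simp
    linear_combination hq - (g - z) * hr
  · field_simp
    ring
  · field_simp
    linear_combination (z + 1) * hq + (z + 1) * (g - 1) * (g - z) * hr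

/-- A second expression for the same function, usable in the exterior also when c = 0: there G = z
and the expression in `mFun_eq` is 0/0. -/
lemma mFun_eq' {c : ℂ} (hc : ‖c‖ ≤ 1) {z : ℂ} (hz : z ∉ arc ‖c‖) (hz0 : z ≠ 0)
    (hE : G ‖c‖ z - 1 - conj c ≠ 0) :
    mFun c z = (G ‖c‖ z - 1) / (z * (G ‖c‖ z - 1 - conj c)) := by
  have hG := G_ne_zero (norm_nonneg c) hc hz
  have hl := norm_conjugate_root_div_G_lt (norm_nonneg c) hc hz
  have hq := G_quadratic hz
  rw [norm_sq_eq_mul_conj] at hq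
  have hr := rho_sq hc
  set g := G ‖c‖ z with hg
  refine (mFun_eq_of_geometric hc (norm_ne_one_or_lt_re (norm_nonneg c) hc hz) hl
    (B := conj c * rho c / (g * (g - 1 - conj c))) ?_ ?_ ?_).2
  · field_simp
    linear_combination -conj c * hq - conj c * z * hr
  · field_simp
    linear_combination - (1 + z) * rho c * hq
  · field_simp
    linear_combination conj c * (1 + z) * (g - 1) * (hq + z * hr)

/-- In the disc the denominator of `m_c` does not vanish. -/
lemma mFun_denom_ne_zero {c : ℂ} (hc : ‖c‖ ≤ 1) {z : ℂ} (hz : ‖z‖ < 1) :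
    z * (1 + c) - G ‖c‖ z ≠ 0 := by
  have h1 := le_norm_G_sub (norm_nonneg c) hc hz
  have h2 := G_ne_self (norm_nonneg c) hc
    (notMem_arc_of_norm_ne_one (norm_nonneg c) hc hz.ne) (Or.inr hz)
  intro h
  -- A zero would give |G - z| = |z| |c|. The bound |G - z| ≥ |c| then forces c = 0, which
  -- contradicts G ≠ z.
  have h3 : G ‖c‖ z - z = z * c := by linear_combination -h
  have h4 : 0 < ‖G ‖c‖ z - z‖ := norm_pos_iff.mpr (sub_ne_zero.mpr h2)
  rw [h3, norm_mul] at h1 h4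
  nlinarith [norm_nonneg c, norm_nonneg z]

lemma mFun_denom_ne_zero' {c : ℂ} (hc : ‖c‖ ≤ 1) {z : ℂ} (hz : 1 < ‖z‖) :
    G ‖c‖ z - 1 - conj c ≠ 0 := by
  have hz0 : z ≠ 0 := norm_pos_iff.mp (by linarith)
  have hzc0 : conj z ≠ 0 := by simpa using hz0
  have hy : ‖1 / conj z‖ < 1 := by
    rw [norm_div, norm_one, RCLike.norm_conj]
    exact (div_lt_one (by linarith)).mpr hz
  have h1 := mFun_denom_ne_zero hc hy
  have h2 := G_one_div_conj (norm_nonneg c) hc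
    (notMem_arc_of_norm_ne_one (norm_nonneg c) hc hz.ne') hz0
  intro h
  apply h1
  have h3 := congrArg conj h2
  rw [Complex.conj_conj, map_div₀] at h3
  have h4 := congrArg conj h
  simp only [map_sub, map_one, map_zero, Complex.conj_conj] at h4
  rw [h3]
  field_simp
  linear_combination -h4

lemma schur_quotient_eq {c : ℂ} (hc : ‖c‖ ≤ 1) {w : ℂ} (hw : w ∉ arc ‖c‖) (hw0 : w ≠ 0)
    (hD : w * (1 + c) - G ‖c‖ w ≠ 0) (hG : G ‖c‖ w ≠ w) :
    1 / w * ((caraFun c w - 1) / (caraFun c w + 1)) = c / (G ‖c‖ w - w) := by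
  obtain ⟨hu, hm⟩ := mFun_eq hc hw hD
  rw [caraFun_eq hu, hm]
  have h1 : G ‖c‖ w - w ≠ 0 := sub_ne_zero.mpr hG
  have h2 : 1 - 2 * w * (c / (w * (1 + c) - G ‖c‖ w)) + 1
      = -2 * (G ‖c‖ w - w) / (w * (1 + c) - G ‖c‖ w) := by
    field_simp
    ring
  rw [h2]
  field_simp
  ring

/-- The right-hand side is continuous at z, so it suffices to match the quotient on a punctured
neighbourhood, where 0 and the only possible zero of the denominator of m_c can be avoided. -/
lemma schurFun_eq {c : ℂ} (hc : ‖c‖ ≤ 1) {z : ℂ} (hz : z ∉ arc ‖c‖) (h : c ≠ 0 ∨ ‖z‖ < 1) :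
    schurFun c z = c / (G ‖c‖ z - z) := by
  have ha0 := norm_nonneg c
  have hG : ∀ w, w ∉ arc ‖c‖ → c ≠ 0 ∨ ‖w‖ < 1 → G ‖c‖ w ≠ w := fun w hw h =>
    G_ne_self ha0 hc hw (h.imp_left norm_ne_zero_iff.mpr)
  have hcont := continuousAt_G ha0 hc hz
  have hlim : Tendsto (fun w => c / (G ‖c‖ w - w)) (𝓝[≠] z) (𝓝 (c / (G ‖c‖ z - z))) := by
    refine Tendsto.mono_left ?_ nhdsWithin_le_nhds
    exact tendsto_const_nhds.div (hcont.tendsto.sub tendsto_id) (sub_ne_zero.mpr (hG z hz h))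
  refine Tendsto.limUnder_eq (hlim.congr' ?_)
  have harc : ∀ᶠ w in 𝓝[≠] z, w ∉ arc ‖c‖ :=
    nhdsWithin_le_nhds ((isClosed_arc ha0 hc).isOpen_compl.mem_nhds hz)
  have hne : ∀ x : ℂ, ∀ᶠ w in 𝓝[≠] z, w ≠ x := by
    intro x
    rcases eq_or_ne x z with rfl | hx
    · exact self_mem_nhdsWithin
    · exact nhdsWithin_le_nhds (isOpen_ne.mem_nhds hx.symm)
  have hor : ∀ᶠ w in 𝓝[≠] z, c ≠ 0 ∨ ‖w‖ < 1 := by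
    rcases h with h | h
    · exact Eventually.of_forall fun _ => Or.inl h
    · filter_upwards [nhdsWithin_le_nhds ((continuous_norm.tendsto z).eventually_lt_const h)]
        with w hw using Or.inr hw
  filter_upwards [harc, hne 0, hne ((1 + conj c) / (1 + c)), hor] with w hw hw0 hw1 hor
  refine (schur_quotient_eq hc hw hw0 ?_ (hG w hw hor)).symm
  rcases hor with hc0 | hw'
  swap
  · exact mFun_denom_ne_zero hc hw'
  -- the denominator has at most one zero
  intro hD
  have hq := G_quadratic hw
  rw [norm_sq_eq_mul_conj] at hq
  have hg : G ‖c‖ w = w * (1 + c) := by linear_combination -hD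
  rw [hg] at hq
  have h3 : w * c * (w * (1 + c) - (1 + conj c)) = 0 := by linear_combination hq
  have h4 : w * (1 + c) - (1 + conj c) = 0 := by
    rcases mul_eq_zero.mp h3 with h5 | h5
    · exact absurd h5 (mul_ne_zero hw0 hc0)
    · exact h5
  -- For c = -1 a vanishing denominator would mean G = 0, which never happens off the arc.
  by_cases hc1 : 1 + c = 0
  · refine G_ne_zero ha0 hc hw ?_
    rw [hg, hc1, mul_zero]
  · exact hw1 (by rw [eq_div_iff hc1]; linear_combination h4)

/-- The Schur function is a fixed point of the Schur step. -/
lemma schur_fixed_point {c : ℂ} {z : ℂ} (hz : z ∉ arc ‖c‖) (hG : G ‖c‖ z ≠ z) :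
    c / (G ‖c‖ z - z) * (1 + conj c * z * (c / (G ‖c‖ z - z)))
      = c + z * (c / (G ‖c‖ z - z)) := by
  have h1 : G ‖c‖ z - z ≠ 0 := sub_ne_zero.mpr hG
  have hq := G_quadratic hz
  rw [norm_sq_eq_mul_conj] at hq
  field_simp
  linear_combination -c * hq

/-! ### Contraction of the Schur iteration in the pseudohyperbolic metric -/

/-- The pseudohyperbolic distance in the unit disc. -/
noncomputable def pseudoDist (u v : ℂ) : ℝ := ‖u - v‖ / ‖1 - conj v * u‖

/-- The Schur step `u ↦ (c + u) / (1 + conj c * u)`. -/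
noncomputable def schurStep (c u : ℂ) : ℂ := (c + u) / (1 + conj c * u)

lemma one_sub_le_norm {r : ℝ} {p q : ℂ} (hp : ‖p‖ ≤ 1) (hq : ‖q‖ ≤ r) : 1 - r ≤ ‖1 - p * q‖ := by
  have h := norm_sub_norm_le (1 : ℂ) (p * q)
  rw [norm_one, norm_mul] at h
  nlinarith [norm_nonneg q, norm_nonneg p]

lemma one_sub_le_norm_add {r : ℝ} {p q : ℂ} (hp : ‖p‖ ≤ 1) (hq : ‖q‖ ≤ r) :
    1 - r ≤ ‖1 + conj p * q‖ := by
  have := one_sub_le_norm (p := -conj p) (by simpa using hp) hq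
  simpa [neg_mul, sub_neg_eq_add] using this

lemma norm_schurStep_le {c u : ℂ} (hc : ‖c‖ ≤ 1) (hu : ‖u‖ < 1) : ‖schurStep c u‖ ≤ 1 := by
  have h0 := one_sub_le_norm_add hc le_rfl (q := u)
  rw [schurStep, norm_div, div_le_one (by linarith)]
  have h1 := normSq_mobius (-conj c) u 1
  rw [norm_neg, RCLike.norm_conj, norm_one] at h1
  have e1 : (1 : ℂ) - -conj c * u = 1 + conj c * u := by ring
  have e2 : u - conj (-conj c) * 1 = c + u := by simp [add_comm]
  rw [e1, e2] at h1
  refine (sq_le_sq₀ (norm_nonneg _) (norm_nonneg _)).mp ?_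
  have : 0 ≤ (1 - ‖c‖ ^ 2) * (1 ^ 2 - ‖u‖ ^ 2) :=
    mul_nonneg (by nlinarith [norm_nonneg c]) (by nlinarith [norm_nonneg u])
  linarith

lemma norm_schurStep_sub_le {r : ℝ} (hr : r < 1) {c u v : ℂ} (hc : ‖c‖ ≤ 1) (hu : ‖u‖ ≤ r)
    (hv : ‖v‖ ≤ r) : ‖schurStep c u - schurStep c v‖ ≤ ‖u - v‖ / (1 - r) ^ 2 := by
  have h1 := one_sub_le_norm_add hc hu
  have h2 := one_sub_le_norm_add hc hv
  have h1' : 1 + conj c * u ≠ 0 := norm_pos_iff.mp (by linarith)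
  have h2' : 1 + conj c * v ≠ 0 := norm_pos_iff.mp (by linarith)
  have e : schurStep c u - schurStep c v
      = ((1 - ‖c‖ ^ 2 : ℝ) : ℂ) * (u - v) / ((1 + conj c * u) * (1 + conj c * v)) := by
    rw [schurStep, schurStep]
    push_cast
    rw [norm_sq_eq_mul_conj, div_sub_div _ _ h1' h2']
    ring
  have h3 : 0 ≤ 1 - ‖c‖ ^ 2 := by nlinarith [norm_nonneg c]
  rw [e, norm_div, norm_mul, norm_mul, Complex.norm_real, Real.norm_of_nonneg h3, pow_two (1 - r)]
  have h4 : (1 - ‖c‖ ^ 2) * ‖u - v‖ ≤ ‖u - v‖ :=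
    mul_le_of_le_one_left (norm_nonneg _) (by nlinarith [norm_nonneg c])
  have h5 : 0 < 1 - r := by linarith
  gcongr

lemma norm_schurStep_sub_param_le {r : ℝ} (hr : r < 1) {c d v : ℂ} (hc : ‖c‖ ≤ 1) (hd : ‖d‖ ≤ 1)
    (hv : ‖v‖ ≤ r) : ‖schurStep c v - schurStep d v‖ ≤ 4 * ‖c - d‖ / (1 - r) ^ 2 := by
  have h1 := one_sub_le_norm_add hc hv
  have h2 := one_sub_le_norm_add hd hv
  have h1' : 1 + conj c * v ≠ 0 := norm_pos_iff.mp (by linarith)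
  have h2' : 1 + conj d * v ≠ 0 := norm_pos_iff.mp (by linarith)
  have e : schurStep c v - schurStep d v
      = ((c - d) - v ^ 2 * conj (c - d) + (v * conj c * (c - d) - v * c * conj (c - d)))
        / ((1 + conj c * v) * (1 + conj d * v)) := by
    rw [schurStep, schurStep, map_sub, div_sub_div _ _ h1' h2']
    ring
  have hv1 : ‖v‖ ≤ 1 := by linarith
  have h3 : ‖(c - d) - v ^ 2 * conj (c - d) + (v * conj c * (c - d) - v * c * conj (c - d))‖
      ≤ 4 * ‖c - d‖ := by
    have hk : ∀ p q : ℂ, ‖p‖ ≤ 1 → ‖p * q‖ ≤ ‖q‖ := fun p q hp => by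
      rw [norm_mul]; exact mul_le_of_le_one_left (norm_nonneg _) hp
    have hm : ∀ p q : ℂ, ‖p‖ ≤ 1 → ‖q‖ ≤ 1 → ‖p * q‖ ≤ 1 := fun p q hp hq => (hk p q hp).trans hq
    have b1 := hk (v ^ 2) (conj (c - d)) (by rw [pow_two]; exact hm _ _ hv1 hv1)
    have b2 := hk (v * conj c) (c - d) (hm _ _ hv1 (by simpa using hc))
    have b3 := hk (v * c) (conj (c - d)) (hm _ _ hv1 hc)
    rw [RCLike.norm_conj] at b1 b3
    have t1 := norm_add_le ((c - d) - v ^ 2 * conj (c - d))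
      (v * conj c * (c - d) - v * c * conj (c - d))
    have t2 := norm_sub_le (c - d) (v ^ 2 * conj (c - d))
    have t3 := norm_sub_le (v * conj c * (c - d)) (v * c * conj (c - d))
    linarith
  have h5 : 0 < 1 - r := by linarith
  rw [e, norm_div, norm_mul, pow_two (1 - r)]
  gcongr

/-- A substitute for the triangle inequality: the perturbation from y to w is small in the Euclidean
sense only, and in the disc of radius r this costs a constant factor. -/
lemma pseudoDist_le_add {r : ℝ} (hr : r < 1) {x y w : ℂ} (hx : ‖x‖ ≤ r) (hy : ‖y‖ ≤ r)
    (hw : ‖w‖ ≤ r) : pseudoDist x w ≤ pseudoDist x y + 4 * ‖y - w‖ / (1 - r) ^ 2 := by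
  have hx1 : ‖x‖ ≤ 1 := by linarith
  have hy1 : ‖y‖ ≤ 1 := by linarith
  have hw1 : ‖w‖ ≤ 1 := by linarith
  have h1 := one_sub_le_norm (p := conj y) (by simpa using hy1) hx
  have h2 := one_sub_le_norm (p := conj w) (by simpa using hw1) hx
  have h1' : 1 - conj y * x ≠ 0 := norm_pos_iff.mp (by linarith)
  have h2' : 1 - conj w * x ≠ 0 := norm_pos_iff.mp (by linarith)
  have e : (x - w) / (1 - conj w * x) = (x - y) / (1 - conj y * x)
      + ((y - w) - x ^ 2 * conj (y - w) + (x * w * conj (y - w) - x * conj w * (y - w)))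
        / ((1 - conj y * x) * (1 - conj w * x)) := by
    rw [map_sub, div_add_div _ _ h1' (mul_ne_zero h1' h2'),
      div_eq_div_iff h2' (mul_ne_zero h1' (mul_ne_zero h1' h2'))]
    ring
  have h3 : ‖(y - w) - x ^ 2 * conj (y - w) + (x * w * conj (y - w) - x * conj w * (y - w))‖
      ≤ 4 * ‖y - w‖ := by
    have hk : ∀ p q : ℂ, ‖p‖ ≤ 1 → ‖p * q‖ ≤ ‖q‖ := fun p q hp => by
      rw [norm_mul]; exact mul_le_of_le_one_left (norm_nonneg _) hp
    have hm : ∀ p q : ℂ, ‖p‖ ≤ 1 → ‖q‖ ≤ 1 → ‖p * q‖ ≤ 1 := fun p q hp hq => (hk p q hp).trans hq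
    have b1 := hk (x ^ 2) (conj (y - w)) (by rw [pow_two]; exact hm _ _ hx1 hx1)
    have b2 := hk (x * conj w) (y - w) (hm _ _ hx1 (by simpa using hw1))
    have b3 := hk (x * w) (conj (y - w)) (hm _ _ hx1 hw1)
    rw [RCLike.norm_conj] at b1 b3
    have t1 := norm_add_le ((y - w) - x ^ 2 * conj (y - w))
      (x * w * conj (y - w) - x * conj w * (y - w))
    have t2 := norm_sub_le (y - w) (x ^ 2 * conj (y - w))
    have t3 := norm_sub_le (x * w * conj (y - w)) (x * conj w * (y - w))
    linarith
  have h5 : 0 < 1 - r := by linarith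
  rw [pseudoDist, pseudoDist, ← norm_div, ← norm_div, e]
  refine (norm_add_le _ _).trans (add_le_add_right ?_ _)
  rw [norm_div, norm_mul, pow_two (1 - r)]
  gcongr

/-- On the closed unit disc |1 - s| / |1 - ρ²s| is largest at s = -1, with value 2 / (1 + ρ²).
Multiplied by ρ this is the contraction constant. -/
lemma norm_one_sub_le_of_norm_le_one {ρ : ℝ} (h0 : 0 ≤ ρ) {s : ℂ} (hs : ‖s‖ ≤ 1) (h1 : ρ ≤ 1) :
    (1 + ρ ^ 2) * ‖1 - s‖ ≤ 2 * ‖1 - (ρ : ℂ) ^ 2 * s‖ := by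
  have hs2 : s.re * s.re + s.im * s.im ≤ 1 := by
    rw [← Complex.normSq_apply, Complex.normSq_eq_norm_sq]
    nlinarith [norm_nonneg s]
  refine (sq_le_sq₀ (by positivity) (by positivity)).mp ?_
  rw [mul_pow, mul_pow, ← Complex.normSq_eq_norm_sq, ← Complex.normSq_eq_norm_sq,
    Complex.normSq_apply, Complex.normSq_apply, ← Complex.ofReal_pow]
  simp only [Complex.sub_re, Complex.sub_im, Complex.re_ofReal_mul, Complex.im_ofReal_mul,
    Complex.one_re, Complex.one_im]
  have hρ0 : 0 ≤ ρ ^ 2 := sq_nonneg ρ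
  have hρ : ρ ^ 2 ≤ 1 := by nlinarith
  generalize ρ ^ 2 = q at *
  nlinarith [sq_nonneg ((1 - q) * (1 + s.re)), sq_nonneg ((1 - q) * s.im),
    mul_nonneg (mul_nonneg (sub_nonneg.mpr hρ) (by linarith : 0 ≤ 1 + q)) (sub_nonneg.mpr hs2)]

/-- The Möbius step is an isometry for |c| < 1, and multiplication by z contracts by 2|z| / (1 +
|z|²), which increases with |z| on [0, 1]. -/
lemma pseudoDist_schurStep_le {r : ℝ} (hr : r < 1) {c u v z : ℂ} (hc : ‖c‖ ≤ 1) (hu : ‖u‖ ≤ r)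
    (hv : ‖v‖ ≤ r) (hz : ‖z‖ ≤ r) :
    pseudoDist (z * schurStep c u) (z * schurStep c v) ≤ 2 * r / (1 + r ^ 2) * pseudoDist u v := by
  have hr0 : 0 ≤ r := (norm_nonneg z).trans hz
  set p := schurStep c u with hp
  set q := schurStep c v with hq
  have hp1 : ‖p‖ ≤ 1 := norm_schurStep_le hc (hu.trans_lt hr)
  have hq1 : ‖q‖ ≤ 1 := norm_schurStep_le hc (hv.trans_lt hr)
  have h1 := one_sub_le_norm_add hc hu
  have h2 := one_sub_le_norm_add hc hv
  have h1' : 1 + conj c * u ≠ 0 := norm_pos_iff.mp (by linarith)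
  have h2' : 1 + conj c * v ≠ 0 := norm_pos_iff.mp (by linarith)
  have h2'' : 1 + c * conj v ≠ 0 := by
    intro h; apply h2'
    have := congrArg conj h
    simpa using this
  have hvu := one_sub_le_norm (p := conj v) (by simpa using hv.trans hr.le) hu
  have hvu0 : 0 < ‖1 - conj v * u‖ := by linarith
  -- invariance
  have hinv : ‖p - q‖ * ‖1 - conj v * u‖ = ‖u - v‖ * ‖1 - conj q * p‖ := by
    have e1 : (p - q) * (1 - conj v * u) * (1 + conj c * v)
        = (u - v) * (1 - conj q * p) * (1 + c * conj v) := by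
      rw [hp, hq, schurStep, schurStep]
      simp only [map_div₀, map_add, map_mul, map_one, Complex.conj_conj]
      rw [div_sub_div _ _ h1' h2', div_mul_div_comm, one_sub_div (mul_ne_zero h2'' h1'),
        div_mul_eq_mul_div, div_mul_eq_mul_div, mul_div_assoc', div_mul_eq_mul_div,
        div_eq_div_iff (mul_ne_zero h1' h2') (mul_ne_zero h2'' h1')]
      ring
    have e2 : ‖1 + conj c * v‖ = ‖1 + c * conj v‖ := by
      rw [← RCLike.norm_conj]; simp
    have e3 := congrArg norm e1
    simp only [norm_mul] at e3
    rw [e2] at e3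
    exact mul_right_cancel₀ (norm_ne_zero_iff.mpr h2'') e3
  have hzpq : ‖z * q‖ ≤ 1 ∧ ‖z * p‖ ≤ r := by
    rw [norm_mul, norm_mul]
    constructor <;> nlinarith [norm_nonneg z, norm_nonneg p, norm_nonneg q]
  have hden := one_sub_le_norm (p := conj (z * q)) (by simpa using hzpq.1) hzpq.2
  have hden0 : 0 < ‖1 - conj (z * q) * (z * p)‖ := by linarith
  have hs : ‖conj q * p‖ ≤ 1 := by
    rw [norm_mul, RCLike.norm_conj]; nlinarith [norm_nonneg p, norm_nonneg q]
  have h4 := norm_one_sub_le_of_norm_le_one (norm_nonneg z) hs (hz.trans hr.le)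
  have h5 : ((‖z‖ : ℝ) : ℂ) ^ 2 * (conj q * p) = conj (z * q) * (z * p) := by
    rw [norm_sq_eq_mul_conj, map_mul]; ring
  rw [h5] at h4
  have hκ : ‖z‖ * (1 + r ^ 2) ≤ r * (1 + ‖z‖ ^ 2) := by
    nlinarith [mul_nonneg (sub_nonneg.mpr hz)
      (by nlinarith [norm_nonneg z] : (0 : ℝ) ≤ 1 - r * ‖z‖)]
  rw [pseudoDist, pseudoDist, ← mul_sub, norm_mul, div_mul_div_comm, div_le_div_iff₀ hden0
    (by positivity)]
  calc ‖z‖ * ‖p - q‖ * ((1 + r ^ 2) * ‖1 - conj v * u‖)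
      = ‖z‖ * (1 + r ^ 2) * (‖p - q‖ * ‖1 - conj v * u‖) := by ring
    _ = ‖z‖ * (1 + r ^ 2) * (‖u - v‖ * ‖1 - conj q * p‖) := by rw [hinv]
    _ ≤ r * (1 + ‖z‖ ^ 2) * (‖u - v‖ * ‖1 - conj q * p‖) := by gcongr
    _ = r * ‖u - v‖ * ((1 + ‖z‖ ^ 2) * ‖1 - conj q * p‖) := by ring
    _ ≤ r * ‖u - v‖ * (2 * ‖1 - conj (z * q) * (z * p)‖) := by gcongr
    _ = 2 * r * ‖u - v‖ * ‖1 - conj (z * q) * (z * p)‖ := by ring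

/-- Compares one step with parameter c against the fixed point of the step with parameter d. One
factor 4 / (1 - r)² comes from changing the parameter, the other from `pseudoDist_le_add`. -/
lemma pseudoDist_perturbed_step_le {r : ℝ} (hr : r < 1) {c d w f z : ℂ} (hc : ‖c‖ ≤ 1)
    (hd : ‖d‖ ≤ 1) (hw : ‖w‖ ≤ 1) (hf : ‖f‖ ≤ 1) (hz : ‖z‖ ≤ r) (hfix : schurStep d (z * f) = f) :
    pseudoDist (z * schurStep c (z * w)) (z * f)
      ≤ 2 * r / (1 + r ^ 2) * pseudoDist (z * w) (z * f) + 16 / (1 - r) ^ 4 * ‖c - d‖ := by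
  have hr0 : 0 ≤ r := (norm_nonneg z).trans hz
  have hk : ∀ q : ℂ, ‖q‖ ≤ 1 → ‖z * q‖ ≤ r := fun q hq => by
    rw [norm_mul]; exact (mul_le_of_le_one_right (norm_nonneg _) hq).trans hz
  have hzw := hk w hw
  have hzf := hk f hf
  have h1 := pseudoDist_schurStep_le hr hc hzw hzf hz
  have h2 := pseudoDist_le_add hr (hk _ (norm_schurStep_le hc (hzw.trans_lt hr)))
    (hk _ (norm_schurStep_le hc (hzf.trans_lt hr))) hzf
  have h3 := norm_schurStep_sub_param_le hr hc hd hzf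
  rw [hfix] at h3
  have h4 : ‖z * schurStep c (z * f) - z * f‖ ≤ 4 * ‖c - d‖ / (1 - r) ^ 2 := by
    rw [← mul_sub, norm_mul]
    exact (mul_le_of_le_one_left (norm_nonneg _) (hz.trans hr.le)).trans h3
  have h5 : 0 < 1 - r := by linarith
  have h6 : 4 * ‖z * schurStep c (z * f) - z * f‖ / (1 - r) ^ 2
      ≤ 16 / (1 - r) ^ 4 * ‖c - d‖ := by
    calc _ ≤ 4 * (4 * ‖c - d‖ / (1 - r) ^ 2) / (1 - r) ^ 2 := by gcongr
      _ = _ := by field_simp; ring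
  linarith

/-! ### Sequences of indices -/

lemma RatioSeq.sub_one {t : ℝ} {n N : ℕ → ℕ} (h : RatioSeq t n N) :
    RatioSeq t (fun j => n j - 1) N := by
  obtain ⟨h1, h2, h3⟩ := h
  refine ⟨(tendsto_sub_atTop_nat 1).comp h1, h2, ?_⟩
  have h4 : Tendsto (fun j => (1 : ℝ) / (N j : ℝ)) atTop (𝓝 0) :=
    tendsto_const_nhds.div_atTop (tendsto_natCast_atTop_atTop.comp h2)
  have h5 := h3.sub h4
  rw [sub_zero] at h5
  refine h5.congr' ?_
  filter_upwards [h1.eventually_ge_atTop 1] with j hj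
  rw [Nat.cast_sub hj, Nat.cast_one, sub_div]

lemma RatioSeq.add_one {t : ℝ} {n N : ℕ → ℕ} (h : RatioSeq t n N) :
    RatioSeq t (fun j => n j + 1) N := by
  obtain ⟨h1, h2, h3⟩ := h
  refine ⟨(tendsto_add_atTop_nat 1).comp h1, h2, ?_⟩
  have h4 : Tendsto (fun j => (1 : ℝ) / (N j : ℝ)) atTop (𝓝 0) :=
    tendsto_const_nhds.div_atTop (tendsto_natCast_atTop_atTop.comp h2)
  have h5 := h3.add h4
  rw [add_zero] at h5
  refine h5.congr fun j => ?_
  push_cast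
  rw [add_div]

/-! ### Convergence of `Φ_n / Φ_n^*` in the disc -/

/-- The inverse Schur iterates `Φ_n / Φ_n^*`. -/
noncomputable def schurIter (a : ℕ → ℂ) (n : ℕ) (z : ℂ) : ℂ :=
  (opuc a n).eval z / (opucStar a n).eval z

lemma norm_schurIter_le {a : ℕ → ℂ} (ha : ∀ n, ‖a n‖ < 1) (n : ℕ) {z : ℂ} (hz : ‖z‖ ≤ 1) :
    ‖schurIter a n z‖ ≤ 1 := by
  obtain ⟨h0, h1⟩ := opucStar_dominates ha n hz
  rw [schurIter, norm_div]
  exact div_le_one_of_le₀ h1 (norm_nonneg _)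

lemma schurIter_succ {a : ℕ → ℂ} (ha : ∀ n, ‖a n‖ < 1) (n : ℕ) {z : ℂ} (hz : ‖z‖ ≤ 1) :
    schurIter a (n + 1) z = schurStep (-conj (a n)) (z * schurIter a n z) := by
  obtain ⟨h0, -⟩ := opucStar_dominates ha n hz
  obtain ⟨h1, -⟩ := opucStar_dominates ha (n + 1) hz
  rw [schurIter, schurStep, schurIter, eval_opuc_succ]
  rw [eval_opucStar_succ] at h1 ⊢
  have h2 : 1 + conj (-conj (a n)) * (z * ((opuc a n).eval z / (opucStar a n).eval z))
      = ((opucStar a n).eval z - a n * (z * (opuc a n).eval z)) / (opucStar a n).eval z := by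
    simp only [map_neg, Complex.conj_conj]
    field_simp
    ring
  rw [h2]
  field_simp
  ring

/-- The Schur function of the constant sequence `c`. -/
noncomputable def constSchur (c z : ℂ) : ℂ := c / (G ‖c‖ z - z)

lemma norm_constSchur_le {c : ℂ} (hc : ‖c‖ ≤ 1) {z : ℂ} (hz : ‖z‖ < 1) :
    ‖constSchur c z‖ ≤ 1 := by
  rw [constSchur, norm_div]
  exact div_le_one_of_le₀ (le_norm_G_sub (norm_nonneg c) hc hz) (norm_nonneg _)

lemma schurStep_constSchur {c : ℂ} (hc : ‖c‖ ≤ 1) {z : ℂ} (hz : ‖z‖ < 1) :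
    schurStep c (z * constSchur c z) = constSchur c z := by
  have harc := notMem_arc_of_norm_ne_one (norm_nonneg c) hc hz.ne
  have h := schur_fixed_point harc (G_ne_self (norm_nonneg c) hc harc (Or.inr hz))
  have h1 : ‖z * constSchur c z‖ < 1 := by
    rw [norm_mul]
    exact (mul_le_of_le_one_right (norm_nonneg _) (norm_constSchur_le hc hz)).trans_lt hz
  have h2 := one_sub_le_norm_add hc le_rfl (q := z * constSchur c z)
  have h3 : 1 + conj c * (z * constSchur c z) ≠ 0 := norm_pos_iff.mp (by linarith)
  rw [schurStep, div_eq_iff h3, ← mul_assoc]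
  exact h.symm

section Convergence

variable {t : ℝ} {α : ℕ → ℕ → ℂ} {α₀ : ℂ}

lemma tendsto_neg_conj_coeffs (hlim : RatioTendsto t α α₀) {n N : ℕ → ℕ} (h : RatioSeq t n N) :
    Tendsto (fun j => ‖-conj (coeffs α (N j) (n j)) - -conj α₀‖) atTop (𝓝 0) := by
  have h1 := hlim n N h
  have h2 := (Complex.continuous_conj.tendsto α₀).comp h1
  have h3 := (h2.neg.sub_const (-conj α₀)).norm
  simpa using! h3

/-- Looking back k steps from a crude initial bound 2 / (1 - r), every step contracts and adds an
error that vanishes in the limit. The induction on k passes from n - 1 to n, so the statement covers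
all admissible sequences at once. -/
lemma eventually_pseudoDist_le (hα : ∀ n N, ‖α n N‖ < 1) (hα₀ : ‖α₀‖ ≤ 1)
    (hlim : RatioTendsto t α α₀) {r : ℝ} (hr0 : 0 ≤ r) (hr : r < 1) (k : ℕ) :
    ∀ n N : ℕ → ℕ, RatioSeq t n N → ∀ ε > 0, ∀ᶠ j in atTop, ∀ z : ℂ, ‖z‖ ≤ r →
      pseudoDist (z * schurIter (coeffs α (N j)) (n j) z) (z * constSchur (-conj α₀) z)
        ≤ (2 * r / (1 + r ^ 2)) ^ k * (2 / (1 - r)) + ε := by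
  have hc : ‖-conj α₀‖ ≤ 1 := by simpa using hα₀
  have ha : ∀ N n, ‖coeffs α N n‖ < 1 := fun N n => hα n N
  induction k with
  | zero =>
    intro n N _ ε hε
    refine Eventually.of_forall fun j z hz => ?_
    have h1 : ‖schurIter (coeffs α (N j)) (n j) z‖ ≤ 1 := norm_schurIter_le (ha _) _ (by linarith)
    have h2 := norm_constSchur_le hc (hz.trans_lt hr)
    set p := schurIter (coeffs α (N j)) (n j) z
    set q := constSchur (-conj α₀) z
    have hk : ∀ q : ℂ, ‖q‖ ≤ 1 → ‖z * q‖ ≤ r := fun q hq => by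
      rw [norm_mul]; exact (mul_le_of_le_one_right (norm_nonneg _) hq).trans hz
    have h3 := one_sub_le_norm (p := conj (z * q)) (by simpa using (hk q h2).trans hr.le) (hk p h1)
    have h4 : ‖z * p - z * q‖ ≤ 2 := by
      have := norm_sub_le (z * p) (z * q)
      linarith [hk p h1, hk q h2]
    rw [pow_zero, one_mul, pseudoDist]
    have h5 : 0 < 1 - r := by linarith
    have : ‖z * p - z * q‖ / ‖1 - conj (z * q) * (z * p)‖ ≤ 2 / (1 - r) := by gcongr
    linarith
  | succ k ih =>
    intro n N h ε hε
    have hκ1 : 2 * r / (1 + r ^ 2) ≤ 1 := by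
      rw [div_le_one (by positivity)]; nlinarith [sq_nonneg (1 - r)]
    have hκ0 : 0 ≤ 2 * r / (1 + r ^ 2) := by positivity
    have h5 : 0 < 1 - r := by linarith
    have hpar := (tendsto_neg_conj_coeffs hlim h.sub_one).const_mul (16 / (1 - r) ^ 4)
    rw [mul_zero] at hpar
    filter_upwards [ih _ N h.sub_one (ε / 2) (by positivity),
      hpar.eventually_lt_const (by positivity : 0 < ε / 2), h.1.eventually_ge_atTop 1]
      with j hj1 hj2 hj3 z hz
    have hs := schurIter_succ (ha (N j)) (n j - 1) (hz.trans hr.le)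
    rw [Nat.sub_add_cancel hj3] at hs
    have hstep := pseudoDist_perturbed_step_le hr (c := -conj (coeffs α (N j) (n j - 1)))
      (by simpa using (ha (N j) (n j - 1)).le) hc
      (norm_schurIter_le (ha (N j)) (n j - 1) (hz.trans hr.le))
      (norm_constSchur_le hc (hz.trans_lt hr)) hz (schurStep_constSchur hc (hz.trans_lt hr))
    rw [← hs] at hstep
    have h6 := mul_le_mul_of_nonneg_left (hj1 z hz) hκ0
    have h7 : 2 * r / (1 + r ^ 2) * (ε / 2) ≤ ε / 2 :=
      mul_le_of_le_one_left (by positivity) hκ1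
    rw [pow_succ]
    linarith

/-- The previous bound compares z f_{n-1} with zf. One further step turns this into a bound on f_n -
f and avoids dividing by z, so z = 0 needs no separate treatment. -/
lemma eventually_norm_schurIter_sub_le (hα : ∀ n N, ‖α n N‖ < 1) (hα₀ : ‖α₀‖ ≤ 1)
    (hlim : RatioTendsto t α α₀) {r : ℝ} (hr0 : 0 ≤ r) (hr : r < 1) {n N : ℕ → ℕ}
    (h : RatioSeq t n N) {ε : ℝ} (hε : 0 < ε) : ∀ᶠ j in atTop, ∀ z : ℂ, ‖z‖ ≤ r →
      ‖schurIter (coeffs α (N j)) (n j) z - constSchur (-conj α₀) z‖ ≤ ε := by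
  have hc : ‖-conj α₀‖ ≤ 1 := by simpa using hα₀
  have ha : ∀ N n, ‖coeffs α N n‖ < 1 := fun N n => hα n N
  have h5 : 0 < 1 - r := by linarith
  have hκ0 : 0 ≤ 2 * r / (1 + r ^ 2) := by positivity
  have hκ1 : 2 * r / (1 + r ^ 2) < 1 := by
    rw [div_lt_one (by positivity)]; nlinarith [sq_pos_of_pos h5]
  -- the target accuracy for the pseudohyperbolic distance
  set η := ε * (1 - r) ^ 2 / 8 with hη
  have hη0 : 0 < η := by positivity
  have hpow : Tendsto (fun k => (2 * r / (1 + r ^ 2)) ^ k * (2 / (1 - r))) atTop (𝓝 0) := by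
    have := (tendsto_pow_atTop_nhds_zero_of_lt_one hκ0 hκ1).mul_const (2 / (1 - r))
    rwa [zero_mul] at this
  obtain ⟨k, hk⟩ := (hpow.eventually_lt_const hη0).exists
  have hpar := (tendsto_neg_conj_coeffs hlim h.sub_one).const_mul (4 / (1 - r) ^ 2)
  rw [mul_zero] at hpar
  filter_upwards [eventually_pseudoDist_le hα hα₀ hlim hr0 hr k _ N h.sub_one η hη0,
    hpar.eventually_lt_const (by positivity : 0 < ε / 2), h.1.eventually_ge_atTop 1]
    with j hj1 hj2 hj3 z hz
  have hs := schurIter_succ (ha (N j)) (n j - 1) (hz.trans hr.le)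
  rw [Nat.sub_add_cancel hj3] at hs
  have hw := norm_schurIter_le (ha (N j)) (n j - 1) (hz.trans hr.le)
  have hf := norm_constSchur_le hc (hz.trans_lt hr)
  have hfix := schurStep_constSchur hc (hz.trans_lt hr)
  have hp := hj1 z hz
  rw [hs]
  set w := schurIter (coeffs α (N j)) (n j - 1) z
  set f := constSchur (-conj α₀) z
  set c := -conj (coeffs α (N j) (n j - 1))
  have hc' : ‖c‖ ≤ 1 := by simpa [c] using (ha (N j) (n j - 1)).le
  have hkk : ∀ q : ℂ, ‖q‖ ≤ 1 → ‖z * q‖ ≤ r := fun q hq => by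
    rw [norm_mul]; exact (mul_le_of_le_one_right (norm_nonneg _) hq).trans hz
  have h1 : ‖z * w - z * f‖ ≤ 4 * η := by
    have h2 : ‖1 - conj (z * f) * (z * w)‖ ≤ 2 := by
      refine (norm_sub_le _ _).trans ?_
      rw [norm_one, norm_mul, RCLike.norm_conj]
      nlinarith [hkk w hw, hkk f hf, norm_nonneg (z * w), norm_nonneg (z * f)]
    have h3 := one_sub_le_norm (p := conj (z * f)) (by simpa using (hkk f hf).trans hr.le) (hkk w hw)
    have h4 : pseudoDist (z * w) (z * f) ≤ 2 * η := by linarith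
    rw [pseudoDist, div_le_iff₀ (by linarith)] at h4
    nlinarith
  have h2 := norm_schurStep_sub_le hr hc' (hkk w hw) (hkk f hf)
  have h3 := norm_schurStep_sub_param_le hr hc' hc (hkk f hf)
  rw [hfix] at h3
  have h4 : ‖z * w - z * f‖ / (1 - r) ^ 2 ≤ ε / 2 := by
    rw [div_le_iff₀ (by positivity)]
    linarith
  have h6 : 4 * ‖c - -conj α₀‖ / (1 - r) ^ 2 ≤ ε / 2 := by
    rw [mul_div_right_comm]; exact hj2.le
  calc _ ≤ ‖schurStep c (z * w) - schurStep c (z * f)‖ + ‖schurStep c (z * f) - f‖ :=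
        norm_sub_le_norm_sub_add_norm_sub _ _ _
    _ ≤ ε := by linarith

end Convergence

/-! ### Joint limits and uniform convergence on compact sets -/

lemma eventually_forall_of_isCompact {P : ℕ → ℂ → Prop} {K : Set ℂ} (hK : IsCompact K)
    (h : ∀ z ∈ K, ∀ᶠ p : ℕ × ℂ in atTop ×ˢ 𝓝[K] z, P p.1 p.2) :
    ∀ᶠ j in atTop, ∀ z ∈ K, P j z := by
  refine hK.induction_on (p := fun s => ∀ᶠ j in atTop, ∀ z ∈ s, P j z) ?_ ?_ ?_ ?_
  · simp
  · intro s s' hs h'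
    filter_upwards [h'] with j hj z hz using hj z (hs hz)
  · intro s s' h1 h2
    filter_upwards [h1, h2] with j hj1 hj2 z hz
    rcases hz with hz | hz
    exacts [hj1 z hz, hj2 z hz]
  · intro z hz
    obtain ⟨pa, ha, pb, hb, hab⟩ := eventually_prod_iff.mp (h z hz)
    exact ⟨{w | pb w}, hb, ha.mono fun j hj w hw => hab hj hw⟩

/-- The joint limits make g continuous on K automatically, which turns local closeness to g z into
closeness to g w. -/
lemma tendstoUniformlyOn_of_joint {F : ℕ → ℂ → ℂ} {g : ℂ → ℂ} {K : Set ℂ} (hK : IsCompact K)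
    (h : ∀ z ∈ K, Tendsto (fun p : ℕ × ℂ => F p.1 p.2) (atTop ×ˢ 𝓝[K] z) (𝓝 (g z))) :
    TendstoUniformlyOn F g atTop K := by
  rw [Metric.tendstoUniformlyOn_iff]
  intro ε hε
  refine eventually_forall_of_isCompact hK fun z hz => ?_
  have h1 := Metric.tendsto_nhds.mp (h z hz) (ε / 3) (by positivity)
  obtain ⟨pa, ha, pb, hb, hab⟩ := eventually_prod_iff.mp h1
  have h2 : ∀ᶠ w in 𝓝[K] z, pb w ∧ w ∈ K := hb.and self_mem_nhdsWithin
  refine eventually_prod_iff.mpr ⟨pa, ha, _, h2, ?_⟩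
  rintro j hj w ⟨hw, hwK⟩
  -- the value of the limit at `w` is close to the value at `z`
  have h3 : Tendsto (fun j => F j w) atTop (𝓝 (g w)) := by
    refine (h w hwK).comp (tendsto_id.prodMk ?_)
    exact tendsto_nhdsWithin_iff.mpr ⟨tendsto_const_nhds, Eventually.of_forall fun _ => hwK⟩
  have h4 : dist (g w) (g z) ≤ ε / 3 :=
    le_of_tendsto (h3.dist tendsto_const_nhds) (ha.mono fun i hi => (hab hi hw).le)
  have h5 : dist (F j w) (g z) < ε / 3 := hab hj hw
  have h6 := dist_triangle_right (g w) (F j w) (g z)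
  linarith

lemma ratioTendstoOnCompacts_of_joint {t : ℝ} {P Q : ℕ → ℕ → ℂ[X]} {g : ℂ → ℂ} {S : Set ℂ}
    (h : ∀ n N : ℕ → ℕ, RatioSeq t n N → ∀ z ∈ S,
      (∀ᶠ p : ℕ × ℂ in atTop ×ˢ 𝓝 z, (Q (n p.1) (N p.1)).eval p.2 ≠ 0) ∧
      Tendsto (fun p : ℕ × ℂ => (P (n p.1) (N p.1)).eval p.2 / (Q (n p.1) (N p.1)).eval p.2)
        (atTop ×ˢ 𝓝 z) (𝓝 (g z))) :
    RatioTendstoOnCompacts t P Q g S := by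
  intro n N hnN K hKS hK
  have hle : ∀ z, (atTop : Filter ℕ) ×ˢ 𝓝[K] z ≤ atTop ×ˢ 𝓝 z := fun z =>
    Filter.prod_mono le_rfl nhdsWithin_le_nhds
  exact ⟨eventually_forall_of_isCompact hK fun z hz => hle z (h n N hnN z (hKS hz)).1,
    tendstoUniformlyOn_of_joint hK fun z hz => (h n N hnN z (hKS hz)).2.mono_left (hle z)⟩

/-- Eventually equi-Lipschitz functions that converge pointwise near `ξ` along a filter have a
joint limit at `ξ`. -/
lemma tendsto_joint_of_lipschitz {m : ℕ → ℂ → ℂ} {M : ℂ → ℂ} {ξ c : ℂ} {δ L : ℝ} (hδ : 0 < δ)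
    (hL : ∀ᶠ j in atTop, ∀ z ∈ Metric.ball ξ δ, ∀ w ∈ Metric.ball ξ δ,
      ‖m j z - m j w‖ ≤ L * ‖z - w‖)
    {l : Filter ℂ} [l.NeBot] (hl : l ≤ 𝓝 ξ)
    (hp : ∀ᶠ w in l, Tendsto (fun j => m j w) atTop (𝓝 (M w))) (hM : Tendsto M l (𝓝 c)) :
    Tendsto (fun p : ℕ × ℂ => m p.1 p.2) (atTop ×ˢ 𝓝 ξ) (𝓝 c) := by
  rw [Metric.tendsto_nhds]
  intro ε hε
  -- Two points of the η-ball are at distance at most ε / (2(|L| + 1)), so the Lipschitz error is at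
  -- most ε / 2; the two other errors are ε / 4 each.
  set η := min δ (ε / (4 * (|L| + 1))) with hη
  have hη0 : 0 < η := lt_min hδ (by positivity)
  have hball : ∀ᶠ w in 𝓝 ξ, w ∈ Metric.ball ξ η := Metric.ball_mem_nhds ξ hη0
  obtain ⟨w, ⟨hw1, hw2⟩, hw3⟩ :=
    ((hp.and (Metric.tendsto_nhds.mp hM (ε / 4) (by positivity))).and (hl hball)).exists
  have h1 := hL.and (Metric.tendsto_nhds.mp hw1 (ε / 4) (by positivity))
  refine eventually_prod_iff.mpr ⟨_, h1, _, hball, ?_⟩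
  rintro j ⟨hj1, hj2⟩ z hz
  have hsub : ∀ x, x ∈ Metric.ball ξ η → x ∈ Metric.ball ξ δ := fun x hx =>
    Metric.ball_subset_ball (min_le_left _ _) hx
  have h2 := hj1 z (hsub z hz) w (hsub w hw3)
  have h3 : ‖z - w‖ ≤ 2 * (ε / (4 * (|L| + 1))) := by
    rw [← dist_eq_norm]
    have := dist_triangle_right z w ξ
    have e1 := (Metric.mem_ball.mp hz).trans_le (min_le_right _ _)
    have e2 := (Metric.mem_ball.mp hw3).trans_le (min_le_right _ _)
    linarith
  have h4 : L * ‖z - w‖ ≤ ε / 2 := by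
    calc L * ‖z - w‖ ≤ (|L| + 1) * ‖z - w‖ := by
          have := le_abs_self L
          have := norm_nonneg (z - w)
          gcongr
          linarith
      _ ≤ (|L| + 1) * (2 * (ε / (4 * (|L| + 1)))) := by gcongr
      _ = ε / 2 := by field_simp; ring
  rw [← dist_eq_norm] at h2
  have h5 := dist_triangle4 (m j z) (m j w) (M w) c
  change dist (m j z) c < ε
  linarith

/-! ### Gaps of the zeros -/

/-- Eventually the zeros of `Φ_{n_j, N_j}^{(β)}` stay away from `ξ`. -/
def HasGap (α : ℕ → ℕ → ℂ) (β : ℂ) (n N : ℕ → ℕ) (ξ : ℂ) : Prop :=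
  ∃ δ > 0, ∀ᶠ j in atTop, ∀ x, ‖x‖ = 1 → (popuc (coeffs α (N j)) β (n j)).eval x = 0 →
    δ ≤ ‖ξ - x‖

lemma hasGap_of_norm_ne_one {α : ℕ → ℕ → ℂ} {β : ℂ} {n N : ℕ → ℕ} {ξ : ℂ} (h : ‖ξ‖ ≠ 1) :
    HasGap α β n N ξ := by
  refine ⟨|‖ξ‖ - 1|, abs_pos.mpr (sub_ne_zero.mpr h), Eventually.of_forall fun j x hx _ => ?_⟩
  rw [← hx]
  exact abs_norm_sub_norm_le ξ x

lemma hasGap_of_notMem_limitZeros {α : ℕ → ℕ → ℂ} {β : ℂ} {t : ℝ} {n N : ℕ → ℕ}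
    (hnN : RatioSeq t n N) {ξ : ℂ} (h : ξ ∉ limitZeros α t β) : HasGap α β n N ξ := by
  by_cases hξ : ‖ξ‖ = 1
  swap
  · exact hasGap_of_norm_ne_one hξ
  have h1 : liminf (fun j => Metric.infEDist ξ (popucZeros α β (n j) (N j))) atTop ≠ 0 :=
    fun h0 => h ⟨hξ, n, N, hnN, h0⟩
  obtain ⟨c, hc0, hc⟩ := exists_between (pos_iff_ne_zero.mpr h1)
  have hctop : c ≠ ⊤ := ne_top_of_lt hc
  refine ⟨c.toReal, ENNReal.toReal_pos hc0.ne' hctop, ?_⟩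
  filter_upwards [eventually_lt_of_lt_liminf hc] with j hj x hx hx0
  have h2 : c ≤ edist ξ x := hj.le.trans (Metric.infEDist_le_edist_of_mem ⟨hx, hx0⟩)
  rw [← dist_eq_norm]
  rw [edist_dist] at h2
  exact ENNReal.toReal_le_of_le_ofReal dist_nonneg h2

lemma HasGap.ball {α : ℕ → ℕ → ℂ} {β : ℂ} {n N : ℕ → ℕ} {ξ : ℂ} (h : HasGap α β n N ξ) :
    ∃ δ > 0, ∀ᶠ j in atTop, ∀ z ∈ Metric.ball ξ δ, ∀ x, ‖x‖ = 1 →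
      (popuc (coeffs α (N j)) β (n j)).eval x = 0 → δ ≤ ‖z - x‖ := by
  obtain ⟨δ, hδ, h⟩ := h
  refine ⟨δ / 2, by positivity, h.mono fun j hj z hz x hx hx0 => ?_⟩
  have h1 := hj x hx hx0
  rw [Metric.mem_ball, dist_comm] at hz
  rw [← dist_eq_norm] at h1 ⊢
  have := dist_triangle ξ z x
  linarith

lemma HasGap.eventually {α : ℕ → ℕ → ℂ} {β : ℂ} {n N : ℕ → ℕ} {ξ : ℂ} (h : HasGap α β n N ξ) :
    ∀ᶠ z in 𝓝 ξ, HasGap α β n N z := by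
  obtain ⟨δ, hδ, h⟩ := h.ball
  filter_upwards [Metric.ball_mem_nhds ξ hδ] with z hz
  exact ⟨δ, hδ, h.mono fun j hj => hj z hz⟩

lemma HasGap.popuc_ne_zero {α : ℕ → ℕ → ℂ} (hα : ∀ n N, ‖α n N‖ < 1) {β : ℂ} (hβ : ‖β‖ = 1)
    {n N : ℕ → ℕ} {ξ : ℂ} (h : HasGap α β n N ξ) :
    ∀ᶠ p : ℕ × ℂ in atTop ×ˢ 𝓝 ξ, (popuc (coeffs α (N p.1)) β (n p.1)).eval p.2 ≠ 0 := by
  obtain ⟨δ, hδ, h⟩ := h.ball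
  refine eventually_prod_iff.mpr ⟨_, h, _, Metric.ball_mem_nhds ξ hδ, fun {j} hj {z} hz => ?_⟩
  exact popuc_eval_ne_zero_of_gap (fun k => hα k (N j)) hβ hδ (hj z hz)

/-! ### Limits off the unit circle -/

section Limits

variable {t : ℝ} {α : ℕ → ℕ → ℂ} {α₀ : ℂ}

lemma continuousAt_constSchur {c : ℂ} (hc : ‖c‖ ≤ 1) {z : ℂ} (hz : ‖z‖ < 1) :
    ContinuousAt (constSchur c) z := by
  have harc := notMem_arc_of_norm_ne_one (norm_nonneg c) hc hz.ne
  have h1 := continuousAt_G (norm_nonneg c) hc harc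
  have h2 := sub_ne_zero.mpr (G_ne_self (norm_nonneg c) hc harc (Or.inr hz))
  unfold constSchur
  exact continuousAt_const.div (h1.sub continuousAt_id) h2

lemma tendsto_schurIter (hα : ∀ n N, ‖α n N‖ < 1) (hα₀ : ‖α₀‖ ≤ 1) (hlim : RatioTendsto t α α₀)
    {n N : ℕ → ℕ} (h : RatioSeq t n N) {z : ℂ} (hz : ‖z‖ < 1) :
    Tendsto (fun p : ℕ × ℂ => schurIter (coeffs α (N p.1)) (n p.1) p.2) (atTop ×ˢ 𝓝 z)
      (𝓝 (constSchur (-conj α₀) z)) := by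
  have hc : ‖-conj α₀‖ ≤ 1 := by simpa using hα₀
  obtain ⟨r, hr1, hr2⟩ := exists_between hz
  have hcont := (continuousAt_constSchur hc hz).tendsto.comp
    (tendsto_snd (f := (atTop : Filter ℕ)) (g := 𝓝 z))
  have hdiff : Tendsto (fun p : ℕ × ℂ => schurIter (coeffs α (N p.1)) (n p.1) p.2
      - constSchur (-conj α₀) p.2) (atTop ×ˢ 𝓝 z) (𝓝 0) := by
    rw [Metric.tendsto_nhds]
    intro ε hε
    refine eventually_prod_iff.mpr ⟨_, eventually_norm_schurIter_sub_le hα hα₀ hlim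
      ((norm_nonneg z).trans hr1.le) hr2 h (half_pos hε), fun w => ‖w‖ < r,
      (continuous_norm.tendsto z).eventually_lt_const hr1, fun {j} hj {w} hw => ?_⟩
    rw [dist_zero_right]
    exact (hj w hw.le).trans_lt (half_lt_self hε)
  have := hdiff.add hcont
  simpa using! this

lemma opucStar_div_opuc_eq (a : ℕ → ℂ) (n : ℕ) {z : ℂ} (hz : z ≠ 0) :
    (opucStar a n).eval z / (opuc a n).eval z = conj (schurIter a n (1 / conj z)) := by
  obtain ⟨h1, h2⟩ := eval_reflection a n hz
  rw [h1, h2, schurIter, map_div₀, mul_div_mul_left _ _ (pow_ne_zero n hz)]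

lemma norm_one_div_conj_lt {z : ℂ} (hz : 1 < ‖z‖) : ‖1 / conj z‖ < 1 := by
  rw [norm_div, norm_one, RCLike.norm_conj]
  exact (div_lt_one (by linarith)).mpr hz

/-- Reflected convergence in the exterior of the disc. -/
lemma tendsto_opucStar_div_opuc (hα : ∀ n N, ‖α n N‖ < 1) (hα₀ : ‖α₀‖ ≤ 1)
    (hlim : RatioTendsto t α α₀) {n N : ℕ → ℕ} (h : RatioSeq t n N) {z : ℂ} (hz : 1 < ‖z‖) :
    Tendsto (fun p : ℕ × ℂ => (opucStar (coeffs α (N p.1)) (n p.1)).eval p.2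
      / (opuc (coeffs α (N p.1)) (n p.1)).eval p.2) (atTop ×ˢ 𝓝 z)
      (𝓝 (conj (constSchur (-conj α₀) (1 / conj z)))) := by
  have hz0 : z ≠ 0 := norm_pos_iff.mp (by linarith)
  have hzc : conj z ≠ 0 := by simpa using hz0
  have hmap : Tendsto (fun w : ℂ => 1 / conj w) (𝓝 z) (𝓝 (1 / conj z)) :=
    tendsto_const_nhds.div (Complex.continuous_conj.tendsto z) hzc
  have h1 := (tendsto_schurIter hα hα₀ hlim h (norm_one_div_conj_lt hz)).comp
    (tendsto_id.prodMap hmap)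
  have h2 := (Complex.continuous_conj.tendsto _).comp h1
  refine h2.congr' ?_
  have hne : ∀ᶠ w in 𝓝 z, w ≠ 0 := isOpen_ne.mem_nhds hz0
  filter_upwards [(tendsto_snd (f := (atTop : Filter ℕ))).eventually hne] with p hp
  exact (opucStar_div_opuc_eq _ _ hp).symm

lemma conj_constSchur_one_div_conj {c : ℂ} (hc : ‖c‖ ≤ 1) {z : ℂ} (hz : 1 < ‖z‖) :
    G ‖c‖ z ≠ 1 ∧
      conj (constSchur c (1 / conj z)) = conj c * z / (G ‖c‖ z - 1) := by
  have hz0 : z ≠ 0 := norm_pos_iff.mp (by linarith)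
  have hy := norm_one_div_conj_lt hz
  have h1 := G_one_div_conj (norm_nonneg c) hc
    (notMem_arc_of_norm_ne_one (norm_nonneg c) hc hz.ne') hz0
  have h2 := G_ne_self (norm_nonneg c) hc
    (notMem_arc_of_norm_ne_one (norm_nonneg c) hc hy.ne) (Or.inr hy)
  have h3 : G ‖c‖ z ≠ 1 := by
    intro h
    rw [h] at h1
    apply h2
    have := congrArg conj h1
    rw [Complex.conj_conj] at this
    rw [this]
    simp
  refine ⟨h3, ?_⟩
  have h4 : G ‖c‖ z - 1 ≠ 0 := sub_ne_zero.mpr h3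
  rw [constSchur, map_div₀, map_sub, h1, map_div₀, map_one, Complex.conj_conj]
  field_simp

/-- The limit of `Φ_n / Φ_{n+1}^{(β)}`, where `c = -conj α₀ * β`. -/
noncomputable def mLim (c z : ℂ) : ℂ :=
  if ‖z‖ ≤ 1 then c / (z * (1 + c) - G ‖c‖ z)
  else (G ‖c‖ z - 1) / (z * (G ‖c‖ z - 1 - conj c))

lemma norm_mul_unit {c β : ℂ} (hβ : ‖β‖ = 1) : ‖c * β‖ = ‖c‖ := by rw [norm_mul, hβ, mul_one]

lemma mul_conj_of_norm_eq_one {β : ℂ} (hβ : ‖β‖ = 1) : β * conj β = 1 := by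
  rw [Complex.mul_conj']; simp [hβ]

/-- Division of numerator and denominator of Φ_n / Φ_{n+1}^{(β)} by Φ_n^* gives f_n / (z f_n - conj
β); this is its limit. In the exterior one divides by Φ_n instead. -/
lemma mLim_of_norm_lt {c β : ℂ} (hc : ‖c‖ ≤ 1) (hβ : ‖β‖ = 1) {z : ℂ} (hz : ‖z‖ < 1) :
    z * constSchur c z - conj β ≠ 0 ∧
      constSchur c z / (z * constSchur c z - conj β) = mLim (c * β) z := by
  have hcβ : ‖c * β‖ ≤ 1 := by rwa [norm_mul_unit hβ]
  have hD := mFun_denom_ne_zero hcβ hz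
  rw [norm_mul_unit hβ] at hD
  have h1 := sub_ne_zero.mpr (G_ne_self (norm_nonneg c) hc
    (notMem_arc_of_norm_ne_one (norm_nonneg c) hc hz.ne) (Or.inr hz))
  have hb := mul_conj_of_norm_eq_one hβ
  have hβ0 : β ≠ 0 := left_ne_zero_of_mul_eq_one hb
  have e : z * constSchur c z - conj β
      = conj β * (z * (1 + c * β) - G ‖c‖ z) / (G ‖c‖ z - z) := by
    rw [constSchur]
    field_simp
    linear_combination -z * c * hb
  refine ⟨?_, ?_⟩
  · rw [e]
    exact div_ne_zero (mul_ne_zero (right_ne_zero_of_mul_eq_one hb) hD) h1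
  · have hb' := right_ne_zero_of_mul_eq_one hb
    rw [e, mLim, if_pos hz.le, norm_mul_unit hβ, constSchur]
    field_simp
    linear_combination (-c) * hb

lemma mLim_of_one_lt_norm {c β : ℂ} (hc : ‖c‖ ≤ 1) (hβ : ‖β‖ = 1) {z : ℂ} (hz : 1 < ‖z‖) :
    z - conj β * conj (constSchur c (1 / conj z)) ≠ 0 ∧
      1 / (z - conj β * conj (constSchur c (1 / conj z))) = mLim (c * β) z := by
  have hz0 : z ≠ 0 := norm_pos_iff.mp (by linarith)
  have hcβ : ‖c * β‖ ≤ 1 := by rwa [norm_mul_unit hβ]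
  have hE := mFun_denom_ne_zero' hcβ hz
  rw [norm_mul_unit hβ] at hE
  obtain ⟨h1, h2⟩ := conj_constSchur_one_div_conj hc hz
  have h1' := sub_ne_zero.mpr h1
  have e : z - conj β * conj (constSchur c (1 / conj z))
      = z * (G ‖c‖ z - 1 - conj (c * β)) / (G ‖c‖ z - 1) := by
    rw [h2, map_mul]
    field_simp
  refine ⟨?_, ?_⟩
  · rw [e]
    exact div_ne_zero (mul_ne_zero hz0 hE) h1'
  · rw [e, mLim, if_neg hz.not_ge, norm_mul_unit hβ, one_div_div]

lemma tendsto_opuc_div_popuc_of_norm_lt (hα : ∀ n N, ‖α n N‖ < 1) (hα₀ : ‖α₀‖ ≤ 1)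
    (hlim : RatioTendsto t α α₀) {β : ℂ} (hβ : ‖β‖ = 1) {n N : ℕ → ℕ} (h : RatioSeq t n N)
    {z : ℂ} (hz : ‖z‖ < 1) :
    Tendsto (fun p : ℕ × ℂ => (opuc (coeffs α (N p.1)) (n p.1)).eval p.2
      / (popuc (coeffs α (N p.1)) β (n p.1 + 1)).eval p.2) (atTop ×ˢ 𝓝 z)
      (𝓝 (mLim (-conj α₀ * β) z)) := by
  have hc : ‖-conj α₀‖ ≤ 1 := by simpa using hα₀
  obtain ⟨h1, h2⟩ := mLim_of_norm_lt hc hβ hz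
  have h3 := tendsto_schurIter hα hα₀ hlim h hz
  have h4 : Tendsto (fun p : ℕ × ℂ => p.2) ((atTop : Filter ℕ) ×ˢ 𝓝 z) (𝓝 z) := tendsto_snd
  rw [← h2]
  refine (h3.div ((h4.mul h3).sub_const (conj β)) h1).congr' ?_
  filter_upwards [h4.eventually ((continuous_norm.tendsto z).eventually_lt_const hz)] with p hp
  obtain ⟨h0, -⟩ := opucStar_dominates (fun k => hα k (N p.1)) (n p.1) (le_of_lt hp)
  have h0' : (opucStar (coeffs α (N p.1)) (n p.1)).eval p.2 ≠ 0 := h0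
  simp only [Pi.div_apply, schurIter, eval_popuc_succ]
  have e : p.2 * ((opuc (coeffs α (N p.1)) (n p.1)).eval p.2
      / (opucStar (coeffs α (N p.1)) (n p.1)).eval p.2) - conj β
      = (p.2 * (opuc (coeffs α (N p.1)) (n p.1)).eval p.2
        - conj β * (opucStar (coeffs α (N p.1)) (n p.1)).eval p.2)
        / (opucStar (coeffs α (N p.1)) (n p.1)).eval p.2 := by
    field_simp
  rw [e, div_div_div_cancel_right₀ h0']

lemma tendsto_opuc_div_popuc_of_one_lt_norm (hα : ∀ n N, ‖α n N‖ < 1) (hα₀ : ‖α₀‖ ≤ 1)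
    (hlim : RatioTendsto t α α₀) {β : ℂ} (hβ : ‖β‖ = 1) {n N : ℕ → ℕ} (h : RatioSeq t n N)
    {z : ℂ} (hz : 1 < ‖z‖) :
    Tendsto (fun p : ℕ × ℂ => (opuc (coeffs α (N p.1)) (n p.1)).eval p.2
      / (popuc (coeffs α (N p.1)) β (n p.1 + 1)).eval p.2) (atTop ×ˢ 𝓝 z)
      (𝓝 (mLim (-conj α₀ * β) z)) := by
  have hc : ‖-conj α₀‖ ≤ 1 := by simpa using hα₀
  obtain ⟨h1, h2⟩ := mLim_of_one_lt_norm hc hβ hz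
  have h3 := tendsto_opucStar_div_opuc hα hα₀ hlim h hz
  have h4 : Tendsto (fun p : ℕ × ℂ => p.2) ((atTop : Filter ℕ) ×ˢ 𝓝 z) (𝓝 z) := tendsto_snd
  rw [← h2]
  refine (tendsto_const_nhds.div (h4.sub (h3.const_mul (conj β))) h1).congr' ?_
  filter_upwards [h4.eventually ((continuous_norm.tendsto z).eventually_const_lt hz)] with p hp
  obtain ⟨h0, -⟩ := opuc_dominates (fun k => hα k (N p.1)) (n p.1) (le_of_lt hp)
  have h0' : (opuc (coeffs α (N p.1)) (n p.1)).eval p.2 ≠ 0 := h0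
  simp only [Pi.div_apply, eval_popuc_succ]
  have e : p.2 - conj β * ((opucStar (coeffs α (N p.1)) (n p.1)).eval p.2
      / (opuc (coeffs α (N p.1)) (n p.1)).eval p.2)
      = (p.2 * (opuc (coeffs α (N p.1)) (n p.1)).eval p.2
        - conj β * (opucStar (coeffs α (N p.1)) (n p.1)).eval p.2)
        / (opuc (coeffs α (N p.1)) (n p.1)).eval p.2 := by
    field_simp
  rw [e, one_div_div]

end Limits

/-! ### Limits at points of the unit circle -/

lemma nhdsWithin_ball_neBot {ξ : ℂ} (hξ : ‖ξ‖ = 1) : (𝓝[Metric.ball 0 1] ξ).NeBot := by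
  rw [← mem_closure_iff_nhdsWithin_neBot, closure_ball 0 one_ne_zero]
  simp [hξ]

/-- The fixed point equation rearranges to (1 - w) f = c - conj c w f², and |f| ≤ 1. -/
lemma norm_one_sub_mul_constSchur_le {c : ℂ} (hc : ‖c‖ ≤ 1) {w : ℂ} (hw : ‖w‖ < 1) :
    ‖1 - w‖ * ‖constSchur c w‖ ≤ 2 * ‖c‖ := by
  have harc := notMem_arc_of_norm_ne_one (norm_nonneg c) hc hw.ne
  have h := schur_fixed_point harc (G_ne_self (norm_nonneg c) hc harc (Or.inr hw))
  have hf := norm_constSchur_le hc hw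
  change constSchur c w * (1 + conj c * w * constSchur c w) = c + w * constSchur c w at h
  have e : (1 - w) * constSchur c w = c - conj c * (w * constSchur c w ^ 2) := by
    linear_combination h
  rw [← norm_mul, e]
  refine (norm_sub_le _ _).trans ?_
  rw [norm_mul, RCLike.norm_conj, norm_mul, norm_pow]
  have : ‖w‖ * ‖constSchur c w‖ ^ 2 ≤ 1 := by
    have h1 : ‖constSchur c w‖ ^ 2 ≤ 1 := pow_le_one₀ (norm_nonneg _) hf
    nlinarith [norm_nonneg w, sq_nonneg ‖constSchur c w‖]
  nlinarith [norm_nonneg c]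

/-- With B = βwf one has w m = B / (B - 1) and 1 - |B|² = -2 |B - 1|² (Re(w m) - 1/2). Since |B - 1|
≤ 2 and |B| ≤ |f|, the constant is 8. -/
lemma one_sub_norm_sq_constSchur_le {c β : ℂ} (hc : ‖c‖ ≤ 1) (hβ : ‖β‖ = 1) {w : ℂ}
    (hw : ‖w‖ < 1) {e : ℝ} (he : |(w * mLim (c * β) w).re - 1 / 2| ≤ e) :
    1 - ‖constSchur c w‖ ^ 2 ≤ 8 * e := by
  obtain ⟨h1, h2⟩ := mLim_of_norm_lt hc hβ hw
  have hf := norm_constSchur_le hc hw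
  set f := constSchur c w
  have hb := mul_conj_of_norm_eq_one hβ
  set B := β * w * f with hB
  have hB1 : B - 1 = β * (w * f - conj β) := by rw [hB]; linear_combination hb
  have hB0 : B - 1 ≠ 0 := by
    rw [hB1]; exact mul_ne_zero (left_ne_zero_of_mul_eq_one hb) h1
  have hM : w * mLim (c * β) w = B / (B - 1) := by
    rw [← h2, hB1, hB, mul_div_assoc', mul_assoc β,
      mul_div_mul_left _ _ (left_ne_zero_of_mul_eq_one hb)]
  have hBf : ‖B‖ ≤ ‖f‖ := by
    rw [hB, norm_mul, norm_mul, hβ, one_mul]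
    exact mul_le_of_le_one_left (norm_nonneg _) hw.le
  have hN := Complex.normSq_pos.mpr hB0
  have hre : 1 - ‖B‖ ^ 2 = -2 * Complex.normSq (B - 1) * ((B / (B - 1)).re - 1 / 2) := by
    rw [Complex.div_re, ← add_div, ← Complex.normSq_eq_norm_sq]
    field_simp
    rw [Complex.normSq_apply, Complex.normSq_apply]
    simp
    ring
  have hN4 : Complex.normSq (B - 1) ≤ 4 := by
    rw [Complex.normSq_eq_norm_sq]
    have : ‖B - 1‖ ≤ 2 := (norm_sub_le _ _).trans (by rw [norm_one]; linarith)
    nlinarith [norm_nonneg (B - 1)]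
  rw [hM] at he
  obtain ⟨he1, he2⟩ := abs_le.mp he
  have h3 : ‖B‖ ^ 2 ≤ ‖f‖ ^ 2 := by gcongr
  nlinarith

section Limits

variable {t : ℝ} {α : ℕ → ℕ → ℂ} {α₀ : ℂ}

/-- The circle points that are not limits of zeros are close to `1`. -/
lemma HasGap.norm_one_sub_le (hα : ∀ n N, ‖α n N‖ < 1) (hα₀ : ‖α₀‖ ≤ 1)
    (hlim : RatioTendsto t α α₀) {β : ℂ} (hβ : ‖β‖ = 1) {n N : ℕ → ℕ} (h : RatioSeq t n N)
    {ξ : ℂ} (hξ : ‖ξ‖ = 1) (hgap : HasGap α β (fun j => n j + 1) N ξ) :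
    ‖1 - ξ‖ ≤ 2 * ‖α₀‖ := by
  have hc : ‖-conj α₀‖ ≤ 1 := by simpa using hα₀
  have hcn : ‖-conj α₀‖ = ‖α₀‖ := by simp
  obtain ⟨δ, hδ, hgap⟩ := hgap.ball
  set L := 1 / δ + 1 / δ ^ 2 with hL
  set m : ℕ → ℂ → ℂ := fun j z => (opuc (coeffs α (N j)) (n j)).eval z
    / (popuc (coeffs α (N j)) β (n j + 1)).eval z with hm
  -- At ξ itself Re(ξ m_j(ξ)) = 1/2 for all large j. The constant L bounds the change of w m_j(w),
  -- by 1/δ for the factor w and by 1/δ² for m_j.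
  have key : ∀ w ∈ Metric.ball ξ δ, ‖w‖ < 1 →
      |(w * mLim (-conj α₀ * β) w).re - 1 / 2| ≤ L * ‖w - ξ‖ := by
    intro w hwδ hw
    have h1 := tendsto_opuc_div_popuc_of_norm_lt hα hα₀ hlim hβ h hw
    have h2 : Tendsto (fun j => m j w) atTop (𝓝 (mLim (-conj α₀ * β) w)) :=
      h1.comp (tendsto_id.prodMk tendsto_const_nhds)
    have h3 : Tendsto (fun j => |(w * m j w).re - 1 / 2|) atTop
        (𝓝 |(w * mLim (-conj α₀ * β) w).re - 1 / 2|) :=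
      (((Complex.continuous_re.tendsto _).comp (h2.const_mul w)).sub_const (1 / 2)).abs
    refine le_of_tendsto h3 (hgap.mono fun j hj => ?_)
    have ha : ∀ k, ‖coeffs α (N j) k‖ < 1 := fun k => hα k (N j)
    have g1 := hj w hwδ
    have g2 := hj ξ (Metric.mem_ball_self hδ)
    have h4 := re_mul_opuc_div_popuc ha hβ hξ (popuc_eval_ne_zero_of_gap ha hβ hδ g2)
    have h5 := norm_opuc_div_popuc_le ha hβ hδ g1
    have h6 := norm_opuc_div_popuc_sub_le ha hβ hδ g1 g2
    change ‖m j w‖ ≤ _ at h5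
    change ‖m j w - m j ξ‖ ≤ _ at h6
    change (ξ * m j ξ).re = _ at h4
    rw [← h4, ← Complex.sub_re]
    refine (Complex.abs_re_le_norm _).trans ?_
    have e : w * m j w - ξ * m j ξ = (w - ξ) * m j w + ξ * (m j w - m j ξ) := by ring
    rw [e]
    refine (norm_add_le _ _).trans ?_
    rw [norm_mul, norm_mul, hξ, one_mul]
    calc _ ≤ ‖w - ξ‖ * (1 / δ) + ‖w - ξ‖ / δ ^ 2 := by gcongr
      _ = L * ‖w - ξ‖ := by rw [hL]; ring
  have hbound : ∀ w ∈ Metric.ball ξ δ, ‖w‖ < 1 →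
      ‖1 - w‖ ^ 2 * (1 - 8 * (L * ‖w - ξ‖)) ≤ (2 * ‖α₀‖) ^ 2 := by
    intro w hwδ hw
    have h1 := one_sub_norm_sq_constSchur_le hc hβ hw (key w hwδ hw)
    have h2 := norm_one_sub_mul_constSchur_le hc hw
    rw [hcn] at h2
    calc _ ≤ ‖1 - w‖ ^ 2 * ‖constSchur (-conj α₀) w‖ ^ 2 := by gcongr; linarith
      _ = (‖1 - w‖ * ‖constSchur (-conj α₀) w‖) ^ 2 := by ring
      _ ≤ _ := by gcongr
  have := nhdsWithin_ball_neBot hξ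
  have hcont : Tendsto (fun w => ‖1 - w‖ ^ 2 * (1 - 8 * (L * ‖w - ξ‖))) (𝓝[Metric.ball 0 1] ξ)
      (𝓝 (‖1 - ξ‖ ^ 2 * (1 - 8 * (L * ‖ξ - ξ‖)))) := by
    have : Continuous fun w => ‖1 - w‖ ^ 2 * (1 - 8 * (L * ‖w - ξ‖)) := by fun_prop
    exact (this.tendsto ξ).mono_left nhdsWithin_le_nhds
  have hle := le_of_tendsto hcont (b := (2 * ‖α₀‖) ^ 2) (by
    filter_upwards [self_mem_nhdsWithin, nhdsWithin_le_nhds (Metric.ball_mem_nhds ξ hδ)]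
      with w hw1 hw2 using hbound w hw2 (by simpa using hw1))
  rw [sub_self, norm_zero, mul_zero, mul_zero, sub_zero, mul_one] at hle
  exact (sq_le_sq₀ (norm_nonneg _) (by positivity)).mp hle

lemma norm_one_sub_exp_sq (θ : ℝ) :
    ‖1 - Complex.exp (θ * Complex.I)‖ ^ 2 = 2 - 2 * Real.cos θ := by
  rw [← Complex.normSq_eq_norm_sq, Complex.normSq_apply]
  simp only [Complex.sub_re, Complex.sub_im, Complex.one_re, Complex.one_im,
    Complex.exp_ofReal_mul_I_re, Complex.exp_ofReal_mul_I_im]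
  nlinarith [Real.sin_sq_add_cos_sq θ]

/-- Gaps are open, so near an arc point e^{iθ} with a gap all points of the circle satisfy |1 -
e^{is}| ≤ 2a, that is cos s ≥ 1 - 2a² ≥ cos θ. Then θ is a local minimum of cos; the value -1 would
need a ≥ 1, and 1 is not a local minimum value. -/
lemma HasGap.notMem_arc (hα : ∀ n N, ‖α n N‖ < 1) (hα₀ : ‖α₀‖ < 1)
    (hlim : RatioTendsto t α α₀) {β : ℂ} (hβ : ‖β‖ = 1) {n N : ℕ → ℕ} (h : RatioSeq t n N)
    {ξ : ℂ} (hgap : HasGap α β (fun j => n j + 1) N ξ) : ξ ∉ arc ‖α₀‖ := by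
  intro harc
  obtain ⟨hξ, hre⟩ := (mem_arc_iff (norm_nonneg _) hα₀.le).mp harc
  obtain ⟨θ, -, -, rfl⟩ := harc
  have hcont : Tendsto (fun s : ℝ => Complex.exp (s * Complex.I)) (𝓝 θ)
      (𝓝 (Complex.exp (θ * Complex.I))) :=
    Continuous.tendsto (by fun_prop) θ
  rw [Complex.exp_ofReal_mul_I_re] at hre
  have hmin : ∀ᶠ s in 𝓝 θ, Real.cos θ ≤ Real.cos s := by
    filter_upwards [hcont.eventually hgap.eventually] with s hs
    have h1 := hs.norm_one_sub_le hα hα₀.le hlim hβ h (Complex.norm_exp_ofReal_mul_I s)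
    have h2 := norm_one_sub_exp_sq s
    have h3 : ‖1 - Complex.exp (s * Complex.I)‖ ^ 2 ≤ (2 * ‖α₀‖) ^ 2 := by gcongr
    nlinarith
  -- so `cos` has a local minimum at `θ`
  have hsin : Real.sin θ = 0 := by
    have h1 : IsLocalMin Real.cos θ := hmin
    have h2 := h1.deriv_eq_zero
    simpa using h2
  have hcos : Real.cos θ = 1 := by
    have h1 := Real.sin_sq_add_cos_sq θ
    rw [hsin] at h1
    have h2 : (Real.cos θ - 1) * (Real.cos θ + 1) = 0 := by linear_combination h1
    rcases mul_eq_zero.mp h2 with h3 | h3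
    · linarith
    · exfalso
      have h4 := (hgap.norm_one_sub_le hα hα₀.le hlim hβ h hξ)
      have h5 := norm_one_sub_exp_sq θ
      have h6 : ‖1 - Complex.exp (θ * Complex.I)‖ ^ 2 ≤ (2 * ‖α₀‖) ^ 2 := by gcongr
      nlinarith [norm_nonneg α₀]
  -- near a maximum the cosine would be constant
  have hconst : ∀ᶠ s in 𝓝 θ, Real.cos s = 1 :=
    hmin.mono fun s hs => le_antisymm (Real.cos_le_one s) (hcos ▸ hs)
  have hder : ∀ᶠ s in 𝓝 θ, Real.sin s = 0 := hconst.mono fun s hs => by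
    have := Real.sin_sq_add_cos_sq s
    rw [hs] at this
    exact pow_eq_zero_iff two_ne_zero |>.mp (by linarith)
  have h1 : HasDerivAt Real.sin (Real.cos θ) θ := Real.hasDerivAt_sin θ
  have h2 : HasDerivAt Real.sin 0 θ := (hasDerivAt_const θ (0 : ℝ)).congr_of_eventuallyEq hder
  have := h1.unique h2
  linarith

lemma continuousAt_mLim_denom {c ξ : ℂ} (hG : ContinuousAt (G ‖c‖) ξ) :
    ContinuousAt (fun z => z * (1 + c) - G ‖c‖ z) ξ := by
  fun_prop

/-- The bound 1/δ on m_j shows that the limit has no pole at ξ, and the Lipschitz bound extends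
convergence from the disc. Only continuity of G at ξ is required, not ξ ∉ Γ_a, so that the point -1
can be treated when |α₀| = 1. -/
lemma HasGap.tendsto_of_norm_eq_one (hα : ∀ n N, ‖α n N‖ < 1) (hα₀ : ‖α₀‖ ≤ 1)
    (hα₀0 : α₀ ≠ 0) (hlim : RatioTendsto t α α₀) {β : ℂ} (hβ : ‖β‖ = 1) {n N : ℕ → ℕ}
    (h : RatioSeq t n N) {ξ : ℂ} (hξ : ‖ξ‖ = 1) (hgap : HasGap α β (fun j => n j + 1) N ξ)
    (hG : ContinuousAt (G ‖α₀‖) ξ) :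
    ξ * (1 + -conj α₀ * β) - G ‖α₀‖ ξ ≠ 0 ∧
    Tendsto (fun p : ℕ × ℂ => (opuc (coeffs α (N p.1)) (n p.1)).eval p.2
      / (popuc (coeffs α (N p.1)) β (n p.1 + 1)).eval p.2) (atTop ×ˢ 𝓝 ξ)
      (𝓝 (mLim (-conj α₀ * β) ξ)) := by
  have hcn : ‖-conj α₀ * β‖ = ‖α₀‖ := by rw [norm_mul_unit hβ]; simp
  set c := -conj α₀ * β with hc
  have hc0 : c ≠ 0 := by rw [← norm_ne_zero_iff, hcn]; exact norm_ne_zero_iff.mpr hα₀0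
  obtain ⟨δ, hδ, hgap⟩ := hgap.ball
  set m : ℕ → ℂ → ℂ := fun j z => (opuc (coeffs α (N j)) (n j)).eval z
    / (popuc (coeffs α (N j)) β (n j + 1)).eval z with hm
  have := nhdsWithin_ball_neBot hξ
  have hball : ∀ᶠ w in 𝓝[Metric.ball 0 1] ξ, w ∈ Metric.ball ξ δ ∧ ‖w‖ < 1 := by
    filter_upwards [self_mem_nhdsWithin, nhdsWithin_le_nhds (Metric.ball_mem_nhds ξ hδ)]
      with w hw1 hw2 using ⟨hw2, by simpa using hw1⟩
  have hp : ∀ w, ‖w‖ < 1 → Tendsto (fun j => m j w) atTop (𝓝 (mLim c w)) := fun w hw =>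
    (tendsto_opuc_div_popuc_of_norm_lt hα hα₀ hlim hβ h hw).comp
      (tendsto_id.prodMk tendsto_const_nhds)
  have hden : Tendsto (fun z => z * (1 + c) - G ‖c‖ z) (𝓝[Metric.ball 0 1] ξ)
      (𝓝 (ξ * (1 + c) - G ‖c‖ ξ)) :=
    (continuousAt_mLim_denom (hcn.symm ▸ hG)).tendsto.mono_left nhdsWithin_le_nhds
  -- boundedness forces the denominator not to vanish at `ξ`
  have hD : ξ * (1 + c) - G ‖c‖ ξ ≠ 0 := by
    have h1 : ‖c‖ ≤ 1 / δ * ‖ξ * (1 + c) - G ‖c‖ ξ‖ := by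
      refine ge_of_tendsto (hden.norm.const_mul (1 / δ)) (hball.mono fun w hw => ?_)
      have h2 : ‖mLim c w‖ ≤ 1 / δ := le_of_tendsto (hp w hw.2).norm (hgap.mono fun j hj =>
        norm_opuc_div_popuc_le (fun k => hα k (N j)) hβ hδ (hj w hw.1))
      have h3 := mFun_denom_ne_zero (hcn.trans_le hα₀) hw.2
      rwa [mLim, if_pos hw.2.le, norm_div, div_le_iff₀ (norm_pos_iff.mpr h3)] at h2
    intro h0
    rw [h0, norm_zero, mul_zero] at h1
    exact hc0 (norm_le_zero_iff.mp h1)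
  refine ⟨hcn ▸ hD, tendsto_joint_of_lipschitz (m := m) (M := mLim c) (L := 1 / δ ^ 2) hδ ?_
    (nhdsWithin_le_nhds (s := Metric.ball 0 1)) (hball.mono fun w hw => hp w hw.2) ?_⟩
  · refine hgap.mono fun j hj z hz w hw => ?_
    rw [one_div_mul_eq_div]
    exact norm_opuc_div_popuc_sub_le (fun k => hα k (N j)) hβ hδ (hj z hz) (hj w hw)
  · have h1 := (tendsto_const_nhds (x := c)).div hden hD
    rw [mLim, if_pos hξ.le]
    exact h1.congr' (hball.mono fun w hw => by rw [mLim, if_pos hw.2.le]; rfl)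

/-- Convergence of `Φ_n / Φ_{n+1}^{(β)}` at points without zeros nearby. -/
lemma HasGap.tendsto_opuc_div_popuc (hα : ∀ n N, ‖α n N‖ < 1) (hα₀ : ‖α₀‖ ≤ 1)
    (hlim : RatioTendsto t α α₀) {β : ℂ} (hβ : ‖β‖ = 1) {n N : ℕ → ℕ}
    (h : RatioSeq t n N) {z : ℂ} (hgap : HasGap α β (fun j => n j + 1) N z)
    (hz : ‖z‖ = 1 → α₀ ≠ 0 ∧ ContinuousAt (G ‖α₀‖) z) :
    (‖z‖ ≤ 1 → z * (1 + -conj α₀ * β) - G ‖α₀‖ z ≠ 0) ∧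
    Tendsto (fun p : ℕ × ℂ => (opuc (coeffs α (N p.1)) (n p.1)).eval p.2
      / (popuc (coeffs α (N p.1)) β (n p.1 + 1)).eval p.2) (atTop ×ˢ 𝓝 z)
      (𝓝 (mLim (-conj α₀ * β) z)) := by
  have hcn : ‖-conj α₀ * β‖ = ‖α₀‖ := by rw [norm_mul_unit hβ]; simp
  rcases lt_trichotomy ‖z‖ 1 with h1 | h1 | h1
  · refine ⟨fun _ => ?_, tendsto_opuc_div_popuc_of_norm_lt hα hα₀ hlim hβ h h1⟩
    rw [← hcn]
    exact mFun_denom_ne_zero (hcn.trans_le hα₀) h1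
  · obtain ⟨h2, h3⟩ := hgap.tendsto_of_norm_eq_one hα hα₀ (hz h1).1 hlim hβ h h1 (hz h1).2
    exact ⟨fun _ => h2, h3⟩
  · exact ⟨fun h2 => absurd h2 h1.not_ge,
      tendsto_opuc_div_popuc_of_one_lt_norm hα hα₀ hlim hβ h h1⟩

/-- The limiting form of `popuc_div_popuc`. The quadratic equation is a hypothesis because at -1, in
the case |c| = 1, it holds although the point is on the arc. -/
lemma mLim_mul_eq {c z : ℂ} (hc : ‖c‖ ≤ 1)
    (hq : G ‖c‖ z ^ 2 - (z + 1) * G ‖c‖ z + z * (1 - ((‖c‖ : ℝ) : ℂ) ^ 2) = 0)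
    (hD : ‖z‖ ≤ 1 → z * (1 + c) - G ‖c‖ z ≠ 0) :
    1 - c * z + z * mLim c z * (z * (1 + c) - (1 + conj c)) = G ‖c‖ z := by
  rw [norm_sq_eq_mul_conj] at hq
  rw [mLim]
  split_ifs with hz
  · have h1 := hD hz
    field_simp
    linear_combination hq
  · have h1 := mFun_denom_ne_zero' hc (not_le.mp hz)
    have hz0 : z ≠ 0 := by rintro rfl; simp at hz
    field_simp
    linear_combination -hq

/-- Convergence of `Φ_{n+1}^{(β)} / Φ_n^{(β)}` at points without zeros nearby. -/
lemma HasGap.tendsto_popuc_div_popuc (hα : ∀ n N, ‖α n N‖ < 1) (hα₀ : ‖α₀‖ ≤ 1)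
    (hlim : RatioTendsto t α α₀) {β : ℂ} (hβ : ‖β‖ = 1) {n N : ℕ → ℕ}
    (h : RatioSeq t n N) {z : ℂ} (hgap : HasGap α β n N z)
    (hz : ‖z‖ = 1 → α₀ ≠ 0 ∧ ContinuousAt (G ‖α₀‖) z)
    (hq : G ‖α₀‖ z ^ 2 - (z + 1) * G ‖α₀‖ z + z * (1 - ((‖α₀‖ : ℝ) : ℂ) ^ 2) = 0) :
    Tendsto (fun p : ℕ × ℂ => (popuc (coeffs α (N p.1)) β (n p.1 + 1)).eval p.2
      / (popuc (coeffs α (N p.1)) β (n p.1)).eval p.2) (atTop ×ˢ 𝓝 z) (𝓝 (G ‖α₀‖ z)) := by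
  have hcn : ‖-conj α₀ * β‖ = ‖α₀‖ := by rw [norm_mul_unit hβ]; simp
  have hpos : ∀ᶠ j in atTop, n j - 1 + 1 = n j :=
    (h.1.eventually_ge_atTop 1).mono fun j hj => Nat.sub_add_cancel hj
  have hgap' : HasGap α β (fun j => n j - 1 + 1) N z := by
    obtain ⟨δ, hδ, hg⟩ := hgap
    refine ⟨δ, hδ, ?_⟩
    filter_upwards [hg, hpos] with j hj hj'
    rwa [hj']
  obtain ⟨hD, hm⟩ := hgap'.tendsto_opuc_div_popuc hα hα₀ hlim hβ h.sub_one hz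
  have hne := hgap'.popuc_ne_zero hα hβ
  have hfst : Tendsto (fun p : ℕ × ℂ => p.1) ((atTop : Filter ℕ) ×ˢ 𝓝 z) atTop := tendsto_fst
  have hsnd : Tendsto (fun p : ℕ × ℂ => p.2) ((atTop : Filter ℕ) ×ˢ 𝓝 z) (𝓝 z) := tendsto_snd
  have hA : Tendsto (fun p : ℕ × ℂ => coeffs α (N p.1) (n p.1 - 1)) (atTop ×ˢ 𝓝 z) (𝓝 α₀) :=
    (hlim _ N h.sub_one).comp hfst
  have hA' := ((Complex.continuous_conj.tendsto α₀).comp hA).mul_const β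
  have hlimit := ((hsnd.mul hA').const_add 1).add ((hsnd.mul hm).mul
    ((hsnd.mul (hA'.const_sub 1)).sub ((hA.mul_const (conj β)).const_sub 1)))
  have e := mLim_mul_eq (c := -conj α₀ * β) (z := z) (hcn.trans_le hα₀) (by rwa [hcn])
    (by rwa [hcn])
  rw [hcn] at e
  have hconj : conj (-conj α₀ * β) = -(α₀ * conj β) := by simp
  have e' : 1 + z * (conj α₀ * β) + z * mLim (-conj α₀ * β) z
      * (z * (1 - conj α₀ * β) - (1 - α₀ * conj β)) = G ‖α₀‖ z := by
    rw [← e, hconj]; ring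
  rw [← e']
  refine hlimit.congr' ?_
  filter_upwards [hne, hfst.eventually hpos] with p hp hp1
  have := popuc_div_popuc (a := coeffs α (N p.1)) hβ (n p.1 - 1) hp
  rw [show n p.1 - 1 + 2 = n p.1 + 1 by omega, hp1] at this
  rw [this, hp1]
  rfl

/-- For `|α₀| = 1` the point `-1` is a limit of zeros. -/
lemma neg_one_mem_limitZeros (hα : ∀ n N, ‖α n N‖ < 1) (hα₀ : ‖α₀‖ = 1)
    (hlim : RatioTendsto t α α₀) {β : ℂ} (hβ : ‖β‖ = 1) {n N : ℕ → ℕ} (h : RatioSeq t n N) :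
    (-1 : ℂ) ∈ limitZeros α t β := by
  by_contra hmem
  have hα₀0 : α₀ ≠ 0 := by rw [← norm_ne_zero_iff, hα₀]; exact one_ne_zero
  have hgap := hasGap_of_notMem_limitZeros h hmem
  -- Gaps are needed at both indices: at n for the denominators and at n + 1 for the numerators, so
  -- that the reciprocal quotient is analytic near -1.
  obtain ⟨δ, hδ, hgap'⟩ := (hasGap_of_notMem_limitZeros h.add_one hmem).ball
  obtain ⟨δ', hδ', hball⟩ := Metric.eventually_nhds_iff_ball.mp hgap.eventually
  set ε := min δ δ' / 2 with hε
  have hmin : 0 < min δ δ' := lt_min hδ hδ'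
  have hε0 : 0 < ε := by positivity
  have hεδ : ε < δ := (half_lt_self hmin).trans_le (min_le_left _ _)
  have hεδ' : ε < δ' := (half_lt_self hmin).trans_le (min_le_right _ _)
  set F : ℕ → ℂ → ℂ := fun j z => (popuc (coeffs α (N j)) β (n j + 1)).eval z
    / (popuc (coeffs α (N j)) β (n j)).eval z with hF
  have hGeq : G ‖α₀‖ = fun z => z + 1 := by ext z; rw [hα₀, G_one]
  have hunif : TendstoUniformlyOn F (fun z => z + 1) atTop (Metric.closedBall (-1) ε) := by
    refine tendstoUniformlyOn_of_joint (isCompact_closedBall _ _) fun z hz => ?_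
    have hg := hball z (Metric.closedBall_subset_ball hεδ' hz)
    have h1 := hg.tendsto_popuc_div_popuc hα hα₀.le hlim hβ h
      (fun _ => ⟨hα₀0, by rw [hGeq]; fun_prop⟩) (by rw [hGeq, hα₀]; push_cast; ring)
    rw [hGeq] at h1
    exact h1.mono_left (Filter.prod_mono le_rfl nhdsWithin_le_nhds)
  have hu := Metric.tendstoUniformlyOn_iff.mp hunif (ε / 4) (by positivity)
  have hne := eventually_forall_of_isCompact (P := fun j z =>
      (popuc (coeffs α (N j)) β (n j)).eval z ≠ 0) (isCompact_closedBall (-1 : ℂ) ε) fun z hz =>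
    ((hball z (Metric.closedBall_subset_ball hεδ' hz)).popuc_ne_zero hα hβ).filter_mono
      (Filter.prod_mono le_rfl nhdsWithin_le_nhds)
  obtain ⟨j, hj1, hj2, hj3⟩ := (hu.and (hne.and hgap')).exists
  -- the maximum principle for the reciprocal
  set P := popuc (coeffs α (N j)) β (n j + 1) with hP
  set Q := popuc (coeffs α (N j)) β (n j) with hQ
  have hPne : ∀ z ∈ Metric.closedBall (-1 : ℂ) ε, P.eval z ≠ 0 := fun z hz =>
    popuc_eval_ne_zero_of_gap (fun k => hα k (N j)) hβ hδ
      (hj3 z (Metric.closedBall_subset_ball hεδ hz))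
  have hdiff : DiffContOnCl ℂ (fun z => Q.eval z / P.eval z) (Metric.ball (-1) ε) := by
    refine DifferentiableOn.diffContOnCl ?_
    rw [closure_ball _ hε0.ne']
    exact Q.differentiable.differentiableOn.div P.differentiable.differentiableOn hPne
  -- The limit z + 1 has modulus ε on the circle of radius ε about -1 and vanishes at the centre.
  -- With approximation error below ε/4, the quotient is at least 3ε/4 on the circle and below ε/4
  -- at the centre.
  have hfront : ∀ z ∈ frontier (Metric.ball (-1 : ℂ) ε), ‖Q.eval z / P.eval z‖ ≤ 1 / (3 * ε / 4) := by
    intro z hz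
    rw [frontier_ball _ hε0.ne'] at hz
    have hzc := Metric.sphere_subset_closedBall hz
    have h1 := hj1 z hzc
    have h2 : ‖z + 1‖ = ε := by
      rw [mem_sphere_iff_norm] at hz
      simpa using hz
    rw [dist_eq_norm] at h1
    have h3 : ‖z + 1‖ - ‖z + 1 - F j z‖ ≤ ‖F j z‖ := by
      have := norm_sub_norm_le (z + 1) (z + 1 - F j z)
      simpa using this
    have h4 : 3 * ε / 4 ≤ ‖F j z‖ := by linarith
    have h5 : Q.eval z / P.eval z = 1 / F j z := by rw [hF, one_div_div]
    rw [h5, norm_div, norm_one]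
    exact one_div_le_one_div_of_le (by positivity) h4
  have hmax := Complex.norm_le_of_forall_mem_frontier_norm_le Metric.isBounded_ball hdiff hfront
    (subset_closure (Metric.mem_ball_self hε0))
  have hc0 : (-1 : ℂ) ∈ Metric.closedBall (-1 : ℂ) ε := Metric.mem_closedBall_self hε0.le
  have h1 := hj1 (-1) hc0
  rw [neg_add_cancel, dist_zero_left] at h1
  have h5 : Q.eval (-1) / P.eval (-1) = 1 / F j (-1) := by rw [hF, one_div_div]
  have hFne : F j (-1) ≠ 0 := div_ne_zero (hPne _ hc0) (hj2 _ hc0)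
  rw [h5, norm_div, norm_one] at hmax
  have h6 := (one_div_le_one_div (norm_pos_iff.mpr hFne) (by positivity)).mp hmax
  linarith

/-- The arc consists of limits of zeros. -/
lemma arc_subset_limitZeros (hα : ∀ n N, ‖α n N‖ < 1) (hα₀ : ‖α₀‖ ≤ 1)
    (hlim : RatioTendsto t α α₀) {β : ℂ} (hβ : ‖β‖ = 1) {n N : ℕ → ℕ} (h : RatioSeq t n N) :
    arc ‖α₀‖ ⊆ limitZeros α t β := by
  intro ξ hξ
  by_contra hmem
  rcases hα₀.lt_or_eq with h1 | h1
  · exact (hasGap_of_notMem_limitZeros h.add_one hmem).notMem_arc hα h1 hlim hβ h hξ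
  · obtain ⟨h2, h3⟩ := (mem_arc_iff (norm_nonneg _) hα₀).mp hξ
    rw [h1] at h3
    have h4 : ξ.re * ξ.re + ξ.im * ξ.im = 1 := by
      rw [← Complex.normSq_apply, Complex.normSq_eq_norm_sq, h2, one_pow]
    have h5 : ξ = -1 := by
      apply Complex.ext
      · simp only [Complex.neg_re, Complex.one_re]; nlinarith
      · simp only [Complex.neg_im, Complex.one_im, neg_zero]
        exact pow_eq_zero_iff two_ne_zero |>.mp (by nlinarith)
    exact hmem (h5 ▸ neg_one_mem_limitZeros hα h1 hlim hβ h)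

end Limits

/-! ### Consequences for the other quotients -/

/-- Inverts the passage from the Schur function to m, namely m = f / (zf - 1) with the parameter β
absorbed in c. For c = 0 the denominator zm - 1 vanishes in the exterior. -/
lemma mLim_div_sub_one {c z : ℂ} (hc : ‖c‖ ≤ 1) (hc0 : c ≠ 0)
    (hq : G ‖c‖ z ^ 2 - (z + 1) * G ‖c‖ z + z * (1 - ((‖c‖ : ℝ) : ℂ) ^ 2) = 0)
    (hG : G ‖c‖ z ≠ z) (hD : ‖z‖ ≤ 1 → z * (1 + c) - G ‖c‖ z ≠ 0) :
    z * mLim c z - 1 ≠ 0 ∧ mLim c z / (z * mLim c z - 1) = constSchur c z := by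
  have hG' := sub_ne_zero.mpr hG
  rw [norm_sq_eq_mul_conj] at hq
  by_cases hz : ‖z‖ ≤ 1
  · have h1 := hD hz
    have e : z * mLim c z - 1 = (G ‖c‖ z - z) / (z * (1 + c) - G ‖c‖ z) := by
      rw [mLim, if_pos hz]
      field_simp
      ring
    refine ⟨e ▸ div_ne_zero hG' h1, ?_⟩
    rw [e, mLim, if_pos hz, div_div_div_cancel_right₀ h1, constSchur]
  · have h1 := mFun_denom_ne_zero' hc (not_le.mp hz)
    have hz0 : z ≠ 0 := by rintro rfl; simp at hz
    have hcc : conj c ≠ 0 := by simpa using hc0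
    have e : z * mLim c z - 1 = conj c / (G ‖c‖ z - 1 - conj c) := by
      rw [mLim, if_neg hz]
      field_simp
      ring
    refine ⟨e ▸ div_ne_zero hcc h1, ?_⟩
    rw [e, mLim, if_neg hz, constSchur]
    field_simp
    linear_combination hq

/-! ### Convergence of the quotients off the limiting zero sets. -/

section Limits

variable {t : ℝ} {α : ℕ → ℕ → ℂ} {α₀ : ℂ}

lemma of_notMem_limitZeros (hα : ∀ n N, ‖α n N‖ < 1) (hα₀ : ‖α₀‖ ≤ 1)
    (hlim : RatioTendsto t α α₀) {β : ℂ} (hβ : ‖β‖ = 1) {n N : ℕ → ℕ} (h : RatioSeq t n N)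
    {z : ℂ} (hz : z ∉ limitZeros α t β) :
    z ∉ arc ‖α₀‖ ∧ (‖z‖ = 1 → α₀ ≠ 0 ∧ ContinuousAt (G ‖α₀‖) z) := by
  have harc : z ∉ arc ‖α₀‖ := fun hmem => hz (arc_subset_limitZeros hα hα₀ hlim hβ h hmem)
  refine ⟨harc, fun hz1 => ⟨?_, continuousAt_G (norm_nonneg _) hα₀ harc⟩⟩
  rintro rfl
  -- For α₀ = 0 the arc is the whole circle, so no point of the circle remains.
  refine harc ((mem_arc_iff (norm_nonneg _) hα₀).mpr ⟨hz1, ?_⟩)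
  simpa [hz1] using Complex.re_le_norm z

theorem tendsto_opuc_div_popuc (hα : ∀ n N, ‖α n N‖ < 1) (hα₀ : ‖α₀‖ ≤ 1)
    (hlim : RatioTendsto t α α₀) {β : ℂ} (hβ : ‖β‖ = 1) :
    RatioTendstoOnCompacts t
      (fun n N => opuc (coeffs α N) n) (fun n N => popuc (coeffs α N) β (n + 1))
      (mFun (-conj α₀ * β)) (limitZeros α t β)ᶜ := by
  refine ratioTendstoOnCompacts_of_joint fun n N h z hz => ?_
  have hcn : ‖-conj α₀ * β‖ = ‖α₀‖ := by rw [norm_mul_unit hβ]; simp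
  obtain ⟨harc, hz1⟩ := of_notMem_limitZeros hα hα₀ hlim hβ h hz
  have hgap := hasGap_of_notMem_limitZeros h.add_one hz
  obtain ⟨hD, hm⟩ := hgap.tendsto_opuc_div_popuc hα hα₀ hlim hβ h hz1
  refine ⟨hgap.popuc_ne_zero hα hβ, ?_⟩
  have e : mFun (-conj α₀ * β) z = mLim (-conj α₀ * β) z := by
    rw [← hcn] at harc hD hα₀
    by_cases hzn : ‖z‖ ≤ 1
    · rw [(mFun_eq hα₀ harc (hD hzn)).2, mLim, if_pos hzn]
    · have hz0 : z ≠ 0 := by rintro rfl; simp at hzn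
      rw [mFun_eq' hα₀ harc hz0 (mFun_denom_ne_zero' hα₀ (not_le.mp hzn)), mLim, if_neg hzn]
  rw [e]
  exact hm

theorem tendsto_popuc_succ_div_popuc (hα : ∀ n N, ‖α n N‖ < 1) (hα₀ : ‖α₀‖ ≤ 1)
    (hlim : RatioTendsto t α α₀) {β : ℂ} (hβ : ‖β‖ = 1) :
    RatioTendstoOnCompacts t
      (fun n N => popuc (coeffs α N) β (n + 1)) (fun n N => popuc (coeffs α N) β n)
      (G ‖α₀‖) (limitZeros α t β)ᶜ := by
  refine ratioTendstoOnCompacts_of_joint fun n N h z hz => ?_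
  obtain ⟨harc, hz1⟩ := of_notMem_limitZeros hα hα₀ hlim hβ h hz
  have hgap := hasGap_of_notMem_limitZeros h hz
  exact ⟨hgap.popuc_ne_zero hα hβ,
    hgap.tendsto_popuc_div_popuc hα hα₀ hlim hβ h hz1 (G_quadratic harc)⟩

/-- The Schur iterates converge at every point that is not a limit of zeros for some `β`. -/
lemma tendsto_schurIter_of_notMem (hα : ∀ n N, ‖α n N‖ < 1) (hα₀ : ‖α₀‖ ≤ 1) (hα₀0 : α₀ ≠ 0)
    (hlim : RatioTendsto t α α₀) {n N : ℕ → ℕ} (h : RatioSeq t n N) {z : ℂ}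
    (hz : z ∉ limitZerosInter α t) :
    z ∉ arc ‖α₀‖ ∧ G ‖α₀‖ z ≠ z ∧
    (∀ᶠ p : ℕ × ℂ in atTop ×ˢ 𝓝 z, (opucStar (coeffs α (N p.1)) (n p.1)).eval p.2 ≠ 0) ∧
    Tendsto (fun p : ℕ × ℂ => schurIter (coeffs α (N p.1)) (n p.1) p.2) (atTop ×ˢ 𝓝 z)
      (𝓝 (constSchur (-conj α₀) z)) := by
  simp only [limitZerosInter, Set.mem_ofPred_eq, not_forall] at hz
  obtain ⟨β, hβ, hz⟩ := hz
  have hcn : ‖-conj α₀ * β‖ = ‖α₀‖ := by rw [norm_mul_unit hβ]; simp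
  obtain ⟨harc, hz1⟩ := of_notMem_limitZeros hα hα₀ hlim hβ h hz
  have hGz := G_ne_self (norm_nonneg _) hα₀ harc (Or.inl (norm_ne_zero_iff.mpr hα₀0))
  have hgap := hasGap_of_notMem_limitZeros h.add_one hz
  obtain ⟨hD, hm⟩ := hgap.tendsto_opuc_div_popuc hα hα₀ hlim hβ h hz1
  have hb := mul_conj_of_norm_eq_one hβ
  have hβ0 : β ≠ 0 := left_ne_zero_of_mul_eq_one hb
  obtain ⟨h1, h2⟩ := mLim_div_sub_one (c := -conj α₀ * β) (z := z) (hcn.trans_le hα₀)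
    (mul_ne_zero (by simpa using hα₀0) hβ0) (by rw [hcn]; exact G_quadratic harc)
    (by rwa [hcn]) (by rwa [hcn])
  have hsnd : Tendsto (fun p : ℕ × ℂ => p.2) ((atTop : Filter ℕ) ×ˢ 𝓝 z) (𝓝 z) := tendsto_snd
  -- Since zΦ_n - Φ_{n+1}^{(β)} = conj β Φ_n^*, the function β(z m_n - 1) is Φ_n^* / Φ_{n+1}^{(β)}.
  -- Its nonzero limit keeps Φ_n^* free of zeros near z, and f_n is the quotient of m_n by it.
  have hs := ((hsnd.mul hm).sub_const 1).const_mul β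
  have hs0 := mul_ne_zero hβ0 h1
  have hquot : ∀ᶠ p : ℕ × ℂ in atTop ×ˢ 𝓝 z,
      β * (p.2 * ((opuc (coeffs α (N p.1)) (n p.1)).eval p.2
        / (popuc (coeffs α (N p.1)) β (n p.1 + 1)).eval p.2) - 1)
      = (opucStar (coeffs α (N p.1)) (n p.1)).eval p.2
        / (popuc (coeffs α (N p.1)) β (n p.1 + 1)).eval p.2 := by
    filter_upwards [hgap.popuc_ne_zero hα hβ] with p hp
    change (popuc (coeffs α (N p.1)) β (n p.1 + 1)).eval p.2 ≠ 0 at hp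
    rw [mul_div_assoc', div_sub_one hp, mul_div_assoc']
    congr 1
    rw [eval_popuc_succ]
    linear_combination (opucStar (coeffs α (N p.1)) (n p.1)).eval p.2 * hb
  have hne : ∀ᶠ p : ℕ × ℂ in atTop ×ˢ 𝓝 z,
      (opucStar (coeffs α (N p.1)) (n p.1)).eval p.2 ≠ 0 := by
    filter_upwards [hquot, hs.eventually_ne hs0] with p hp hp0 h0
    rw [hp, h0, zero_div] at hp0
    exact hp0 rfl
  refine ⟨harc, hGz, hne, ?_⟩
  have e : constSchur (-conj α₀) z
      = mLim (-conj α₀ * β) z / (β * (z * mLim (-conj α₀ * β) z - 1)) := by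
    rw [mul_comm β, ← div_div, h2, constSchur, constSchur, hcn, show ‖-conj α₀‖ = ‖α₀‖ by simp]
    field_simp
  rw [e]
  refine (hm.div hs hs0).congr' ?_
  filter_upwards [hquot, hgap.popuc_ne_zero hα hβ] with p hp hp0
  rw [Pi.div_apply, hp]
  exact div_div_div_cancel_right₀ hp0 _ _

lemma schurFun_eq_constSchur (hα₀ : ‖α₀‖ ≤ 1) {z : ℂ} (hz : z ∉ arc ‖α₀‖)
    (h : α₀ ≠ 0 ∨ ‖z‖ < 1) : schurFun (-conj α₀) z = constSchur (-conj α₀) z := by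
  have hcn : ‖-conj α₀‖ = ‖α₀‖ := by simp
  rw [constSchur]
  exact schurFun_eq (hcn.trans_le hα₀) (by rwa [hcn]) (h.imp_left fun h => by simpa using h)

theorem tendsto_opuc_div_opucStar (hα : ∀ n N, ‖α n N‖ < 1) (hα₀ : ‖α₀‖ ≤ 1) (hα₀0 : α₀ ≠ 0)
    (hlim : RatioTendsto t α α₀) :
    RatioTendstoOnCompacts t
      (fun n N => opuc (coeffs α N) n) (fun n N => opucStar (coeffs α N) n)
      (schurFun (-conj α₀)) (limitZerosInter α t)ᶜ := by
  refine ratioTendstoOnCompacts_of_joint fun n N h z hz => ?_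
  obtain ⟨harc, -, hne, hs⟩ := tendsto_schurIter_of_notMem hα hα₀ hα₀0 hlim h hz
  rw [schurFun_eq_constSchur hα₀ harc (Or.inl hα₀0)]
  exact ⟨hne, hs⟩

theorem tendsto_opuc_div_opucStar_ball (hα : ∀ n N, ‖α n N‖ < 1) (hα₀ : ‖α₀‖ ≤ 1)
    (hlim : RatioTendsto t α α₀) :
    RatioTendstoOnCompacts t
      (fun n N => opuc (coeffs α N) n) (fun n N => opucStar (coeffs α N) n)
      (schurFun (-conj α₀)) (Metric.ball 0 1) := by
  refine ratioTendstoOnCompacts_of_joint fun n N h z hz => ?_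
  have hz1 : ‖z‖ < 1 := by simpa using hz
  rw [schurFun_eq_constSchur hα₀ (notMem_arc_of_norm_ne_one (norm_nonneg _) hα₀ hz1.ne)
    (Or.inr hz1)]
  refine ⟨?_, tendsto_schurIter hα hα₀ hlim h hz1⟩
  filter_upwards [tendsto_snd.eventually ((continuous_norm.tendsto z).eventually_lt_const hz1)]
    with p hp
  exact (opucStar_dominates (fun k => hα k (N p.1)) (n p.1) (le_of_lt hp)).1

theorem tendsto_opucStar_succ_div_opucStar (hα : ∀ n N, ‖α n N‖ < 1) (hα₀ : ‖α₀‖ ≤ 1)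
    (hα₀0 : α₀ ≠ 0) (hlim : RatioTendsto t α α₀) :
    RatioTendstoOnCompacts t
      (fun n N => opucStar (coeffs α N) (n + 1)) (fun n N => opucStar (coeffs α N) n)
      (G ‖α₀‖) (limitZerosInter α t)ᶜ := by
  refine ratioTendstoOnCompacts_of_joint fun n N h z hz => ?_
  obtain ⟨harc, hGz, hne, hs⟩ := tendsto_schurIter_of_notMem hα hα₀ hα₀0 hlim h hz
  refine ⟨hne, ?_⟩
  have hA : Tendsto (fun p : ℕ × ℂ => coeffs α (N p.1) (n p.1)) (atTop ×ˢ 𝓝 z) (𝓝 α₀) :=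
    (hlim n N h).comp tendsto_fst
  have hsnd : Tendsto (fun p : ℕ × ℂ => p.2) ((atTop : Filter ℕ) ×ˢ 𝓝 z) (𝓝 z) := tendsto_snd
  -- Φ_{n+1}^* / Φ_n^* = 1 - α_n z f_n by the recurrence; the quadratic equation identifies the
  -- limit with G.
  have e : 1 - α₀ * (z * constSchur (-conj α₀) z) = G ‖α₀‖ z := by
    have hq := G_quadratic harc
    have hG' := sub_ne_zero.mpr hGz
    rw [norm_sq_eq_mul_conj] at hq
    rw [constSchur, show ‖-conj α₀‖ = ‖α₀‖ by simp]
    field_simp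
    linear_combination -hq
  rw [← e]
  refine ((hA.mul (hsnd.mul hs)).const_sub 1).congr' ?_
  filter_upwards [hne] with p hp
  simp only [eval_opucStar_succ, schurIter]
  field_simp

theorem tendsto_opuc_succ_div_opuc (hα : ∀ n N, ‖α n N‖ < 1) (hα₀ : ‖α₀‖ ≤ 1)
    (hα₀0 : α₀ ≠ 0) (hlim : RatioTendsto t α α₀) :
    RatioTendstoOnCompacts t
      (fun n N => opuc (coeffs α N) (n + 1)) (fun n N => opuc (coeffs α N) n)
      (G ‖α₀‖) (limitZerosInter α t)ᶜ := by
  refine ratioTendstoOnCompacts_of_joint fun n N h z hz => ?_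
  obtain ⟨harc, hGz, hne, hs⟩ := tendsto_schurIter_of_notMem hα hα₀ hα₀0 hlim h hz
  have hG' := sub_ne_zero.mpr hGz
  have hc0 : conj α₀ ≠ 0 := by simpa using hα₀0
  have hcs : constSchur (-conj α₀) z = -conj α₀ / (G ‖α₀‖ z - z) := by
    rw [constSchur, show ‖-conj α₀‖ = ‖α₀‖ by simp]
  have hs0 : constSchur (-conj α₀) z ≠ 0 := hcs ▸ div_ne_zero (neg_ne_zero.mpr hc0) hG'
  have hne' : ∀ᶠ p : ℕ × ℂ in atTop ×ˢ 𝓝 z,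
      (opuc (coeffs α (N p.1)) (n p.1)).eval p.2 ≠ 0 := by
    filter_upwards [hs.eventually_ne hs0] with p hp h0
    exact hp (by rw [schurIter, h0, zero_div])
  refine ⟨hne', ?_⟩
  have hA : Tendsto (fun p : ℕ × ℂ => conj (coeffs α (N p.1) (n p.1))) (atTop ×ˢ 𝓝 z)
      (𝓝 (conj α₀)) :=
    (Complex.continuous_conj.tendsto α₀).comp ((hlim n N h).comp tendsto_fst)
  have hsnd : Tendsto (fun p : ℕ × ℂ => p.2) ((atTop : Filter ℕ) ×ˢ 𝓝 z) (𝓝 z) := tendsto_snd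
  -- Φ_{n+1} / Φ_n = z - conj α_n / f_n. The division is legitimate because the limit of f_n is
  -- nonzero for α₀ ≠ 0.
  have e : z - conj α₀ / constSchur (-conj α₀) z = G ‖α₀‖ z := by
    rw [hcs]
    field_simp
    ring
  rw [← e]
  refine (hsnd.sub (hA.div hs hs0)).congr' ?_
  filter_upwards [hne, hne'] with p hp hp'
  simp only [eval_opuc_succ, schurIter, Pi.div_apply]
  field_simp

/-! ### The case of vanishing limit -/

lemma extendFrom_G_zero_ball {z : ℂ} (hz : ‖z‖ ≤ 1) : extendFrom (Metric.ball 0 1) (G 0) z = 1 := by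
  refine extendFrom_eq (by rw [closure_ball 0 one_ne_zero]; simpa using hz) ?_
  refine tendsto_const_nhds.congr' ?_
  filter_upwards [self_mem_nhdsWithin] with w hw
  exact (G_zero_of_norm_lt (by simpa using hw)).symm

lemma extendFrom_G_zero_compl {z : ℂ} (hz : 1 ≤ ‖z‖) :
    extendFrom (Metric.closedBall 0 1)ᶜ (G 0) z = z := by
  refine extendFrom_eq ?_ ?_
  · rw [closure_compl, interior_closedBall 0 one_ne_zero]
    simpa using hz
  · refine ((tendsto_id (x := 𝓝 z)).mono_left nhdsWithin_le_nhds).congr' ?_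
    filter_upwards [self_mem_nhdsWithin] with w hw
    exact (G_zero_of_one_lt_norm (by simpa using hw)).symm

/-- The recurrence and domination give |Φ_{n+1}^* / Φ_n^* - 1| = |α_n| |zΦ_n / Φ_n^*| ≤ |α_n| on the
whole closed disc, so zeros of the paraorthogonal polynomials play no role. -/
theorem tendsto_opucStar_succ_div_opucStar_of_zero (hα : ∀ n N, ‖α n N‖ < 1)
    (hlim : RatioTendsto t α 0) :
    RatioTendstoOnCompacts t
      (fun n N => opucStar (coeffs α N) (n + 1)) (fun n N => opucStar (coeffs α N) n)
      (extendFrom (Metric.ball 0 1) (G 0)) (Metric.closedBall 0 1) := by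
  intro n N h K hK _
  have hK1 : ∀ z ∈ K, ‖z‖ ≤ 1 := fun z hz => by simpa using hK hz
  refine ⟨Eventually.of_forall fun j z hz =>
    (opucStar_dominates (fun k => hα k (N j)) (n j) (hK1 z hz)).1, ?_⟩
  rw [Metric.tendstoUniformlyOn_iff]
  intro ε hε
  filter_upwards [Metric.tendsto_nhds.mp (hlim n N h) ε hε] with j hj z hz
  have hz1 := hK1 z hz
  obtain ⟨h1, h2⟩ := opucStar_dominates (a := coeffs α (N j)) (fun k => hα k (N j)) (n j) hz1
  rw [extendFrom_G_zero_ball hz1, dist_eq_norm, eval_opucStar_succ, one_sub_div h1, sub_sub_cancel,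
    norm_div, div_lt_iff₀ (norm_pos_iff.mpr h1), norm_mul, norm_mul]
  rw [dist_zero_right] at hj
  have h3 : ‖z‖ * ‖(opuc (coeffs α (N j)) (n j)).eval z‖
      ≤ ‖(opucStar (coeffs α (N j)) (n j)).eval z‖ :=
    (mul_le_of_le_one_left (norm_nonneg _) hz1).trans h2
  exact (mul_le_mul_of_nonneg_left h3 (norm_nonneg _)).trans_lt
    (mul_lt_mul_of_pos_right hj (norm_pos_iff.mpr h1))

/-- The same estimate outside the open disc: |Φ_{n+1} / Φ_n - z| = |α_n| |Φ_n^* / Φ_n| ≤ |α_n|. -/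
theorem tendsto_opuc_succ_div_opuc_of_zero (hα : ∀ n N, ‖α n N‖ < 1)
    (hlim : RatioTendsto t α 0) :
    RatioTendstoOnCompacts t
      (fun n N => opuc (coeffs α N) (n + 1)) (fun n N => opuc (coeffs α N) n)
      (extendFrom (Metric.closedBall 0 1)ᶜ (G 0)) (Metric.ball 0 1)ᶜ := by
  intro n N h K hK _
  have hK1 : ∀ z ∈ K, 1 ≤ ‖z‖ := fun z hz => by simpa using hK hz
  refine ⟨Eventually.of_forall fun j z hz =>
    (opuc_dominates (fun k => hα k (N j)) (n j) (hK1 z hz)).1, ?_⟩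
  rw [Metric.tendstoUniformlyOn_iff]
  intro ε hε
  filter_upwards [Metric.tendsto_nhds.mp (hlim n N h) ε hε] with j hj z hz
  have hz1 := hK1 z hz
  obtain ⟨h1, h2⟩ := opuc_dominates (a := coeffs α (N j)) (fun k => hα k (N j)) (n j) hz1
  rw [extendFrom_G_zero_compl hz1, dist_eq_norm, eval_opuc_succ, sub_div' h1, sub_sub_cancel,
    norm_div, div_lt_iff₀ (norm_pos_iff.mpr h1), norm_mul, RCLike.norm_conj]
  rw [dist_zero_right] at hj
  exact (mul_le_mul_of_nonneg_left h2 (norm_nonneg _)).trans_lt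
    (mul_lt_mul_of_pos_right hj (norm_pos_iff.mpr h1))

end Limits

end VaryingOPUC

theorem theorem3p3 (β : ℂ) (hβ : ‖β‖ = 1) (t : ℝ) (ht : 0 < t)
    (α : ℕ → ℕ → ℂ) (hα : ∀ n N, ‖α n N‖ < 1)
    (α₀ : ℂ) (hα₀ : ‖α₀‖ ≤ 1) (hlim : RatioTendsto t α α₀) :
    -- `Φ_n / Φ_{n+1}^{(β)}`
    RatioTendstoOnCompacts t
      (fun n N => opuc (coeffs α N) n) (fun n N => popuc (coeffs α N) β (n + 1))
      (mFun (-conj α₀ * β)) (limitZeros α t β)ᶜ ∧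
    -- `Φ_n / Φ_n^*`
    (α₀ ≠ 0 → RatioTendstoOnCompacts t
      (fun n N => opuc (coeffs α N) n) (fun n N => opucStar (coeffs α N) n)
      (schurFun (-conj α₀)) (limitZerosInter α t)ᶜ) ∧
    (α₀ = 0 → RatioTendstoOnCompacts t
      (fun n N => opuc (coeffs α N) n) (fun n N => opucStar (coeffs α N) n)
      (schurFun (-conj α₀)) (Metric.ball 0 1)) ∧
    -- `Φ_{n+1}^* / Φ_n^*`; for `α₀ = 0` the values of `G_0` on the circle are limits from inside
    (α₀ ≠ 0 → RatioTendstoOnCompacts t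
      (fun n N => opucStar (coeffs α N) (n + 1)) (fun n N => opucStar (coeffs α N) n)
      (G ‖α₀‖) (limitZerosInter α t)ᶜ) ∧
    (α₀ = 0 → RatioTendstoOnCompacts t
      (fun n N => opucStar (coeffs α N) (n + 1)) (fun n N => opucStar (coeffs α N) n)
      (extendFrom (Metric.ball 0 1) (G 0)) (Metric.closedBall 0 1)) ∧
    -- `Φ_{n+1} / Φ_n`; for `α₀ = 0` the values of `G_0` on the circle are limits from outside
    (α₀ ≠ 0 → RatioTendstoOnCompacts t
      (fun n N => opuc (coeffs α N) (n + 1)) (fun n N => opuc (coeffs α N) n)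
      (G ‖α₀‖) (limitZerosInter α t)ᶜ) ∧
    (α₀ = 0 → RatioTendstoOnCompacts t
      (fun n N => opuc (coeffs α N) (n + 1)) (fun n N => opuc (coeffs α N) n)
      (extendFrom (Metric.closedBall 0 1)ᶜ (G 0)) (Metric.ball 0 1)ᶜ) ∧
    -- `Φ_{n+1}^{(β)} / Φ_n^{(β)}`
    RatioTendstoOnCompacts t
      (fun n N => popuc (coeffs α N) β (n + 1)) (fun n N => popuc (coeffs α N) β n)
      (G ‖α₀‖) (limitZeros α t β)ᶜ :=
  ⟨tendsto_opuc_div_popuc hα hα₀ hlim hβ,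
    fun h => tendsto_opuc_div_opucStar hα hα₀ h hlim,
    fun _ => tendsto_opuc_div_opucStar_ball hα hα₀ hlim,
    fun h => tendsto_opucStar_succ_div_opucStar hα hα₀ h hlim,
    fun h => tendsto_opucStar_succ_div_opucStar_of_zero hα (h ▸ hlim),
    fun h => tendsto_opuc_succ_div_opuc hα hα₀ h hlim,
    fun h => tendsto_opuc_succ_div_opuc_of_zero hα (h ▸ hlim),
    tendsto_popuc_succ_div_popuc hα hα₀ hlim hβ⟩
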